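/- There is an algorithm that, given a finite simple undirected graph $G$, a tree decomposition $(T,B)$ of $G$ of width $\mathrm{tw}$ and a positive integer $t$, computes the number of feedback vertex sets of $G$ of size $t$ modulo $2$ in time $O(3^{\mathrm{tw}}\,n^{c})$, where $n$ is the size of the input and $c$ is a constant; neither $c$ nor the constant hidden in the $O$-notation depends on the input. Here a feedback vertex set of $G$ is a set $S\subseteq V(G)$ such that $G-S$ is a forest, and the width of $(T,B)$ is $\max_{x\in V(T)}|B(x)|-1$. The algorithm is a single program for a random access machine, time is measured under the logarithmic cost criterion (every instruction is charged at least in proportion to the bit lengths of the numbers and addresses it handles), and $G$, $T$ and $B$ are given by their adjacency and incidence matrices. -/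

import Mathlib

/-! ### A random access machine with logarithmic cost

Programs are finite structured programs (sequencing, branching, loops) over finitely many registers
and an unbounded memory, all of them holding natural numbers. The memory is accessed by indirect
addressing. Every instruction is charged according to the bit lengths of the numbers (operands,
addresses, contents) that it handles. -/

namespace RAM

/-- A configuration: the contents of the registers and of the memory cells. -/
structure State where
  reg : ℕ → ℕ
  mem : ℕ → ℕ

/-- The arithmetic operations of the machine; subtraction is truncated, division is integral. -/
inductive BinOp where
  | add
  | sub
  | mul
  | div
  | mod

/-- The function computed by an arithmetic operation. -/
def BinOp.eval : BinOp → ℕ → ℕ → ℕ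
  | .add, x, y => x + y
  | .sub, x, y => x - y
  | .mul, x, y => x * y
  | .div, x, y => x / y
  | .mod, x, y => x % y

/-- The elementary instructions. The arguments `d`, `a`, `b` are names of registers. -/
inductive Instr where
  /-- `reg d := c` -/
  | const (d c : ℕ)
  /-- `reg d := reg a ∘ reg b` -/
  | arith (o : BinOp) (d a b : ℕ)
  /-- `reg d := mem[reg a]` -/
  | load (d a : ℕ)
  /-- `mem[reg a] := reg b` -/
  | store (a b : ℕ)

/-- The effect of an instruction. -/
def Instr.exec : Instr → State → State
  | .const d c, s => { s with reg := Function.update s.reg d c }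
  | .arith o d a b, s => { s with reg := Function.update s.reg d (o.eval (s.reg a) (s.reg b)) }
  | .load d a, s => { s with reg := Function.update s.reg d (s.mem (s.reg a)) }
  | .store a b, s => { s with mem := Function.update s.mem (s.reg a) (s.reg b) }

/-- The cost of an instruction. Here `Nat.size x` is the length of `x` in binary. Arithmetic is
charged at the cost of the schoolbook methods for multiplication and division. -/
def Instr.cost : Instr → State → ℕ
  | .const _ c, _ => Nat.size c + 1
  | .arith _ _ a b, s => (Nat.size (s.reg a) + 1) * (Nat.size (s.reg b) + 1)
  | .load _ a, s => Nat.size (s.reg a) + Nat.size (s.mem (s.reg a)) + 1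
  | .store a b, s => Nat.size (s.reg a) + Nat.size (s.reg b) + 1

/-- Programs. -/
inductive Prog where
  | skip
  | instr (i : Instr)
  | seq (p q : Prog)
  /-- `if reg a < reg b then p else q` -/
  | ifLt (a b : ℕ) (p q : Prog)
  /-- `while reg a < reg b do p` -/
  | whileLt (a b : ℕ) (p : Prog)

/-- The cost of comparing registers `a` and `b`. -/
def testCost (a b : ℕ) (s : State) : ℕ :=
  Nat.size (s.reg a) + Nat.size (s.reg b) + 1

/-- `Runs p s t s'`: the program `p`, started in the configuration `s`, halts after time exactly
`t`, in the configuration `s'`. -/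
inductive Runs : Prog → State → ℕ → State → Prop where
  | skip (s : State) : Runs .skip s 1 s
  | instr (i : Instr) (s : State) : Runs (.instr i) s (i.cost s) (i.exec s)
  | seq {p q : Prog} {s s' s'' : State} {t t' : ℕ} :
      Runs p s t s' → Runs q s' t' s'' → Runs (.seq p q) s (t + t') s''
  | ifTrue {a b : ℕ} {p q : Prog} {s s' : State} {t : ℕ} :
      s.reg a < s.reg b → Runs p s t s' → Runs (.ifLt a b p q) s (testCost a b s + t) s'
  | ifFalse {a b : ℕ} {p q : Prog} {s s' : State} {t : ℕ} :
      ¬ s.reg a < s.reg b → Runs q s t s' → Runs (.ifLt a b p q) s (testCost a b s + t) s'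
  | whileTrue {a b : ℕ} {p : Prog} {s s' s'' : State} {t t' : ℕ} :
      s.reg a < s.reg b → Runs p s t s' → Runs (.whileLt a b p) s' t' s'' →
      Runs (.whileLt a b p) s (testCost a b s + t + t') s''
  | whileFalse {a b : ℕ} {p : Prog} {s : State} :
      ¬ s.reg a < s.reg b → Runs (.whileLt a b p) s (testCost a b s) s

/-- The start configuration on an input given as a list of numbers: the input occupies the first
memory cells; all other cells and all registers are zero. -/
def start (input : List ℕ) : State where
  reg := fun _ => 0
  mem := fun i => input.getD i 0

/-- The size of an input: its length in bits, with one delimiter per number. -/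
def inputSize (input : List ℕ) : ℕ :=
  (input.map fun x => Nat.size x + 1).sum

/-- The program `p` on the given input halts within time `T`, with `out` in register `0`. -/
def OutputsWithin (p : Prog) (input : List ℕ) (out T : ℕ) : Prop :=
  ∃ (t : ℕ) (s : State), Runs p (start input) t s ∧ t ≤ T ∧ s.reg 0 = out

end RAM

/-- A tree decomposition of the graph `G` whose tree has the node set `W`. -/
structure TreeDecomposition {V : Type*} (G : SimpleGraph V) (W : Type*) where
  tree : SimpleGraph W
  isTree : tree.IsTree
  bag : W → Finset V
  exists_mem_bag : ∀ v : V, ∃ x : W, v ∈ bag x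
  exists_edge_bag : ∀ u v : V, G.Adj u v → ∃ x : W, u ∈ bag x ∧ v ∈ bag x
  connected : ∀ v : V, (tree.induce {x : W | v ∈ bag x}).Connected

/-- The width `max |bag x| - 1`; for the graph without vertices it is taken to be `0`. -/
def TreeDecomposition.width {V W : Type*} [Fintype W] {G : SimpleGraph V}
    (D : TreeDecomposition G W) : ℕ :=
  (Finset.univ.sup fun x : W => (D.bag x).card) - 1

/-- `S` is a feedback vertex set of `G`: deleting `S` leaves a forest. -/
def IsFeedbackVertexSet {V : Type*} (G : SimpleGraph V) (S : Finset V) : Prop :=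
  (G.induce {v : V | v ∉ S}).IsAcyclic

/-- The number of feedback vertex sets of `G` of size `t`. -/
noncomputable def feedbackVertexSetCount {V : Type*} (G : SimpleGraph V) (t : ℕ) : ℕ :=
  {S : Finset V | IsFeedbackVertexSet G S ∧ S.card = t}.ncard

open Classical in
/-- The 0-1 matrix of a relation, row by row. -/
noncomputable def matrixWord {n m : ℕ} (r : Fin n → Fin m → Prop) : List ℕ :=
  (List.finRange n).flatMap fun i => (List.finRange m).map fun j => if r i j then 1 else 0

/-- The input for the graph `G` on `n` vertices, the tree decomposition `D` of `G` with `m` nodes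
and the number `t`: the numbers `n`, `m`, `t`, the adjacency matrix of `G`, the adjacency matrix of
the tree, and the incidence matrix of nodes (rows) and the vertices in their bags (columns). -/
noncomputable def encodeInput {n m : ℕ} (G : SimpleGraph (Fin n))
    (D : TreeDecomposition G (Fin m)) (t : ℕ) : List ℕ :=
  [n, m, t] ++ matrixWord G.Adj ++ matrixWord D.tree.Adj ++ matrixWord fun x v => v ∈ D.bag x

/-! Give every vertex a state, `0` if it is deleted and `1` or `2` if it is kept. An edge between
kept vertices contributes a factor 2 if the states agree and 0 otherwise. For a fixed zero set S,
the surviving assignments are those constant on each component of G - S, so their total weight is 2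
^ (c + e), where c and e are the numbers of components and edges of G - S. Always c + e ≥ n - |S|,
with equality exactly for forests. Hence the weight is 2 ^ (n - |S|) times a number that is odd iff
S is a feedback vertex set (`sum_colorings_parity`). Marking deleted vertices by X gives a
generating function, `partitionFunction`, whose coefficient at X ^ t is 2 ^ (n - t) times a number
with the parity of the wanted count (`sizeWeight_parity`). At X = 2 ^ ((n + 2) ^ 2) the coefficients
are the base X digits of a single number, so they can be read off by division
(`partitionFunction_parity`).

All factors of the weight belong to single vertices or edges, so dynamic programming over the tree
decomposition needs three states per vertex and no record of connectivity. A node sends its parent a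
message indexed by the assignments on the intersection of the two bags. For each of the at most 3 ^
(tw + 1) assignments on its bag, the messages of all children are multiplied with the new factors,
and the product is added to one cell; a node with many children thus costs only a polynomial factor
more. Summing out the vertices node by node shows that the message of the root is the total weight
(`OrderedDecomposition.sum_eq_message`). The order of the nodes is found by growing a subtree from
node 0; uniqueness of paths gives the running intersection property (`IsGrowthOrder.par_mem`).
Messages are kept modulo X ^ (n + 1), which exceeds the total, so they have polynomially many bits.

For the running time, a small language of expressions and statements is compiled to the machine. One
number `Γ.bits`, polynomial in the input size, bounds the lengths of all stored numbers and the
loops inside expressions, so an expression costs at most a power of `Γ.bits` with an exponent read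
off its syntax (`Expr.reaches_compile`). `Triple` counts the executed statements, each charged such
a power. The only loop that may exceed polynomial length is the one over the assignments on a bag.
-/

namespace RAM

/-! ### Rules for running times of machine programs -/

/-- The program `p`, started in `s`, halts within time `T` in a configuration satisfying `Φ`. -/
def Reaches (p : Prog) (s : State) (T : ℕ) (Φ : State → Prop) : Prop :=
  ∃ t s', Runs p s t s' ∧ t ≤ T ∧ Φ s'

theorem Reaches.mono {p : Prog} {s : State} {T T' : ℕ} {Φ Ψ : State → Prop}
    (h : Reaches p s T Φ) (hT : T ≤ T') (hΦ : ∀ s', Φ s' → Ψ s') : Reaches p s T' Ψ := by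
  obtain ⟨t, s', h1, h2, h3⟩ := h
  exact ⟨t, s', h1, h2.trans hT, hΦ _ h3⟩

theorem Reaches.seq {p q : Prog} {s : State} {T T' : ℕ} {Φ Ψ : State → Prop}
    (h : Reaches p s T Φ) (h' : ∀ s', Φ s' → Reaches q s' T' Ψ) :
    Reaches (.seq p q) s (T + T') Ψ := by
  obtain ⟨t, s', h1, h2, h3⟩ := h
  obtain ⟨t', s'', h4, h5, h6⟩ := h' _ h3
  exact ⟨_, _, .seq h1 h4, Nat.add_le_add h2 h5, h6⟩

theorem Reaches.instr {i : Instr} {s : State} {T : ℕ} {Φ : State → Prop}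
    (h : i.cost s ≤ T) (hΦ : Φ (i.exec s)) : Reaches (.instr i) s T Φ :=
  ⟨_, _, .instr i s, h, hΦ⟩

theorem Reaches.ifLt {a b : ℕ} {p q : Prog} {s : State} {T₀ T : ℕ} {Φ : State → Prop}
    (h₀ : testCost a b s ≤ T₀) (hp : s.reg a < s.reg b → Reaches p s T Φ)
    (hq : ¬ s.reg a < s.reg b → Reaches q s T Φ) : Reaches (.ifLt a b p q) s (T₀ + T) Φ := by
  by_cases h : s.reg a < s.reg b
  · obtain ⟨t, s', h1, h2, h3⟩ := hp h
    exact ⟨_, _, .ifTrue h h1, Nat.add_le_add h₀ h2, h3⟩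
  · obtain ⟨t, s', h1, h2, h3⟩ := hq h
    exact ⟨_, _, .ifFalse h h1, Nat.add_le_add h₀ h2, h3⟩

/-- The invariant decides the test in every round i ≤ N, so there are exactly N rounds; the
induction is on the number of rounds that remain. -/
theorem Reaches.whileLt {a b : ℕ} {p : Prog} {s : State} {T₀ T : ℕ} (N : ℕ)
    (I : ℕ → State → Prop) (h₀ : I 0 s)
    (ht : ∀ i s, i ≤ N → I i s → testCost a b s ≤ T₀ ∧ (s.reg a < s.reg b ↔ i < N))
    (hI : ∀ i s, i < N → I i s → Reaches p s T (I (i + 1))) :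
    Reaches (.whileLt a b p) s (N * (T₀ + T) + T₀) (I N) := by
  have key : ∀ k i s, i + k = N → I i s →
      Reaches (.whileLt a b p) s (k * (T₀ + T) + T₀) (I N) := by
    intro k
    induction k with
    | zero =>
      intro i s hi hs
      obtain ⟨h1, h2⟩ := ht i s (by omega) hs
      exact ⟨_, s, .whileFalse (by omega), by simpa using h1, by simpa [← hi] using hs⟩
    | succ k ih =>
      intro i s hi hs
      obtain ⟨h1, h2⟩ := ht i s (by omega) hs
      obtain ⟨t, s', h3, h4, h5⟩ := hI i s (by omega) hs
      obtain ⟨t', s'', h6, h7, h8⟩ := ih (i + 1) s' (by omega) h5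
      refine ⟨_, _, .whileTrue (by omega) h3 h6, ?_, h8⟩
      rw [Nat.succ_mul]; omega
  exact key N 0 s (by omega) h₀

/-- Overwrite a register. -/
def State.set (s : State) (r v : ℕ) : State := { s with reg := Function.update s.reg r v }

theorem State.reg_set (s : State) (r v k : ℕ) :
    (s.set r v).reg k = if k = r then v else s.reg k := by
  simp [State.set, Function.update_apply]

/-! ### Expressions and the lengths of their values -/

/-- Expressions over numbered variables, four arrays and the input. `big o r e b` is the product
(`o = true`) or the sum (`o = false`) of `b` over the values of the variable `r` below `e`. -/
inductive Expr where
  | var (r : ℕ)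
  | lit (c : ℕ)
  | op (o : BinOp) (a b : Expr)
  | inp (a : Expr)
  | arr (j : Fin 4) (a : Expr)
  | ite (a b p q : Expr)
  | big (o : Bool) (r : ℕ) (e b : Expr)

/-- The values of the variables and the contents of the arrays. -/
structure Env where
  var : ℕ → ℕ
  arr : Fin 4 → ℕ → ℕ

/-- The input, the first free memory address, and a bound on bit lengths and on loop counts. -/
structure Ctx where
  inp : ℕ → ℕ
  base : ℕ
  bits : ℕ

/-- Assign a value to a variable. -/
def Env.setVar (σ : Env) (r v : ℕ) : Env := { σ with var := Function.update σ.var r v }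

/-- Store a value in an array. -/
def Env.setArr (σ : Env) (j : Fin 4) (i v : ℕ) : Env :=
  { σ with arr := Function.update σ.arr j (Function.update (σ.arr j) i v) }

@[simp] theorem Env.arr_setVar (σ : Env) (r v : ℕ) : (σ.setVar r v).arr = σ.arr := rfl

@[simp] theorem Env.var_setArr (σ : Env) (j : Fin 4) (i v : ℕ) : (σ.setArr j i v).var = σ.var := rfl

theorem Env.var_setVar (σ : Env) (r v k : ℕ) :
    (σ.setVar r v).var k = if k = r then v else σ.var k := by
  simp [Env.setVar, Function.update_apply]

theorem Env.arr_setArr (σ : Env) (j : Fin 4) (i v : ℕ) (j' : Fin 4) (k : ℕ) :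
    (σ.setArr j i v).arr j' k = if j' = j ∧ k = i then v else σ.arr j' k := by
  simp only [Env.setArr, Function.update_apply]
  split_ifs <;> simp_all

/-- Iterated sums and products. -/
def bigVal (o : Bool) (N : ℕ) (f : ℕ → ℕ) : ℕ :=
  match o with
  | true => ∏ i ∈ Finset.range N, f i
  | false => ∑ i ∈ Finset.range N, f i

/-- The operation that is iterated. -/
def bigOp : Bool → BinOp
  | true => .mul
  | false => .add

theorem bigVal_succ (o : Bool) (N : ℕ) (f : ℕ → ℕ) :
    bigVal o (N + 1) f = (bigOp o).eval (bigVal o N f) (f N) := by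
  cases o
  · simp [bigVal, bigOp, BinOp.eval, Finset.sum_range_succ]
  · simp [bigVal, bigOp, BinOp.eval, Finset.prod_range_succ]

theorem bigVal_zero (o : Bool) (f : ℕ → ℕ) : bigVal o 0 f = cond o 1 0 := by
  cases o <;> simp [bigVal]

/-- The value of an expression. -/
def Expr.eval (Γ : Ctx) : Expr → Env → ℕ
  | .var r, σ => σ.var r
  | .lit c, _ => c
  | .op o a b, σ => o.eval (a.eval Γ σ) (b.eval Γ σ)
  | .inp a, σ => Γ.inp (a.eval Γ σ)
  | .arr j a, σ => σ.arr j (a.eval Γ σ)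
  | .ite a b p q, σ => if a.eval Γ σ < b.eval Γ σ then p.eval Γ σ else q.eval Γ σ
  | .big o r e b, σ => bigVal o (e.eval Γ σ) fun i => b.eval Γ (σ.setVar r i)

/-- The evaluation stays within the input and within the bound on loop counts. -/
def Expr.ok (Γ : Ctx) : Expr → Env → Prop
  | .var _, _ => True
  | .lit _, _ => True
  | .op _ a b, σ => a.ok Γ σ ∧ b.ok Γ σ
  | .inp a, σ => a.ok Γ σ ∧ a.eval Γ σ < Γ.base
  | .arr _ a, σ => a.ok Γ σ
  | .ite a b p q, σ => a.ok Γ σ ∧ b.ok Γ σ ∧ (a.eval Γ σ < b.eval Γ σ → p.ok Γ σ) ∧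
      (¬ a.eval Γ σ < b.eval Γ σ → q.ok Γ σ)
  | .big _ r e b, σ => e.ok Γ σ ∧ e.eval Γ σ ≤ Γ.bits ∧
      ∀ i < e.eval Γ σ, b.ok Γ (σ.setVar r i)

/-- An exponent for the polynomial that bounds the evaluation time and the length of the value. -/
def Expr.deg : Expr → ℕ
  | .var _ => 2
  | .lit c => Nat.size c + 1
  | .op _ a b => a.deg + b.deg + 2
  | .inp a => a.deg + 2
  | .arr _ a => a.deg + 8
  | .ite a b p q => a.deg + b.deg + p.deg + q.deg + 2
  | .big _ _ e b => e.deg + 2 * b.deg + 9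

/-- All numbers in the environment have at most `Γ.bits` bits. -/
def Env.Bdd (Γ : Ctx) (σ : Env) : Prop :=
  (∀ r, Nat.size (σ.var r) ≤ Γ.bits) ∧ ∀ j i, Nat.size (σ.arr j i) ≤ Γ.bits

/-- The conditions on a context: all its numbers are short. -/
structure Ctx.Good (Γ : Ctx) : Prop where
  four_le : 4 ≤ Γ.bits
  base_le : Nat.size Γ.base ≤ Γ.bits
  inp_le : ∀ i < Γ.base, Nat.size (Γ.inp i) ≤ Γ.bits

theorem size_le_self (x : ℕ) : Nat.size x ≤ x := Nat.size_le.2 Nat.lt_two_pow_self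

theorem size_add_le (x y : ℕ) : Nat.size (x + y) ≤ Nat.size x + Nat.size y + 1 := by
  rw [Nat.size_le]
  have h1 := Nat.lt_size_self x
  have h2 := Nat.lt_size_self y
  have h3 : 2 ^ Nat.size x ≤ 2 ^ (Nat.size x + Nat.size y) := Nat.pow_le_pow_right (by omega) (by omega)
  have h4 : 2 ^ Nat.size y ≤ 2 ^ (Nat.size x + Nat.size y) := Nat.pow_le_pow_right (by omega) (by omega)
  rw [pow_succ]; omega

theorem size_mul_le (x y : ℕ) : Nat.size (x * y) ≤ Nat.size x + Nat.size y := by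
  rw [Nat.size_le, pow_add]
  exact Nat.mul_lt_mul'' (Nat.lt_size_self x) (Nat.lt_size_self y)

theorem size_binOp_le (o : BinOp) (x y : ℕ) :
    Nat.size (o.eval x y) ≤ Nat.size x + Nat.size y + 1 := by
  cases o
  · exact size_add_le x y
  · exact (Nat.size_le_size (Nat.sub_le x y)).trans (by omega)
  · exact (size_mul_le x y).trans (by omega)
  · exact (Nat.size_le_size (Nat.div_le_self x y)).trans (by omega)
  · exact (Nat.size_le_size (Nat.mod_le x y)).trans (by omega)

/-- Each round lengthens the accumulator by at most b + 1 ≤ 2 * b bits, for sums and products alike;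
the final 1 is the length of the empty product. -/
theorem size_bigVal_le (o : Bool) (N : ℕ) (f : ℕ → ℕ) (b : ℕ) (hb : 1 ≤ b)
    (h : ∀ i < N, Nat.size (f i) ≤ b) : Nat.size (bigVal o N f) ≤ 2 * N * b + 1 := by
  induction N with
  | zero => cases o <;> simp [bigVal]
  | succ N ih =>
    rw [bigVal_succ]
    have := ih fun i hi => h i (by omega)
    have h2 := h N (by omega)
    have h3 := size_binOp_le (bigOp o) (bigVal o N f) (f N)
    have : 2 * (N + 1) * b = 2 * N * b + b + b := by ring
    omega

theorem one_le_bits_pow {Γ : Ctx} (hΓ : Γ.Good) (k : ℕ) : 1 ≤ Γ.bits ^ k :=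
  Nat.one_le_pow _ _ (by have := hΓ.four_le; omega)

theorem Env.Bdd.setVar {Γ : Ctx} {σ : Env} (h : σ.Bdd Γ) {r v : ℕ} (hv : Nat.size v ≤ Γ.bits) :
    (σ.setVar r v).Bdd Γ := by
  refine ⟨fun k => ?_, h.2⟩
  rw [Env.var_setVar]; split_ifs
  exacts [hv, h.1 k]

theorem Env.Bdd.setArr {Γ : Ctx} {σ : Env} (h : σ.Bdd Γ) {j : Fin 4} {i v : ℕ}
    (hv : Nat.size v ≤ Γ.bits) : (σ.setArr j i v).Bdd Γ := by
  refine ⟨h.1, fun k i => ?_⟩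
  rw [Env.arr_setArr]; split_ifs
  exacts [hv, h.2 _ _]

/-- Numbers that are read are short, and so are loop indices, being below `Γ.bits`; only arithmetic
lengthens. Since `Γ.bits ≥ 4`, additional powers absorb the constant factors, which turns sums of
bounds into products. -/
theorem Expr.size_eval_le {Γ : Ctx} (hΓ : Γ.Good) (e : Expr) : ∀ σ : Env, σ.Bdd Γ → e.ok Γ σ →
    Nat.size (e.eval Γ σ) ≤ Γ.bits ^ e.deg := by
  have h4 := hΓ.four_le
  have hle : ∀ {a b : ℕ}, a ≤ b → Γ.bits ^ a ≤ Γ.bits ^ b :=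
    fun h => Nat.pow_le_pow_right (by omega) h
  have hS2 : 16 ≤ Γ.bits ^ 2 := by nlinarith
  induction e with
  | var r =>
    intro σ hσ _
    exact (hσ.1 r).trans (by simp only [Expr.deg]; nlinarith)
  | lit c =>
    intro σ hσ _
    calc Nat.size c ≤ 2 ^ Nat.size c := Nat.lt_two_pow_self.le
      _ ≤ Γ.bits ^ Nat.size c := Nat.pow_le_pow_left (by omega) _
      _ ≤ _ := hle (by simp [Expr.deg])
  | op o a b iha ihb =>
    intro σ hσ h
    have h1 := iha σ hσ h.1
    have h2 := ihb σ hσ h.2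
    have h3 := size_binOp_le o (a.eval Γ σ) (b.eval Γ σ)
    have hx := one_le_bits_pow hΓ a.deg
    have hy := one_le_bits_pow hΓ b.deg
    simp only [Expr.deg, Expr.eval, pow_add]
    have : Γ.bits ^ a.deg + Γ.bits ^ b.deg + 1 ≤ 16 * (Γ.bits ^ a.deg * Γ.bits ^ b.deg) := by nlinarith
    nlinarith [Nat.zero_le (Γ.bits ^ a.deg * Γ.bits ^ b.deg)]
  | inp a iha =>
    intro σ hσ h
    exact (hΓ.inp_le _ h.2).trans ((pow_one Γ.bits).symm.le.trans (hle (by simp [Expr.deg])))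
  | arr j a iha =>
    intro σ hσ h
    exact (hσ.2 _ _).trans ((pow_one Γ.bits).symm.le.trans (hle (by simp [Expr.deg])))
  | ite a b p q iha ihb ihp ihq =>
    intro σ hσ h
    simp only [Expr.eval]
    split_ifs with hc
    · exact (ihp σ hσ (h.2.2.1 hc)).trans (hle (by simp only [Expr.deg]; omega))
    · exact (ihq σ hσ (h.2.2.2 hc)).trans (hle (by simp only [Expr.deg]; omega))
  | big o r e b ihe ihb =>
    intro σ hσ h
    simp only [Expr.eval]
    have hN := h.2.1
    refine (size_bigVal_le o _ _ (Γ.bits ^ b.deg) (one_le_bits_pow hΓ _) fun i hi => ?_).trans ?_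
    · exact ihb _ (hσ.setVar ((size_le_self i).trans (by omega))) (h.2.2 i hi)
    · have hy := one_le_bits_pow hΓ b.deg
      calc 2 * e.eval Γ σ * Γ.bits ^ b.deg + 1 ≤ (2 * e.eval Γ σ + 1) * Γ.bits ^ b.deg := by
            nlinarith
        _ ≤ Γ.bits ^ 2 * Γ.bits ^ b.deg := Nat.mul_le_mul_right _ (by nlinarith)
        _ = Γ.bits ^ (2 + b.deg) := (pow_add _ _ _).symm
        _ ≤ _ := hle (by simp only [Expr.deg]; omega)

end RAM

/-! ### Compilation of expressions -/

namespace RAM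

/-- Copy the contents of register `a` to the register `d ≠ a`. -/
def move (d a : ℕ) : Prog := .seq (.instr (.const d 0)) (.instr (.arith .add d a d))

/-- Replace an array index in register `2 * d + 1` by the address of the array cell. -/
def address (j : Fin 4) (d : ℕ) : Prog :=
  .seq (.instr (.const (2 * d + 3) 4)) <|
  .seq (.instr (.arith .mul (2 * d + 1) (2 * d + 1) (2 * d + 3))) <|
  .seq (.instr (.const (2 * d + 3) j)) <|
  .seq (.instr (.arith .add (2 * d + 1) (2 * d + 1) (2 * d + 3)))
    (.instr (.arith .add (2 * d + 1) (2 * d + 1) 1))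

/-- The program that computes an expression to register `2 * d + 1`. The variable `r` is kept in
register `2 * r`, register `1` holds the first free address, and the registers `2 * k + 1` with
`k ≥ d` are free. -/
def Expr.compile : Expr → ℕ → Prog
  | .var r, d => move (2 * d + 1) (2 * r)
  | .lit c, d => .instr (.const (2 * d + 1) c)
  | .op o a b, d => .seq (a.compile d) <| .seq (b.compile (d + 1)) <|
      .instr (.arith o (2 * d + 1) (2 * d + 1) (2 * d + 3))
  | .inp a, d => .seq (a.compile d) <| .instr (.load (2 * d + 1) (2 * d + 1))
  | .arr j a, d => .seq (a.compile d) <| .seq (address j d) <|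
      .instr (.load (2 * d + 1) (2 * d + 1))
  | .ite a b p q, d => .seq (a.compile d) <| .seq (b.compile (d + 1)) <|
      .ifLt (2 * d + 1) (2 * d + 3) (p.compile d) (q.compile d)
  | .big o r e b, d =>
      .seq (move (2 * d + 1) (2 * r)) <|
      .seq (.instr (.const (2 * d + 3) (cond o 1 0))) <|
      .seq (.instr (.const (2 * d + 5) 0)) <|
      .seq (e.compile (d + 3)) <|
      .seq (.whileLt (2 * d + 5) (2 * d + 7) <|
        .seq (move (2 * r) (2 * d + 5)) <|
        .seq (b.compile (d + 4)) <|
        .seq (.instr (.arith (bigOp o) (2 * d + 3) (2 * d + 3) (2 * d + 9))) <|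
        .seq (.instr (.const (2 * d + 9) 1)) <|
        .instr (.arith .add (2 * d + 5) (2 * d + 5) (2 * d + 9))) <|
      .seq (move (2 * r) (2 * d + 1)) (move (2 * d + 1) (2 * d + 3))

/-- The configurations `s` and `s'` agree except for the free registers. -/
structure Agree (d : ℕ) (s s' : State) : Prop where
  mem : s'.mem = s.mem
  even : ∀ r, s'.reg (2 * r) = s.reg (2 * r)
  odd : ∀ k < d, s'.reg (2 * k + 1) = s.reg (2 * k + 1)

/-- The configuration `s` represents the environment `σ`. -/
structure Rel (Γ : Ctx) (σ : Env) (s : State) : Prop where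
  good : Γ.Good
  bdd : σ.Bdd Γ
  var : ∀ r, s.reg (2 * r) = σ.var r
  base : s.reg 1 = Γ.base
  inp : ∀ i < Γ.base, s.mem i = Γ.inp i
  arr : ∀ (j : Fin 4) i, s.mem (i * 4 + j + Γ.base) = σ.arr j i

theorem Agree.trans {d d' : ℕ} {s s' s'' : State} (h : Agree d s s') (h' : Agree d' s' s'')
    (hd : d ≤ d') : Agree d s s'' :=
  ⟨h'.mem.trans h.mem, fun r => (h'.even r).trans (h.even r),
    fun k hk => (h'.odd k (by omega)).trans (h.odd k hk)⟩

theorem Agree.set {d k : ℕ} (s : State) (v : ℕ) (h : d ≤ k) : Agree d s (s.set (2 * k + 1) v) :=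
  ⟨rfl, fun r => by rw [State.reg_set, if_neg (by omega)],
    fun i hi => by rw [State.reg_set, if_neg (by omega)]⟩

theorem Rel.agree {Γ : Ctx} {σ : Env} {d : ℕ} {s s' : State} (h : Rel Γ σ s) (hd : 1 ≤ d)
    (h' : Agree d s s') : Rel Γ σ s' where
  good := h.good
  bdd := h.bdd
  var r := (h'.even r).trans (h.var r)
  base := (h'.odd 0 (by omega)).trans h.base
  inp i hi := by rw [h'.mem, h.inp i hi]
  arr j i := by rw [h'.mem, h.arr j i]

theorem reaches_const {d c T : ℕ} {s : State} {Φ : State → Prop} (hT : Nat.size c + 1 ≤ T)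
    (h : Φ (s.set d c)) : Reaches (.instr (.const d c)) s T Φ := Reaches.instr hT h

theorem reaches_arith {o : BinOp} {d a b T : ℕ} {s : State} {Φ : State → Prop}
    (hT : (Nat.size (s.reg a) + 1) * (Nat.size (s.reg b) + 1) ≤ T)
    (h : Φ (s.set d (o.eval (s.reg a) (s.reg b)))) : Reaches (.instr (.arith o d a b)) s T Φ :=
  Reaches.instr hT h

theorem reaches_load {d a T : ℕ} {s : State} {Φ : State → Prop}
    (hT : Nat.size (s.reg a) + Nat.size (s.mem (s.reg a)) + 1 ≤ T)
    (h : Φ (s.set d (s.mem (s.reg a)))) : Reaches (.instr (.load d a)) s T Φ :=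
  Reaches.instr hT h

theorem reaches_move {d a : ℕ} (hda : a ≠ d) (s : State) :
    Reaches (move d a) s (Nat.size (s.reg a) + 2) fun s' =>
      s'.mem = s.mem ∧ ∀ k, s'.reg k = if k = d then s.reg a else s.reg k := by
  refine (Reaches.seq (Φ := fun s' => s' = s.set d 0) (T := 1) (reaches_const (by simp) rfl)
    (T' := Nat.size (s.reg a) + 1) ?_).mono (by omega) fun _ h => h
  rintro _ rfl
  refine reaches_arith (by simp [State.reg_set, hda]) ⟨rfl, fun k => ?_⟩
  simp only [State.reg_set, BinOp.eval, if_neg hda]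
  split_ifs <;> simp

theorem reaches_move_odd {Γ : Ctx} {σ : Env} {s : State} (h : Rel Γ σ s) (r d : ℕ) :
    Reaches (move (2 * d + 1) (2 * r)) s (Γ.bits + 2) fun s' =>
      Agree d s s' ∧ s'.reg (2 * d + 1) = σ.var r := by
  refine (reaches_move (by omega) s).mono (by rw [h.var]; have := h.bdd.1 r; omega) ?_
  rintro s' ⟨h1, h2⟩
  refine ⟨⟨h1, fun r => ?_, fun k hk => ?_⟩, ?_⟩
  · rw [h2, if_neg (by omega)]
  · rw [h2, if_neg (by omega)]
  · rw [h2, if_pos rfl, h.var]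

/-- Interleaving the four arrays modulo 4 lets all of them be unbounded. The index is the value of
an expression and may be longer than `Γ.bits`, whence the separate bound x on its length. -/
theorem reaches_address {Γ : Ctx} {σ : Env} {s : State} (h : Rel Γ σ s) (j : Fin 4) {d : ℕ}
    (hd : 1 ≤ d) {x : ℕ} (hx : 1 ≤ x) (hs : Nat.size (s.reg (2 * d + 1)) ≤ x) :
    Reaches (address j d) s (90 * (x * Γ.bits)) fun s' =>
      Agree d s s' ∧ s'.reg (2 * d + 1) = s.reg (2 * d + 1) * 4 + j + Γ.base ∧
        Nat.size (s'.reg (2 * d + 1)) ≤ x + Γ.bits + 10 := by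
  have hS := h.good.four_le
  have hB := h.good.base_le
  have hj : Nat.size (j : ℕ) ≤ 3 := (size_le_self _).trans (by omega)
  have h4 : Nat.size 4 ≤ 4 := size_le_self 4
  generalize hi : s.reg (2 * d + 1) = i at *
  have e1 := size_mul_le i 4
  have e2 := size_add_le (i * 4) j
  have e3 := size_add_le (i * 4 + j) Γ.base
  have hxS : x + Γ.bits ≤ 2 * (x * Γ.bits) := by nlinarith
  have hxS' : 4 ≤ x * Γ.bits := by nlinarith
  refine Reaches.mono
    (Reaches.seq (T := 5) (T' := 85 * (x * Γ.bits)) (Φ := fun s' => s' = s.set (2 * d + 3) 4)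
      (reaches_const (by omega) rfl) ?_) (by omega) fun _ h => h
  rintro _ rfl
  refine Reaches.mono
    (Reaches.seq (T := 5 * (x + 1)) (T' := 65 * (x * Γ.bits)) (Φ := fun s' => s' =
      (s.set (2 * d + 3) 4).set (2 * d + 1) (i * 4))
      (reaches_arith ?_ (by simp [State.reg_set, hi, BinOp.eval])) ?_) (by omega) fun _ h => h
  · simp only [State.reg_set, hi, if_true, show 2 * d + 1 ≠ 2 * d + 3 by omega, if_false]
    nlinarith
  rintro _ rfl
  refine Reaches.mono
    (Reaches.seq (T := 4) (T' := 64 * (x * Γ.bits)) (Φ := fun s' => s' =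
      ((s.set (2 * d + 3) 4).set (2 * d + 1) (i * 4)).set (2 * d + 3) j)
      (reaches_const (by omega) rfl) ?_) (by omega) fun _ h => h
  rintro _ rfl
  refine Reaches.mono
    (Reaches.seq (T := (x + 5) * 4) (T' := 32 * (x * Γ.bits)) (Φ := fun s' => s' =
      (((s.set (2 * d + 3) 4).set (2 * d + 1) (i * 4)).set (2 * d + 3) j).set (2 * d + 1) (i * 4 + j))
      (reaches_arith ?_ (by simp [State.reg_set, BinOp.eval])) ?_) (by nlinarith) fun _ h => h
  · simp only [State.reg_set, if_true, show 2 * d + 1 ≠ 2 * d + 3 by omega, if_false]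
    exact Nat.mul_le_mul (by omega) (by omega)
  rintro _ rfl
  have hb : ((((s.set (2 * d + 3) 4).set (2 * d + 1) (i * 4)).set (2 * d + 3) j).set (2 * d + 1)
      (i * 4 + j)).reg 1 = Γ.base := by
    simp only [State.reg_set]
    rw [if_neg (by omega), if_neg (by omega), if_neg (by omega), if_neg (by omega), h.base]
  refine reaches_arith ?_ ⟨?_, ?_, ?_⟩
  · rw [hb]
    simp only [State.reg_set, if_true]
    calc _ ≤ (x + 10) * (Γ.bits + 1) := Nat.mul_le_mul (by omega) (by omega)
      _ ≤ _ := by nlinarith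
  · refine ⟨rfl, fun r => ?_, fun k hk => ?_⟩
    · simp only [State.reg_set]
      rw [if_neg (by omega), if_neg (by omega), if_neg (by omega), if_neg (by omega), if_neg (by omega)]
    · simp only [State.reg_set]
      rw [if_neg (by omega), if_neg (by omega), if_neg (by omega), if_neg (by omega), if_neg (by omega)]
  · rw [hb]; simp [State.reg_set, BinOp.eval]
  · rw [hb]; simp only [State.reg_set, BinOp.eval, if_true]; omega

end RAM

/-! ### Correctness and running time of compiled expressions -/

namespace RAM

/-- The state of the loop for `Expr.big` after `i` rounds, when the registers below `2 * d` agree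
with `s`, except for the bound variable `r`. -/
structure BigInv (d r : ℕ) (s : State) (x acc i N : ℕ) (s' : State) : Prop where
  mem : s'.mem = s.mem
  even : ∀ k, k ≠ r → s'.reg (2 * k) = s.reg (2 * k)
  odd : ∀ k < d, s'.reg (2 * k + 1) = s.reg (2 * k + 1)
  saved : s'.reg (2 * d + 1) = x
  acc : s'.reg (2 * d + 3) = acc
  counter : s'.reg (2 * d + 5) = i
  bound : s'.reg (2 * d + 7) = N

/-- The dominant cost is the multiplication of the accumulator, of up to 2 * i * y + 1 bits, by a
value of y bits; this gives `Γ.bits * (y * y)`. -/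
theorem reaches_big_body {Γ : Ctx} {σ : Env} {s : State} (h : Rel Γ σ s) {d r : ℕ} (hd : 1 ≤ d)
    {o : Bool} {b : Expr} {f : ℕ → ℕ} {N i y : ℕ} {s₀ : State} (hi : i < N) (hN : N ≤ Γ.bits)
    (hy : 1 ≤ y)
    (hb : ∀ s', Rel Γ (σ.setVar r i) s' → Reaches (b.compile (d + 4)) s' y fun s'' =>
      Agree (d + 4) s' s'' ∧ s''.reg (2 * (d + 4) + 1) = f i)
    (hf : ∀ i < N, Nat.size (f i) ≤ y)
    (hs : BigInv d r s (σ.var r) (bigVal o i f) i N s₀) :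
    Reaches (.seq (move (2 * r) (2 * d + 5)) <|
        .seq (b.compile (d + 4)) <|
        .seq (.instr (.arith (bigOp o) (2 * d + 3) (2 * d + 3) (2 * d + 9))) <|
        .seq (.instr (.const (2 * d + 9) 1)) <|
        .instr (.arith .add (2 * d + 5) (2 * d + 5) (2 * d + 9))) s₀ (20 * (Γ.bits * (y * y)))
      (BigInv d r s (σ.var r) (bigVal o (i + 1) f) (i + 1) N) := by
  have hS := h.good.four_le
  have hsi : Nat.size i ≤ Γ.bits := (size_le_self i).trans (by omega)
  have hyy : y ≤ y * y := by nlinarith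
  have h1 : Γ.bits ≤ Γ.bits * (y * y) := Nat.le_mul_of_pos_right _ (by positivity)
  have h2 : y ≤ Γ.bits * (y * y) := by nlinarith
  have hacc := size_bigVal_le o i f y hy fun k hk => hf k (by omega)
  have hacc2 : 2 * i * y + 1 + 1 ≤ 2 * (Γ.bits * y) := by
    calc 2 * i * y + 1 + 1 ≤ 2 * i * y + 2 * y := by omega
      _ = 2 * ((i + 1) * y) := by ring
      _ ≤ _ := by gcongr; omega
  have hacc3 : (2 * i * y + 1 + 1) * (y + 1) ≤ 4 * (Γ.bits * (y * y)) := by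
    calc _ ≤ 2 * (Γ.bits * y) * (2 * y) := Nat.mul_le_mul hacc2 (by omega)
      _ = _ := by ring
  refine Reaches.mono (Reaches.seq (T := Γ.bits + 2) (T' := 18 * (Γ.bits * (y * y)))
    (Φ := fun s' => BigInv d r s (σ.var r) (bigVal o i f) i N s' ∧ s'.reg (2 * r) = i) ?_ ?_)
    (by omega) fun _ h => h
  · refine (reaches_move (by omega) s₀).mono (by rw [hs.counter]; omega) ?_
    rintro s' ⟨hm, hr⟩
    rw [hs.counter] at hr
    refine ⟨⟨hm.trans hs.mem, fun k hk => ?_, fun k hk => ?_, ?_, ?_, ?_, ?_⟩, ?_⟩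
    · rw [hr, if_neg (by omega), hs.even k hk]
    · rw [hr, if_neg (by omega), hs.odd k hk]
    · rw [hr, if_neg (by omega), hs.saved]
    · rw [hr, if_neg (by omega), hs.acc]
    · rw [hr, if_neg (by omega), hs.counter]
    · rw [hr, if_neg (by omega), hs.bound]
    · rw [hr, if_pos rfl]
  rintro s₁ ⟨hs, hr⟩
  refine Reaches.mono (Reaches.seq (T := y) (T' := 17 * (Γ.bits * (y * y)))
    (Φ := fun s' => BigInv d r s (σ.var r) (bigVal o i f) i N s' ∧ s'.reg (2 * d + 9) = f i)
    ((hb s₁ ?_).mono le_rfl ?_) ?_) (by omega) fun _ h => h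
  · refine ⟨h.good, h.bdd.setVar hsi, fun k => ?_, ?_, fun k hk => ?_, fun j k => ?_⟩
    · rw [Env.var_setVar]; split_ifs with hk
      · rw [hk, hr]
      · rw [hs.even k hk, h.var]
    · exact (hs.odd 0 (by omega)).trans h.base
    · rw [hs.mem, h.inp k hk]
    · rw [hs.mem, h.arr]; rfl
  · rintro s' ⟨ha, hv⟩
    refine ⟨⟨ha.mem.trans hs.mem, fun k hk => ?_, fun k hk => ?_, ?_, ?_, ?_, ?_⟩, hv⟩
    · rw [ha.even, hs.even k hk]
    · rw [ha.odd k (by omega), hs.odd k hk]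
    · rw [ha.odd d (by omega), hs.saved]
    · exact (ha.odd (d + 1) (by omega)).trans hs.acc
    · exact (ha.odd (d + 2) (by omega)).trans hs.counter
    · exact (ha.odd (d + 3) (by omega)).trans hs.bound
  rintro s₂ ⟨hs, hv⟩
  refine Reaches.mono (Reaches.seq (T := (2 * i * y + 1 + 1) * (y + 1)) (T' := 13 * (Γ.bits * (y * y)))
    (Φ := BigInv d r s (σ.var r) (bigVal o (i + 1) f) i N) (reaches_arith ?_ ?_) ?_)
    (by omega) fun _ h => h
  · rw [hs.acc, hv]
    exact Nat.mul_le_mul (by omega) (by have := hf i hi; omega)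
  · rw [hs.acc, hv, bigVal_succ]
    refine ⟨hs.mem, fun k hk => ?_, fun k hk => ?_, ?_, ?_, ?_, ?_⟩
    · rw [State.reg_set, if_neg (by omega), hs.even k hk]
    · rw [State.reg_set, if_neg (by omega), hs.odd k hk]
    · rw [State.reg_set, if_neg (by omega), hs.saved]
    · rw [State.reg_set, if_pos rfl]
    · rw [State.reg_set, if_neg (by omega), hs.counter]
    · rw [State.reg_set, if_neg (by omega), hs.bound]
  intro s₃ hs
  refine Reaches.mono (Reaches.seq (T := 2) (T' := 2 * (Γ.bits + 1))
    (Φ := fun s' => s' = s₃.set (2 * d + 9) 1) (reaches_const (by simp) rfl) ?_) (by omega)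
    fun _ h => h
  rintro _ rfl
  have e1 : (s₃.set (2 * d + 9) 1).reg (2 * d + 5) = i := by
    rw [State.reg_set, if_neg (by omega), hs.counter]
  have e2 : (s₃.set (2 * d + 9) 1).reg (2 * d + 9) = 1 := by
    rw [State.reg_set, if_pos rfl]
  refine reaches_arith ?_ ?_
  · rw [e1, e2, mul_comm]
    exact Nat.mul_le_mul (by simp) (by omega)
  · rw [e1, e2]
    refine ⟨hs.mem, fun k hk => ?_, fun k hk => ?_, ?_, ?_, ?_, ?_⟩
    · rw [State.reg_set, if_neg (by omega), State.reg_set, if_neg (by omega), hs.even k hk]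
    · rw [State.reg_set, if_neg (by omega), State.reg_set, if_neg (by omega), hs.odd k hk]
    · rw [State.reg_set, if_neg (by omega), State.reg_set, if_neg (by omega), hs.saved]
    · rw [State.reg_set, if_neg (by omega), State.reg_set, if_neg (by omega), hs.acc]
    · rw [State.reg_set, if_pos rfl]; rfl
    · rw [State.reg_set, if_neg (by omega), State.reg_set, if_neg (by omega), hs.bound]

/-- Structural induction with d general, because a second operand is compiled one level deeper to
protect the value of the first. The length bounds of `Expr.size_eval_le` turn instruction costs into
powers of `Γ.bits`. -/
theorem Expr.reaches_compile {Γ : Ctx} (e : Expr) : ∀ (σ : Env) (s : State) (d : ℕ), 1 ≤ d →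
    Rel Γ σ s → e.ok Γ σ → Reaches (e.compile d) s (Γ.bits ^ e.deg) fun s' =>
      Agree d s s' ∧ s'.reg (2 * d + 1) = e.eval Γ σ := by
  induction e with
  | var r =>
    intro σ s d hd h _
    have := h.good.four_le
    exact (reaches_move_odd h r d).mono (by simp only [Expr.deg]; nlinarith) fun _ h => h
  | lit c =>
    intro σ s d hd h _
    have := h.good.four_le
    refine reaches_const ?_ ⟨Agree.set _ _ le_rfl, by rw [State.reg_set, if_pos rfl]; rfl⟩
    calc Nat.size c + 1 ≤ 2 ^ (Nat.size c + 1) := Nat.lt_two_pow_self.le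
      _ ≤ _ := Nat.pow_le_pow_left (by omega) _
  | op o a b iha ihb =>
    intro σ s d hd h hok
    have h4 := h.good.four_le
    have hx := one_le_bits_pow h.good a.deg
    have hy := one_le_bits_pow h.good b.deg
    have sa := a.size_eval_le h.good σ h.bdd hok.1
    have sb := b.size_eval_le h.good σ h.bdd hok.2
    refine Reaches.mono ((iha σ s d hd h hok.1).seq fun s₁ h₁ =>
      (ihb σ s₁ (d + 1) (by omega) (h.agree hd h₁.1) hok.2).seq
        (T' := (Γ.bits ^ a.deg + 1) * (Γ.bits ^ b.deg + 1)) (Ψ := fun s' =>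
      Agree d s s' ∧ s'.reg (2 * d + 1) = (Expr.op o a b).eval Γ σ) fun s₂ h₂ => ?_) ?_ fun _ h => h
    · have e1 : s₂.reg (2 * d + 1) = a.eval Γ σ := (h₂.1.odd d (by omega)).trans h₁.2
      have e2 : s₂.reg (2 * d + 3) = b.eval Γ σ := h₂.2
      refine reaches_arith (by rw [e1, e2]; exact Nat.mul_le_mul (by omega) (by omega)) ⟨?_, ?_⟩
      · exact (h₁.1.trans h₂.1 (by omega)).trans (Agree.set _ _ le_rfl) le_rfl
      · rw [e1, e2, State.reg_set, if_pos rfl]; rfl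
    · simp only [Expr.deg, pow_add]
      calc _ ≤ 16 * (Γ.bits ^ a.deg * Γ.bits ^ b.deg) := by nlinarith
        _ ≤ _ := by rw [mul_comm]; exact Nat.mul_le_mul_left _ (by nlinarith)
  | inp a iha =>
    intro σ s d hd h hok
    have h4 := h.good.four_le
    have hx := one_le_bits_pow h.good a.deg
    have sa := a.size_eval_le h.good σ h.bdd hok.1
    refine Reaches.mono ((iha σ s d hd h hok.1).seq
        (T' := Γ.bits ^ a.deg + Γ.bits + 1) (Ψ := fun s' =>
      Agree d s s' ∧ s'.reg (2 * d + 1) = (Expr.inp a).eval Γ σ) fun s₁ h₁ => ?_) ?_ fun _ h => h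
    · have e1 : s₁.mem (a.eval Γ σ) = Γ.inp (a.eval Γ σ) := by rw [h₁.1.mem, h.inp _ hok.2]
      have := h.good.inp_le _ hok.2
      refine reaches_load (by rw [h₁.2, e1]; omega) ⟨h₁.1.trans (Agree.set _ _ le_rfl) le_rfl, ?_⟩
      rw [h₁.2, e1, State.reg_set, if_pos rfl]; rfl
    · simp only [Expr.deg, pow_add]
      nlinarith [Nat.zero_le (Γ.bits ^ a.deg), mul_le_mul hx h4 (by norm_num) (by omega)]
  | arr j a iha =>
    intro σ s d hd h hok
    have h4 := h.good.four_le
    have hx := one_le_bits_pow h.good a.deg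
    have sa := a.size_eval_le h.good σ h.bdd hok
    refine Reaches.mono ((iha σ s d hd h hok).seq fun s₁ h₁ =>
      (reaches_address (h.agree hd h₁.1) j hd hx (by rw [h₁.2]; exact sa)).seq
        (T' := Γ.bits ^ a.deg + Γ.bits + 10 + Γ.bits + 1) (Ψ := fun s' =>
      Agree d s s' ∧ s'.reg (2 * d + 1) = (Expr.arr j a).eval Γ σ) fun s₂ h₂ => ?_) ?_ fun _ h => h
    · have e1 : s₂.mem (s₂.reg (2 * d + 1)) = σ.arr j (a.eval Γ σ) := by
        rw [h₂.2.1, h₂.1.mem, h₁.1.mem, h.arr, h₁.2]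
      refine reaches_load ?_ ⟨(h₁.1.trans h₂.1 le_rfl).trans (Agree.set _ _ le_rfl) le_rfl, ?_⟩
      · have := h₂.2.2
        have := h.bdd.2 j (a.eval Γ σ)
        rw [e1]; omega
      · rw [e1, State.reg_set, if_pos rfl]; rfl
    · simp only [Expr.deg, pow_add]
      have hxS : Γ.bits ^ a.deg ≤ Γ.bits ^ a.deg * Γ.bits := by nlinarith
      have hxS2 : Γ.bits ≤ Γ.bits ^ a.deg * Γ.bits := by nlinarith
      calc _ ≤ 4 ^ 7 * (Γ.bits ^ a.deg * Γ.bits) := by omega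
        _ ≤ Γ.bits ^ 7 * (Γ.bits ^ a.deg * Γ.bits) :=
          Nat.mul_le_mul_right _ (Nat.pow_le_pow_left h4 7)
        _ = _ := by ring
  | ite a b p q iha ihb ihp ihq =>
    intro σ s d hd h hok
    obtain ⟨oa, ob, op, oq⟩ := hok
    have h4 := h.good.four_le
    have hx := one_le_bits_pow h.good a.deg
    have hy := one_le_bits_pow h.good b.deg
    have hz := one_le_bits_pow h.good p.deg
    have hw := one_le_bits_pow h.good q.deg
    have sa := a.size_eval_le h.good σ h.bdd oa
    have sb := b.size_eval_le h.good σ h.bdd ob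
    refine Reaches.mono ((iha σ s d hd h oa).seq fun s₁ h₁ =>
      (ihb σ s₁ (d + 1) (by omega) (h.agree hd h₁.1) ob).seq
        (T' := (Γ.bits ^ a.deg + Γ.bits ^ b.deg + 1) + (Γ.bits ^ p.deg + Γ.bits ^ q.deg))
        (Ψ := fun s' => Agree d s s' ∧ s'.reg (2 * d + 1) = (Expr.ite a b p q).eval Γ σ)
        fun s₂ h₂ => ?_) ?_ fun _ h => h
    · have e1 : s₂.reg (2 * d + 1) = a.eval Γ σ := (h₂.1.odd d (by omega)).trans h₁.2
      have e2 : s₂.reg (2 * d + 3) = b.eval Γ σ := h₂.2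
      have ha : Agree d s s₂ := h₁.1.trans h₂.1 (by omega)
      refine Reaches.ifLt (by rw [testCost, e1, e2]; omega) (fun hc => ?_) fun hc => ?_
      · rw [e1, e2] at hc
        refine (ihp σ s₂ d hd (h.agree hd ha) (op hc)).mono (by omega) fun s' h' => ?_
        exact ⟨ha.trans h'.1 le_rfl, by rw [h'.2, Expr.eval, if_pos hc]⟩
      · rw [e1, e2] at hc
        refine (ihq σ s₂ d hd (h.agree hd ha) (oq hc)).mono (by omega) fun s' h' => ?_
        exact ⟨ha.trans h'.1 le_rfl, by rw [h'.2, Expr.eval, if_neg hc]⟩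
    · simp only [Expr.deg, pow_add]
      have key : ∀ x y : ℕ, 1 ≤ x → 1 ≤ y → x ≤ x * y ∧ y ≤ x * y ∧ 1 ≤ x * y :=
        fun x y hx hy => ⟨by nlinarith, by nlinarith, by nlinarith⟩
      obtain ⟨k1, k2, k3⟩ := key _ _ hx hy
      obtain ⟨k4, k5, k6⟩ := key _ _ k3 hz
      obtain ⟨k7, k8, k9⟩ := key _ _ k6 hw
      calc _ ≤ 16 * (Γ.bits ^ a.deg * Γ.bits ^ b.deg * Γ.bits ^ p.deg * Γ.bits ^ q.deg) := by omega
        _ ≤ _ := by rw [mul_comm]; exact Nat.mul_le_mul_left _ (by nlinarith)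
  | big o r e b ihe ihb =>
    intro σ s d hd h hok
    obtain ⟨oe, oN, ob⟩ := hok
    have h4 := h.good.four_le
    have hx := one_le_bits_pow h.good e.deg
    have hy := one_le_bits_pow h.good b.deg
    set f := fun i => b.eval Γ (σ.setVar r i) with hf
    set N := e.eval Γ σ with hN
    set y := Γ.bits ^ b.deg with hydef
    have hsz : ∀ i ≤ N, Nat.size i ≤ Γ.bits := fun i hi => (size_le_self i).trans (by omega)
    have hfy : ∀ i < N, Nat.size (f i) ≤ y := fun i hi =>
      b.size_eval_le h.good _ (h.bdd.setVar (hsz i hi.le)) (ob i hi)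
    have hacc := size_bigVal_le o N f y hy hfy
    refine Reaches.mono ((reaches_move_odd h r d).seq fun s₁ h₁ =>
      Reaches.seq (T := 2) (Φ := fun s' => s' = s₁.set (2 * d + 3) (cond o 1 0))
        (reaches_const (by cases o <;> simp) rfl) fun s₂ h₂ =>
      Reaches.seq (T := 1) (Φ := fun s' => s' = s₂.set (2 * d + 5) 0)
        (reaches_const (by simp) rfl) fun s₃ h₃ =>
      Reaches.seq (T := Γ.bits ^ e.deg) (Φ := BigInv d r s (σ.var r) (bigVal o 0 f) 0 N) ?_
        fun s₄ h₄ =>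
      Reaches.seq (T := N * (2 * Γ.bits + 1 + 20 * (Γ.bits * (y * y))) + (2 * Γ.bits + 1))
        (Φ := BigInv d r s (σ.var r) (bigVal o N f) N N)
        (Reaches.whileLt N (fun i => BigInv d r s (σ.var r) (bigVal o i f) i N) h₄ ?_ ?_)
        fun s₅ h₅ =>
      Reaches.seq (T := Γ.bits + 2) (Φ := fun s' => Agree d s s' ∧ s'.reg (2 * d + 3) = bigVal o N f)
        ?_ fun s₆ h₆ => (reaches_move (by omega) s₆).mono
          (T' := 2 * N * y + 1 + 2) (by rw [h₆.2]; omega) ?_) ?_ fun _ h => h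
    · have ha : Agree d s s₃ := by
        subst h₃ h₂
        exact (h₁.1.trans (Agree.set (k := d + 1) _ _ (by omega)) le_rfl).trans
          (Agree.set (k := d + 2) _ _ (by omega)) le_rfl
      have e1 : s₃.reg (2 * d + 1) = σ.var r := by
        rw [h₃, State.reg_set, if_neg (by omega), h₂, State.reg_set, if_neg (by omega), h₁.2]
      have e2 : s₃.reg (2 * d + 3) = cond o 1 0 := by
        rw [h₃, State.reg_set, if_neg (by omega), h₂, State.reg_set, if_pos rfl]
      have e3 : s₃.reg (2 * d + 5) = 0 := by rw [h₃, State.reg_set, if_pos rfl]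
      refine (ihe σ s₃ (d + 3) (by omega) (h.agree hd ha) oe).mono le_rfl fun s' h' => ?_
      have ha' : Agree d s s' := ha.trans h'.1 (by omega)
      refine ⟨ha'.mem, fun k _ => ha'.even k, ha'.odd, ?_, ?_, ?_, h'.2⟩
      · rw [h'.1.odd d (by omega), e1]
      · rw [bigVal_zero]; exact (h'.1.odd (d + 1) (by omega)).trans e2
      · exact (h'.1.odd (d + 2) (by omega)).trans e3
    · intro i s' hi hs
      rw [testCost, hs.counter, hs.bound]
      have := hsz i hi
      have := hsz N le_rfl
      exact ⟨by omega, Iff.rfl⟩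
    · intro i s' hi hs
      refine reaches_big_body h hd hi oN hy (fun s'' h'' => ?_) hfy hs
      exact ihb _ s'' (d + 4) (by omega) h'' (ob i hi)
    · refine (reaches_move (by omega) s₅).mono
        (by rw [h₅.saved]; have := h.bdd.1 r; omega) fun s' h' => ?_
      refine ⟨⟨h'.1.trans h₅.mem, fun k => ?_, fun k hk => ?_⟩, ?_⟩
      -- Restoring the saved value makes the bound variable local to the expression, so that
      -- evaluation changes no variable.
      · rw [h'.2]; split_ifs with hk
        · rw [h₅.saved, hk, h.var]
        · exact h₅.even k (by omega)
      · rw [h'.2, if_neg (by omega), h₅.odd k hk]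
      · rw [h'.2, if_neg (by omega), h₅.acc]
    · rintro s' ⟨hm, hr⟩
      refine ⟨⟨hm.trans h₆.1.mem, fun k => ?_, fun k hk => ?_⟩, ?_⟩
      · rw [hr, if_neg (by omega), h₆.1.even k]
      · rw [hr, if_neg (by omega), h₆.1.odd k hk]
      · rw [hr, if_pos rfl, h₆.2]; rfl
    · simp only [Expr.deg, pow_add, two_mul, ← hydef]
      set x := Γ.bits ^ e.deg
      set S := Γ.bits
      have e1 : S ≤ S * (y * y) := Nat.le_mul_of_pos_right _ (by positivity)
      have e2 : N * (S + S + 1 + 20 * (S * (y * y))) ≤ S * (23 * (S * (y * y))) :=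
        Nat.mul_le_mul oN (by omega)
      have e3 : (N + N) * y ≤ 2 * (S * (y * y)) := by
        calc (N + N) * y ≤ (S + S) * (y * y) := Nat.mul_le_mul (by omega) (by nlinarith)
          _ = _ := by ring
      have e4 : S * (y * y) ≤ S * (S * (y * y)) := Nat.le_mul_of_pos_left _ (by omega)
      have e5 : S * (S * (y * y)) ≤ x * (S * (S * (y * y))) := Nat.le_mul_of_pos_left _ (by omega)
      have e6 : x ≤ x * (S * (S * (y * y))) := Nat.le_mul_of_pos_right _ (by positivity)
      have e7 : S * (23 * (S * (y * y))) = 23 * (S * (S * (y * y))) := by ring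
      -- Of the nine powers reserved in `Expr.deg`, two occur in the product and seven absorb the
      -- constants by 4 ≤ `Γ.bits`.
      calc _ ≤ 4 ^ 7 * (x * (S * (S * (y * y)))) := by omega
        _ ≤ S ^ 7 * (x * (S * (S * (y * y)))) :=
          Nat.mul_le_mul_right _ (Nat.pow_le_pow_left h4 7)
        _ = _ := by ring

end RAM

/-! ### Statements and the counting of steps -/

namespace RAM

/-- Programs over variables and arrays. In `loop r e p` the variable `r` runs through the numbers
below the value that `e` has at the start. -/
inductive Stmt where
  | assign (r : ℕ) (e : Expr)
  | store (j : Fin 4) (a b : Expr)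
  | seq (p q : Stmt)
  | loop (r : ℕ) (e : Expr) (p : Stmt)

/-- The translation to the machine; the registers `2 * k + 1` with `k ≥ d` are free. -/
def Stmt.compile : Stmt → ℕ → Prog
  | .assign r e, d => .seq (e.compile d) (move (2 * r) (2 * d + 1))
  | .store j a b, d => .seq (a.compile d) <| .seq (address j d) <| .seq (b.compile (d + 1)) <|
      .instr (.store (2 * d + 1) (2 * d + 3))
  | .seq p q, d => .seq (p.compile d) (q.compile d)
  | .loop r e p, d => .seq (.instr (.const (2 * d + 1) 0)) <| .seq (e.compile (d + 1)) <|
      .whileLt (2 * d + 1) (2 * d + 3) <| .seq (move (2 * r) (2 * d + 1)) <|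
      .seq (p.compile (d + 2)) <| .seq (.instr (.const (2 * d + 5) 1)) <|
      .instr (.arith .add (2 * d + 1) (2 * d + 1) (2 * d + 5))

/-- An exponent for the polynomial that bounds the time of a single step. -/
def Stmt.deg : Stmt → ℕ
  | .assign _ e => e.deg + 1
  | .store _ a b => a.deg + b.deg + 5
  | .seq p q => p.deg + q.deg
  | .loop _ e p => e.deg + p.deg + 3

/-- The statement `p`, started in the environment `σ`, terminates after at most `c` steps in an
environment satisfying `Q`. -/
def Triple (Γ : Ctx) (p : Stmt) (σ : Env) (c : ℕ) (Q : Env → Prop) : Prop :=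
  ∀ (κ d : ℕ) (s : State), 1 ≤ d → p.deg ≤ κ → Rel Γ σ s →
    Reaches (p.compile d) s (c * Γ.bits ^ κ) fun s' =>
      ∃ σ', Rel Γ σ' s' ∧ Q σ' ∧ ∀ k < d, s'.reg (2 * k + 1) = s.reg (2 * k + 1)

/-- The expression `e` can be evaluated in `σ`, with value `x`. -/
def Ev (Γ : Ctx) (σ : Env) (e : Expr) (x : ℕ) : Prop := e.ok Γ σ ∧ e.eval Γ σ = x

variable {Γ : Ctx} {σ : Env}

theorem Triple.mono {p : Stmt} {c c' : ℕ} {Q Q' : Env → Prop} (h : Triple Γ p σ c Q) (hc : c ≤ c')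
    (hQ : ∀ σ', Q σ' → Q' σ') : Triple Γ p σ c' Q' := fun κ d s hd hκ hs =>
  (h κ d s hd hκ hs).mono (Nat.mul_le_mul_right _ hc)
    fun _ ⟨σ', h1, h2, h3⟩ => ⟨σ', h1, hQ _ h2, h3⟩

/-- This is where `Triple` needs every exponent κ from the degree on: both parts are charged the
same power, so their step counts simply add. -/
theorem Triple.seq {p q : Stmt} {c c' : ℕ} {Q Q' : Env → Prop} (h : Triple Γ p σ c Q)
    (h' : ∀ σ', Q σ' → Triple Γ q σ' c' Q') : Triple Γ (.seq p q) σ (c + c') Q' := by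
  intro κ d s hd hκ hs
  rw [add_mul]
  rw [Stmt.deg] at hκ
  refine (h κ d s hd (by omega) hs).seq ?_
  rintro s' ⟨σ', h1, h2, h3⟩
  refine (h' σ' h2 κ d s' hd (by omega) h1).mono le_rfl ?_
  rintro s'' ⟨σ'', h4, h5, h6⟩
  exact ⟨σ'', h4, h5, fun k hk => (h6 k hk).trans (h3 k hk)⟩

/-- Only the final value has to be short, which preserves `Env.Bdd`; intermediate results may be
longer, within the bound for expressions. -/
theorem Triple.assign {r : ℕ} {e : Expr} {x : ℕ} {Q : Env → Prop} (he : Ev Γ σ e x)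
    (hx : Nat.size x ≤ Γ.bits) (hQ : Q (σ.setVar r x)) : Triple Γ (.assign r e) σ 1 Q := by
  intro κ d s hd hκ hs
  rw [Stmt.deg] at hκ
  have h4 := hs.good.four_le
  have h1 := one_le_bits_pow hs.good e.deg
  have hsz := e.size_eval_le hs.good σ hs.bdd he.1
  rw [he.2] at hsz
  refine Reaches.mono ((e.reaches_compile σ s d hd hs he.1).seq fun s₁ h₁ =>
    (reaches_move (by omega) s₁).mono (T' := Γ.bits ^ e.deg + 2) (by rw [h₁.2, he.2]; omega) ?_) ?_
    fun _ h => h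
  · rintro s' ⟨hm, hr⟩
    rw [h₁.2, he.2] at hr
    refine ⟨_, ⟨hs.good, hs.bdd.setVar hx, fun k => ?_, ?_, fun k hk => ?_, fun j k => ?_⟩, hQ,
      fun k hk => ?_⟩
    · rw [hr, Env.var_setVar, h₁.1.even, hs.var]
      simp
    · rw [hr, if_neg (by omega), (hs.agree hd h₁.1).base]
    · rw [hm, h₁.1.mem, hs.inp k hk]
    · rw [hm, h₁.1.mem, hs.arr]; rfl
    · rw [hr, if_neg (by omega), h₁.1.odd k hk]
  · calc _ ≤ Γ.bits ^ e.deg * 4 := by omega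
      _ ≤ Γ.bits ^ e.deg * Γ.bits := Nat.mul_le_mul_left _ h4
      _ = Γ.bits ^ (e.deg + 1) := (pow_succ _ _).symm
      _ ≤ Γ.bits ^ κ := Nat.pow_le_pow_right (by omega) hκ
      _ = _ := (one_mul _).symm

theorem Triple.store {j : Fin 4} {a b : Expr} {i x : ℕ} {Q : Env → Prop} (ha : Ev Γ σ a i)
    (hb : Ev Γ σ b x) (hx : Nat.size x ≤ Γ.bits) (hQ : Q (σ.setArr j i x)) :
    Triple Γ (.store j a b) σ 1 Q := by
  intro κ d s hd hκ hs
  rw [Stmt.deg] at hκ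
  have h4 := hs.good.four_le
  have h1 := one_le_bits_pow hs.good a.deg
  have h2 := one_le_bits_pow hs.good b.deg
  have hsz := a.size_eval_le hs.good σ hs.bdd ha.1
  rw [ha.2] at hsz
  refine Reaches.mono ((a.reaches_compile σ s d hd hs ha.1).seq fun s₁ h₁ =>
    (reaches_address (hs.agree hd h₁.1) j hd h1 (by rw [h₁.2, ha.2]; exact hsz)).seq fun s₂ h₂ =>
    (b.reaches_compile σ s₂ (d + 1) (by omega)
      (hs.agree hd (h₁.1.trans h₂.1 le_rfl)) hb.1).seq fun s₃ h₃ =>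
    Reaches.instr (T := Γ.bits ^ a.deg + Γ.bits + 10 + Γ.bits + 1) ?_ ?_) ?_ fun _ h => h
  · have e1 : s₃.reg (2 * d + 1) = s₂.reg (2 * d + 1) := h₃.1.odd d (by omega)
    have e2 : s₃.reg (2 * d + 3) = x := h₃.2.trans hb.2
    have := h₂.2.2
    simp only [Instr.cost]
    rw [e1, e2]; omega
  · have e1 : s₃.reg (2 * d + 1) = i * 4 + j + Γ.base :=
      (h₃.1.odd d (by omega)).trans (by rw [h₂.2.1, h₁.2, ha.2])
    have e2 : s₃.reg (2 * d + 3) = x := h₃.2.trans hb.2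
    have hA : Agree d s s₃ := (h₁.1.trans h₂.1 le_rfl).trans h₃.1 (by omega)
    have hR := hs.agree hd hA
    refine ⟨_, ⟨hs.good, hs.bdd.setArr hx, hR.var, hR.base, fun k hk => ?_, fun j' k => ?_⟩, hQ,
      hA.odd⟩
    · simp only [Instr.exec]
      rw [e1, Function.update_of_ne (by omega), hR.inp k hk]
    · simp only [Instr.exec]
      rw [e1, e2, Function.update_apply, Env.arr_setArr, hR.arr]
      congr 1
      have := j.isLt
      have := j'.isLt
      rw [Fin.ext_iff]
      -- Since j and j' are below 4, equal addresses have equal quotients and remainders modulo 4.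
      exact propext ⟨fun h => by omega, fun h => by omega⟩
  · have hxS : Γ.bits ^ a.deg ≤ Γ.bits ^ a.deg * Γ.bits := by nlinarith
    have hxS2 : Γ.bits ≤ Γ.bits ^ a.deg * Γ.bits := by nlinarith
    have hz : Γ.bits ^ a.deg * Γ.bits ≤ Γ.bits ^ a.deg * Γ.bits * Γ.bits ^ b.deg :=
      Nat.le_mul_of_pos_right _ (by omega)
    have hy : Γ.bits ^ b.deg ≤ Γ.bits ^ a.deg * Γ.bits * Γ.bits ^ b.deg :=
      Nat.le_mul_of_pos_left _ (by positivity)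
    calc _ ≤ 4 ^ 4 * (Γ.bits ^ a.deg * Γ.bits * Γ.bits ^ b.deg) := by omega
      _ ≤ Γ.bits ^ 4 * (Γ.bits ^ a.deg * Γ.bits * Γ.bits ^ b.deg) :=
        Nat.mul_le_mul_right _ (Nat.pow_le_pow_left h4 4)
      _ = Γ.bits ^ (a.deg + b.deg + 5) := by ring
      _ ≤ Γ.bits ^ κ := Nat.pow_le_pow_right (by omega) hκ
      _ = _ := (one_mul _).symm

/-- Unlike in `Expr.big`, only the binary length of N is bounded, so exponentially many rounds are
allowed. The counter has a register of its own; the extra step per round pays for the test and the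
increment. -/
theorem Triple.loop {r : ℕ} {e : Expr} {p : Stmt} {N c : ℕ} (I : ℕ → Env → Prop)
    (he : Ev Γ σ e N) (hN : Nat.size N ≤ Γ.bits) (h₀ : I 0 σ)
    (hI : ∀ i < N, ∀ τ, I i τ → Triple Γ p (τ.setVar r i) c (I (i + 1))) :
    Triple Γ (.loop r e p) σ (N * (c + 1) + 1) (I N) := by
  intro κ d s hd hκ hs
  rw [Stmt.deg] at hκ
  have h4 := hs.good.four_le
  have h1 := one_le_bits_pow hs.good e.deg
  have hsz : ∀ i ≤ N, Nat.size i ≤ Γ.bits := fun i hi => (Nat.size_le_size hi).trans hN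
  have hκ3 : Γ.bits ^ (e.deg + 3) ≤ Γ.bits ^ κ := Nat.pow_le_pow_right (by omega) (by omega)
  have hb : 64 * Γ.bits ^ e.deg ≤ Γ.bits ^ κ := by
    refine le_trans ?_ hκ3
    rw [pow_add, mul_comm]
    exact Nat.mul_le_mul_left _ (Nat.pow_le_pow_left h4 3)
  have hb' : 16 * Γ.bits ≤ Γ.bits ^ κ := by
    refine le_trans ?_ hκ3
    calc 16 * Γ.bits = 1 * (4 ^ 2 * Γ.bits) := by ring
      _ ≤ Γ.bits ^ e.deg * (Γ.bits ^ 2 * Γ.bits) :=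
        Nat.mul_le_mul h1 (Nat.mul_le_mul_right _ (Nat.pow_le_pow_left h4 2))
      _ = _ := by ring
  let J : ℕ → State → Prop := fun i s' => (∃ τ, Rel Γ τ s' ∧ I i τ) ∧
    (∀ k < d, s'.reg (2 * k + 1) = s.reg (2 * k + 1)) ∧ s'.reg (2 * d + 1) = i ∧
      s'.reg (2 * d + 3) = N
  refine Reaches.mono (Reaches.seq (T := 1) (Φ := fun s' => s' = s.set (2 * d + 1) 0)
      (reaches_const (by simp) rfl) fun s₁ h₁ =>
    Reaches.seq (T := Γ.bits ^ e.deg) (Φ := J 0) ?_ fun s₂ h₂ =>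
    (Reaches.whileLt (T₀ := 2 * Γ.bits + 1)
      (T := (Γ.bits + 2) + (c * Γ.bits ^ κ + (2 + (Γ.bits + 1) * 2))) N J h₂ ?_ ?_).mono le_rfl ?_)
    ?_ fun _ h => h
  · have ha : Agree d s s₁ := h₁ ▸ Agree.set _ _ le_rfl
    have hR := hs.agree hd ha
    refine (e.reaches_compile σ s₁ (d + 1) (by omega) hR he.1).mono le_rfl fun s' h' => ?_
    refine ⟨⟨σ, hR.agree (by omega) h'.1, h₀⟩, fun k hk => ?_, ?_, h'.2.trans he.2⟩
    · rw [h'.1.odd k (by omega), ha.odd k hk]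
    · rw [h'.1.odd d (by omega), h₁, State.reg_set, if_pos rfl]
  · rintro i s' hi ⟨-, -, e1, e2⟩
    rw [testCost, e1, e2]
    have := hsz i hi
    exact ⟨by omega, Iff.rfl⟩
  · rintro i s' hi ⟨⟨τ, hτ, hIτ⟩, hk, e1, e2⟩
    have hi' := hsz i hi.le
    refine Reaches.seq (Φ := fun s'' => Rel Γ (τ.setVar r i) s'' ∧
        (∀ k < d, s''.reg (2 * k + 1) = s.reg (2 * k + 1)) ∧ s''.reg (2 * d + 1) = i ∧
          s''.reg (2 * d + 3) = N)
      ((reaches_move (by omega) s').mono (by rw [e1]; omega) ?_) fun s₃ h₃ =>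
      Reaches.seq (hI i hi τ hIτ κ (d + 2) s₃ (by omega) (by omega) h₃.1) fun s₄ h₄ =>
      Reaches.seq (T := 2) (Φ := fun s' => s' = s₄.set (2 * d + 5) 1)
        (reaches_const (by simp) rfl) fun s₅ h₅ => ?_
    · rintro s'' ⟨hm, hr⟩
      rw [e1] at hr
      refine ⟨⟨hτ.good, hτ.bdd.setVar hi', fun k => ?_, ?_, fun k hk => ?_, fun j k => ?_⟩,
        fun k hk' => ?_, ?_, ?_⟩
      · rw [hr, Env.var_setVar, hτ.var]; simp
      · rw [hr, if_neg (by omega), hτ.base]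
      · rw [hm, hτ.inp k hk]
      · rw [hm, hτ.arr]; rfl
      · rw [hr, if_neg (by omega), hk k hk']
      · rw [hr, if_neg (by omega), e1]
      · rw [hr, if_neg (by omega), e2]
    · obtain ⟨τ', hτ', hIτ', hodd⟩ := h₄
      have f1 : s₅.reg (2 * d + 1) = i := by
        rw [h₅, State.reg_set, if_neg (by omega), hodd d (by omega), h₃.2.2.1]
      have f2 : s₅.reg (2 * d + 5) = 1 := by rw [h₅, State.reg_set, if_pos rfl]
      refine reaches_arith ?_ ⟨⟨τ', ?_, hIτ'⟩, fun k hk => ?_, ?_, ?_⟩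
      · rw [f1, f2]
        exact Nat.mul_le_mul (by omega) (by simp)
      · refine hτ'.agree hd (Agree.trans (d := d) (d' := d) ?_ (Agree.set _ _ le_rfl) le_rfl)
        rw [h₅]
        exact Agree.set (k := d + 2) _ _ (by omega)
      · rw [State.reg_set, if_neg (by omega), h₅, State.reg_set, if_neg (by omega),
          hodd k (by omega), h₃.2.1 k hk]
      · rw [f1, f2, State.reg_set, if_pos rfl]; rfl
      · rw [State.reg_set, if_neg (by omega), h₅, State.reg_set, if_neg (by omega)]
        exact (hodd (d + 1) (by omega)).trans h₃.2.2.2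
  · rintro s' ⟨⟨τ, hτ, hIτ⟩, hk, -, -⟩
    exact ⟨τ, hτ, hIτ, hk⟩
  · have : 2 * Γ.bits + 1 + (Γ.bits + 2 + (c * Γ.bits ^ κ + (2 + (Γ.bits + 1) * 2))) ≤
        (c + 1) * Γ.bits ^ κ := by
      have e1 : (c + 1) * Γ.bits ^ κ = c * Γ.bits ^ κ + Γ.bits ^ κ := by ring
      omega
    have h5 := Nat.mul_le_mul_left N this
    have e2 : (N * (c + 1) + 1) * Γ.bits ^ κ = N * ((c + 1) * Γ.bits ^ κ) + Γ.bits ^ κ := by ring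
    rw [e2]
    omega

/-! ### Evaluation of expressions -/

theorem Ev.congr {e : Expr} {x y : ℕ} (h : Ev Γ σ e x) (hxy : x = y) : Ev Γ σ e y := hxy ▸ h

theorem Ev.var {r x : ℕ} (h : σ.var r = x) : Ev Γ σ (.var r) x := ⟨trivial, h⟩

theorem Ev.lit (c : ℕ) : Ev Γ σ (.lit c) c := ⟨trivial, rfl⟩

theorem Ev.add {a b : Expr} {x y : ℕ} (ha : Ev Γ σ a x) (hb : Ev Γ σ b y) :
    Ev Γ σ (.op .add a b) (x + y) := ⟨⟨ha.1, hb.1⟩, by simp [Expr.eval, ha.2, hb.2, BinOp.eval]⟩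

theorem Ev.sub {a b : Expr} {x y : ℕ} (ha : Ev Γ σ a x) (hb : Ev Γ σ b y) :
    Ev Γ σ (.op .sub a b) (x - y) := ⟨⟨ha.1, hb.1⟩, by simp [Expr.eval, ha.2, hb.2, BinOp.eval]⟩

theorem Ev.mul {a b : Expr} {x y : ℕ} (ha : Ev Γ σ a x) (hb : Ev Γ σ b y) :
    Ev Γ σ (.op .mul a b) (x * y) := ⟨⟨ha.1, hb.1⟩, by simp [Expr.eval, ha.2, hb.2, BinOp.eval]⟩

theorem Ev.div {a b : Expr} {x y : ℕ} (ha : Ev Γ σ a x) (hb : Ev Γ σ b y) :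
    Ev Γ σ (.op .div a b) (x / y) := ⟨⟨ha.1, hb.1⟩, by simp [Expr.eval, ha.2, hb.2, BinOp.eval]⟩

theorem Ev.mod {a b : Expr} {x y : ℕ} (ha : Ev Γ σ a x) (hb : Ev Γ σ b y) :
    Ev Γ σ (.op .mod a b) (x % y) := ⟨⟨ha.1, hb.1⟩, by simp [Expr.eval, ha.2, hb.2, BinOp.eval]⟩

theorem Ev.inp {a : Expr} {x : ℕ} (ha : Ev Γ σ a x) (h : x < Γ.base) :
    Ev Γ σ (.inp a) (Γ.inp x) := ⟨⟨ha.1, ha.2.symm ▸ h⟩, by simp [Expr.eval, ha.2]⟩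

theorem Ev.arr {j : Fin 4} {a : Expr} {x : ℕ} (ha : Ev Γ σ a x) :
    Ev Γ σ (.arr j a) (σ.arr j x) := ⟨ha.1, by simp [Expr.eval, ha.2]⟩

/-- Only the branch taken has to be evaluable, so a test can guard an access to the input or the
bound of an inner loop. -/
theorem Ev.ite {a b p q : Expr} {x y z w : ℕ} (ha : Ev Γ σ a x) (hb : Ev Γ σ b y)
    (hp : x < y → Ev Γ σ p z) (hq : ¬ x < y → Ev Γ σ q w) :
    Ev Γ σ (.ite a b p q) (if x < y then z else w) := by
  refine ⟨⟨ha.1, hb.1, fun h => ?_, fun h => ?_⟩, ?_⟩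
  · rw [ha.2, hb.2] at h; exact (hp h).1
  · rw [ha.2, hb.2] at h; exact (hq h).1
  · simp only [Expr.eval, ha.2, hb.2]
    split_ifs with h
    exacts [(hp h).2, (hq h).2]

theorem Ev.prod {r : ℕ} {e b : Expr} {N : ℕ} {f : ℕ → ℕ} (he : Ev Γ σ e N) (hN : N ≤ Γ.bits)
    (hb : ∀ i < N, Ev Γ (σ.setVar r i) b (f i)) :
    Ev Γ σ (.big true r e b) (∏ i ∈ Finset.range N, f i) := by
  refine ⟨⟨he.1, he.2.symm ▸ hN, fun i hi => (hb i (he.2 ▸ hi)).1⟩, ?_⟩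
  simp only [Expr.eval, bigVal, he.2]
  exact Finset.prod_congr rfl fun i hi => (hb i (Finset.mem_range.1 hi)).2

theorem Ev.sum {r : ℕ} {e b : Expr} {N : ℕ} {f : ℕ → ℕ} (he : Ev Γ σ e N) (hN : N ≤ Γ.bits)
    (hb : ∀ i < N, Ev Γ (σ.setVar r i) b (f i)) :
    Ev Γ σ (.big false r e b) (∑ i ∈ Finset.range N, f i) := by
  refine ⟨⟨he.1, he.2.symm ▸ hN, fun i hi => (hb i (he.2 ▸ hi)).1⟩, ?_⟩
  simp only [Expr.eval, bigVal, he.2]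
  exact Finset.sum_congr rfl fun i hi => (hb i (Finset.mem_range.1 hi)).2

end RAM

/-! ### Parity of the weight of colorings and forests -/

/-- The edge weight: two vertices outside the deleted set (states `1` and `2`) must agree, and then
contribute a factor `2`. -/
def edgeWeight (a b : ℕ) : ℕ := if a = 0 ∨ b = 0 then 1 else if a = b then 2 else 0

/-- The graph whose edges are the given pairs. -/
def pairGraph {V : Type*} [DecidableEq V] (E : Finset (V × V)) : SimpleGraph V :=
  SimpleGraph.fromEdgeSet (E.image fun e => s(e.1, e.2) : Finset (Sym2 V))

/-- The assignments of states to vertices for which exactly the vertices in `S` have state `0`. -/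
def colorings {V : Type*} [DecidableEq V] [Fintype V] (S : Finset V) : Finset (V → ℕ) :=
  Fintype.piFinset fun v => if v ∈ S then {0} else {1, 2}

section ForestParity

variable {V : Type*} [LinearOrder V]

theorem pairGraph_adj {E : Finset (V × V)} (hE : ∀ e ∈ E, e.2 < e.1) {u v : V} :
    (pairGraph E).Adj u v ↔ (u, v) ∈ E ∨ (v, u) ∈ E := by
  simp only [pairGraph, SimpleGraph.fromEdgeSet_adj, Finset.coe_image, Set.mem_image,
    Finset.mem_coe, Prod.exists, Sym2.eq_iff]
  constructor
  · rintro ⟨⟨a, b, h, ⟨rfl, rfl⟩ | ⟨rfl, rfl⟩⟩, -⟩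
    exacts [.inl h, .inr h]
  · rintro (h | h)
    · exact ⟨⟨_, _, h, .inl ⟨rfl, rfl⟩⟩, (hE _ h).ne'⟩
    · exact ⟨⟨_, _, h, .inr ⟨rfl, rfl⟩⟩, (hE _ h).ne⟩

theorem pairGraph_insert (E : Finset (V × V)) (u v : V) :
    pairGraph (insert (u, v) E) = pairGraph E ⊔ SimpleGraph.edge u v := by
  rw [pairGraph, pairGraph, SimpleGraph.edge, ← SimpleGraph.fromEdgeSet_union]
  congr 1
  simp [Finset.image_insert, Set.union_comm]

variable [Fintype V]

theorem mem_colorings {S : Finset V} {f : V → ℕ} :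
    f ∈ colorings S ↔ (∀ v ∈ S, f v = 0) ∧ ∀ v ∉ S, f v = 1 ∨ f v = 2 := by
  simp only [colorings, Fintype.mem_piFinset]
  constructor
  · intro h
    exact ⟨fun v hv => by simpa [hv] using h v, fun v hv => by simpa [hv] using h v⟩
  · rintro ⟨h1, h2⟩ v
    by_cases hv : v ∈ S
    · simp [hv, h1 v hv]
    · simp [hv, h2 v hv]

/-- No factor of a nonzero product vanishes, so the states agree along every edge and hence along
every walk. -/
theorem eq_of_reachable_of_prod_ne_zero {S : Finset V} {E : Finset (V × V)}
    (hE : ∀ e ∈ E, e.2 < e.1 ∧ e.1 ∉ S ∧ e.2 ∉ S) {f : V → ℕ} (hf : f ∈ colorings S)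
    (h : ∏ e ∈ E, edgeWeight (f e.1) (f e.2) ≠ 0) {u v : V} (huv : (pairGraph E).Reachable u v) :
    f u = f v := by
  rw [mem_colorings] at hf
  have key : ∀ e ∈ E, f e.1 = f e.2 := by
    intro e he
    have h1 := (Finset.prod_ne_zero_iff.1 h) e he
    have h2 := hf.2 _ (hE e he).2.1
    have h3 := hf.2 _ (hE e he).2.2
    by_contra hne
    apply h1
    rw [edgeWeight, if_neg (by omega), if_neg hne]
  obtain ⟨w⟩ := huv
  induction w with
  | nil => rfl
  | cons h _ ih =>
    rw [← ih]
    rcases (pairGraph_adj fun e he => (hE e he).1).1 h with h | h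
    exacts [key _ h, (key _ h).symm]

open Classical in
/-- Exchange the states `1` and `2` on the connected component of `u`. -/
noncomputable def flipComponent (S : Finset V) (E : Finset (V × V)) (u : V) (f : V → ℕ) : V → ℕ :=
  fun v => if v ∉ S ∧ (pairGraph E).Reachable u v then 3 - f v else f v

theorem flipComponent_mem {S : Finset V} {E : Finset (V × V)} {u : V} {f : V → ℕ}
    (hf : f ∈ colorings S) : flipComponent S E u f ∈ colorings S := by
  rw [mem_colorings] at hf ⊢
  refine ⟨fun v hv => ?_, fun v hv => ?_⟩
  · simp [flipComponent, hv, hf.1 v hv]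
  · have := hf.2 v hv
    simp only [flipComponent]
    split_ifs <;> omega

theorem flipComponent_flipComponent {S : Finset V} {E : Finset (V × V)} {u : V} {f : V → ℕ}
    (hf : f ∈ colorings S) : flipComponent S E u (flipComponent S E u f) = f := by
  rw [mem_colorings] at hf
  ext v
  simp only [flipComponent]
  split_ifs with h
  · have := hf.2 v h.1
    omega
  · rfl

/-- An edge has both ends in the component or neither, and `edgeWeight` does not change when the
states 1 and 2 are exchanged at both ends. -/
theorem prod_flipComponent {S : Finset V} {E : Finset (V × V)}
    (hE : ∀ e ∈ E, e.2 < e.1 ∧ e.1 ∉ S ∧ e.2 ∉ S) {u : V} {f : V → ℕ} (hf : f ∈ colorings S) :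
    ∏ e ∈ E, edgeWeight (flipComponent S E u f e.1) (flipComponent S E u f e.2) =
      ∏ e ∈ E, edgeWeight (f e.1) (f e.2) := by
  rw [mem_colorings] at hf
  refine Finset.prod_congr rfl fun e he => ?_
  obtain ⟨h1, h2, h3⟩ := hE e he
  have hadj : (pairGraph E).Adj e.1 e.2 := (pairGraph_adj fun e he => (hE e he).1).2 (.inl he)
  have hr : (pairGraph E).Reachable u e.1 ↔ (pairGraph E).Reachable u e.2 :=
    ⟨fun h => h.trans hadj.reachable, fun h => h.trans hadj.symm.reachable⟩
  have e1 := hf.2 _ h2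
  have e2 := hf.2 _ h3
  by_cases h : (pairGraph E).Reachable u e.1
  · simp only [flipComponent, h2, h3, ← hr, h, not_false_eq_true, and_self, if_true]
    rcases e1 with e1 | e1 <;> rcases e2 with e2 | e2 <;> simp [e1, e2, edgeWeight]
  · simp only [flipComponent, ← hr, h, and_false, if_false]

theorem card_colorings (S : Finset V) : (colorings S).card = 2 ^ (Fintype.card V - S.card) := by
  rw [colorings, Fintype.card_piFinset]
  have : ∀ v, (if v ∈ S then ({0} : Finset ℕ) else {1, 2}).card = if v ∈ Sᶜ then 2 else 1 := by
    intro v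
    by_cases hv : v ∈ S <;> simp [hv]
  simp only [this]
  rw [Finset.prod_ite, Finset.prod_const, Finset.prod_const_one, mul_one, Finset.filter_mem_eq_inter,
    Finset.univ_inter, Finset.card_compl]

/-- Induction on the edges replaces the count of components. An edge inside a component imposes no
new constraint: only its factor 2 remains, so q doubles, while a cycle is closed. An edge between
two components keeps half of the total weight, and its factor 2 makes up for that, so q stays;
acyclicity is unaffected as well. -/
theorem sum_colorings_parity (S : Finset V) (E : Finset (V × V))
    (hE : ∀ e ∈ E, e.2 < e.1 ∧ e.1 ∉ S ∧ e.2 ∉ S) :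
    ∃ q, ∑ f ∈ colorings S, ∏ e ∈ E, edgeWeight (f e.1) (f e.2) =
      2 ^ (Fintype.card V - S.card) * q ∧ (Odd q ↔ (pairGraph E).IsAcyclic) := by
  induction E using Finset.induction_on with
  | empty =>
    refine ⟨1, by simp [card_colorings], ?_⟩
    simp [pairGraph]
  | insert e E he ih =>
    obtain ⟨u, v⟩ := e
    obtain ⟨q, hq, hodd⟩ := ih fun e he => hE e (Finset.mem_insert_of_mem he)
    have hE' : ∀ e ∈ E, e.2 < e.1 ∧ e.1 ∉ S ∧ e.2 ∉ S := fun e he =>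
      hE e (Finset.mem_insert_of_mem he)
    obtain ⟨hlt, hu, hv⟩ := hE (u, v) (Finset.mem_insert_self _ _)
    simp only at hlt hu hv
    have hnadj : ¬ (pairGraph E).Adj u v := by
      rw [pairGraph_adj fun e he => (hE' e he).1]
      rintro (h | h)
      exacts [he h, absurd (hE' _ h).1 hlt.not_gt]
    rw [pairGraph_insert, SimpleGraph.isAcyclic_sup_fromEdgeSet_iff]
    set P : (V → ℕ) → ℕ := fun f => ∏ e ∈ E, edgeWeight (f e.1) (f e.2) with hP
    have hsum : ∑ f ∈ colorings S, ∏ e ∈ insert (u, v) E, edgeWeight (f e.1) (f e.2) =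
        ∑ f ∈ colorings S, if f u = f v then 2 * P f else 0 := by
      refine Finset.sum_congr rfl fun f hf => ?_
      rw [Finset.prod_insert he]
      rw [mem_colorings] at hf
      have h1 := hf.2 u hu
      have h2 := hf.2 v hv
      change edgeWeight (f u) (f v) * P f = _
      rw [edgeWeight, if_neg (show ¬ (f u = 0 ∨ f v = 0) by omega), ite_mul, zero_mul]
    rw [hsum]
    by_cases hr : (pairGraph E).Reachable u v
    -- Assignments with f u ≠ f v already have weight 0 on the old edges.
    · refine ⟨2 * q, ?_, ?_⟩
      · rw [mul_left_comm, ← hq, Finset.mul_sum]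
        refine Finset.sum_congr rfl fun f hf => ?_
        split_ifs with h
        · rfl
        · by_contra hne
          exact h (eq_of_reachable_of_prod_ne_zero hE' hf
            (fun h0 => hne (by rw [h0, mul_zero])) hr)
      · simp [hr, hlt.ne', hnadj]
    · refine ⟨q, ?_, by simp [hr, hodd]⟩
      rw [← hq, ← Finset.sum_filter, ← Finset.mul_sum, two_mul,
        ← Finset.sum_filter_add_sum_filter_not (colorings S) (fun f => f u = f v) P]
      congr 1
      have hfu : ∀ f, flipComponent S E u f u = 3 - f u := fun f => by
        simp [flipComponent, hu]
      have hfv : ∀ f, flipComponent S E u f v = f v := fun f => by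
        simp [flipComponent, hr]
      -- Flipping the component of u, which does not contain v, is a weight-preserving involution
      -- that exchanges the cases f u = f v and f u ≠ f v.
      refine Finset.sum_nbij' (flipComponent S E u) (flipComponent S E u) ?_ ?_ ?_ ?_ ?_
      · intro f hf
        rw [Finset.mem_filter] at hf ⊢
        refine ⟨flipComponent_mem hf.1, ?_⟩
        have := (mem_colorings.1 hf.1).2 u hu
        rw [hfu, hfv]; omega
      · intro f hf
        rw [Finset.mem_filter] at hf ⊢
        refine ⟨flipComponent_mem hf.1, ?_⟩
        have h1 := (mem_colorings.1 hf.1).2 u hu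
        have h2 := (mem_colorings.1 hf.1).2 v hv
        have h3 := hf.2
        rw [hfu, hfv]; omega
      · intro f hf
        exact flipComponent_flipComponent (Finset.mem_filter.1 hf).1
      · intro f hf
        exact flipComponent_flipComponent (Finset.mem_filter.1 hf).1
      · intro f hf
        exact (prod_flipComponent hE' (Finset.mem_filter.1 hf).1).symm

/-- A graph all of whose edges lie in `s` is a forest if the graph induced on `s` is. -/
theorem isAcyclic_iff_induce {V : Type*} {G H : SimpleGraph V} {s : Set V}
    (hH : ∀ u v, H.Adj u v ↔ G.Adj u v ∧ u ∈ s ∧ v ∈ s) :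
    H.IsAcyclic ↔ (G.induce s).IsAcyclic := by
  have hi : H.induce s = G.induce s := by
    ext u v
    simp [hH, u.2, v.2]
  rw [← hi]
  refine ⟨fun h => h.induce s, fun h a c hc => ?_⟩
  have hsup : ∀ {a b : V} (w : H.Walk a b), a ∈ s → ∀ x ∈ w.support, x ∈ s := by
    intro a b w
    induction w with
    | nil => simp
    | cons hab _ ih =>
      intro ha x hx
      rw [SimpleGraph.Walk.support_cons, List.mem_cons] at hx
      rcases hx with rfl | hx
      exacts [ha, ih ((hH _ _).1 hab).2.2 x hx]
  have ha : a ∈ s := by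
    cases c with
    | nil => exact absurd rfl hc.ne_nil
    | cons hab _ => exact ((hH _ _).1 hab).2.1
  refine h (c.induce s (hsup c ha)) ?_
  have := SimpleGraph.Walk.map_induce c (hsup c ha)
  rw [← SimpleGraph.Walk.isCycle_map_iff_of_injective
    (f := (SimpleGraph.Embedding.induce s).toHom) Subtype.val_injective]
  exact this.symm ▸ hc

end ForestParity

/-! ### Summation along a tree decomposition -/

section TreeDP

variable {V : Type*} [DecidableEq V]

/-- Restriction of an assignment to a set of vertices. -/
def restrict (A : Finset V) (f : V → ℕ) : V → ℕ := fun v => if v ∈ A then f v else 0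

variable [Fintype V]

/-- The assignments of states to vertices that vanish outside `A`. -/
def assignments (A : Finset V) : Finset (V → ℕ) :=
  Fintype.piFinset fun v => Finset.range (if v ∈ A then 3 else 1)

theorem mem_assignments {A : Finset V} {f : V → ℕ} :
    f ∈ assignments A ↔ (∀ v, f v < 3) ∧ ∀ v ∉ A, f v = 0 := by
  simp only [assignments, Fintype.mem_piFinset, Finset.mem_range]
  constructor
  · intro h
    refine ⟨fun v => ?_, fun v hv => ?_⟩
    · have := h v
      split_ifs at this <;> omega
    · have := h v
      rw [if_neg hv] at this; omega
  · rintro ⟨h1, h2⟩ v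
    split_ifs with hv
    · exact h1 v
    · rw [h2 v hv]; omega

theorem restrict_mem {A B : Finset V} {f : V → ℕ} (hf : f ∈ assignments B) :
    restrict A f ∈ assignments A := by
  rw [mem_assignments] at *
  refine ⟨fun v => ?_, fun v hv => by simp [restrict, hv]⟩
  have := hf.1 v
  simp only [restrict]; split_ifs <;> omega

/-- Assignments vanish outside their set, so gluing two of them on disjoint sets is pointwise
addition, with restriction as the inverse. -/
theorem sum_assignments_union {M : Type*} [AddCommMonoid M] {A B : Finset V} (hAB : Disjoint A B)
    (F : (V → ℕ) → M) : ∑ f ∈ assignments (A ∪ B), F f =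
      ∑ g ∈ assignments A, ∑ h ∈ assignments B, F (g + h) := by
  rw [← Finset.sum_product']
  have hd : ∀ v, v ∈ A → v ∉ B := fun v h1 h2 => Finset.disjoint_left.1 hAB h1 h2
  refine Finset.sum_nbij' (fun f => (restrict A f, restrict B f)) (fun p => p.1 + p.2)
    ?_ ?_ ?_ ?_ ?_
  · intro f hf
    exact Finset.mem_product.2 ⟨restrict_mem hf, restrict_mem hf⟩
  · rintro ⟨g, h⟩ hp
    simp only [Finset.mem_product, mem_assignments] at hp ⊢
    obtain ⟨⟨h1, h2⟩, h3, h4⟩ := hp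
    refine ⟨fun v => ?_, fun v hv => ?_⟩
    · by_cases hv : v ∈ A
      · simp [h4 v (hd v hv), h1 v]
      · simp [h2 v hv, h3 v]
    · rw [Finset.mem_union, not_or] at hv
      simp [h2 v hv.1, h4 v hv.2]
  · intro f hf
    rw [mem_assignments] at hf
    ext v
    simp only [restrict, Pi.add_apply]
    by_cases h1 : v ∈ A
    · simp [h1, hd v h1]
    · by_cases h2 : v ∈ B
      · simp [h1, h2]
      · simp [h1, h2, hf.2 v (by simp [h1, h2])]
  · rintro ⟨g, h⟩ hp
    simp only [Finset.mem_product, mem_assignments] at hp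
    obtain ⟨⟨h1, h2⟩, h3, h4⟩ := hp
    ext v
    · by_cases hv : v ∈ A
      · simp [restrict, hv, h4 v (hd v hv)]
      · simp [restrict, hv, h2 v hv]
    · by_cases hv : v ∈ B
      · simp [restrict, hv, h2 v (fun h => hd v h hv)]
      · simp [restrict, hv, h4 v hv]
  · intro f hf
    rw [mem_assignments] at hf
    congr 1
    ext v
    simp only [restrict, Pi.add_apply]
    by_cases h1 : v ∈ A
    · simp [h1, hd v h1]
    · by_cases h2 : v ∈ B
      · simp [h1, h2]
      · simp [h1, h2, hf.2 v (by simp [h1, h2])]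

variable {R : Type*} [CommSemiring R]

/-- The product of the factors `ψ` over the pairs that lie in `A` and satisfy `p`. -/
def localWeight (I : Finset (V × V)) (ψ : V × V → ℕ → ℕ → R) (A P : Finset V) (f : V → ℕ) : R :=
  ∏ e ∈ I with (e.1 ∈ A ∧ e.2 ∈ A) ∧ ¬ (e.1 ∈ P ∧ e.2 ∈ P), ψ e (f e.1) (f e.2)

/-- A tree decomposition whose nodes are ordered such that parents precede children. The separator
`sep i` is the intersection of the bag of `i` with the bag of its parent; it is empty for the root,
the node `0`. -/
structure OrderedDecomposition (m : ℕ) (I : Finset (V × V)) where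
  bag : ℕ → Finset V
  par : ℕ → ℕ
  sep : ℕ → Finset V
  pos : 0 < m
  par_lt : ∀ i, 0 < i → i < m → par i < i
  par_zero : m ≤ par 0
  sep_zero : sep 0 = ∅
  sep_eq : ∀ i, 0 < i → i < m → sep i = bag i ∩ bag (par i)
  inter : ∀ i, 0 < i → i < m → ∀ j < i, bag i ∩ bag j ⊆ bag (par i)
  cover : ∀ v, ∃ i < m, v ∈ bag i
  cover_pair : ∀ e ∈ I, ∃ i < m, e.1 ∈ bag i ∧ e.2 ∈ bag i

variable {m : ℕ} {I : Finset (V × V)}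

/-- The contribution of an assignment to the bag of the node `i`, given the messages `a` of its
children. -/
def OrderedDecomposition.val (D : OrderedDecomposition m I) (ψ : V × V → ℕ → ℕ → R)
    (a : ℕ → (V → ℕ) → R) (i : ℕ) (f : V → ℕ) : R :=
  (∏ c ∈ Finset.range m, if D.par c = i then a c (restrict (D.sep c) f) else 1) *
    localWeight I ψ (D.bag i) (D.sep i) f

/-- The union of the first `i` bags. -/
def OrderedDecomposition.front (D : OrderedDecomposition m I) (i : ℕ) : Finset V :=
  (Finset.range i).biUnion D.bag

theorem OrderedDecomposition.mem_front {V : Type*} [DecidableEq V] {I : Finset (V × V)} {D : OrderedDecomposition m I} {i : ℕ} {v : V} :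
    v ∈ D.front i ↔ ∃ j < i, v ∈ D.bag j := by
  simp [front]

/-- Descent on j: if j > i, then u occurs in bag i and v in some bag of index at most i, so the
running intersection property moves both to the parent of j. The descent cannot pass below i,
because u occurs in no earlier bag. -/
theorem OrderedDecomposition.pair_mem_bag {V : Type*} [DecidableEq V]
    {I : Finset (V × V)} (D : OrderedDecomposition m I) {i : ℕ} (hi : i < m)
    {u v : V} (hu : u ∈ D.bag i) (hu' : u ∉ D.front i) (hv : v ∈ D.front (i + 1)) :
    ∀ j, j < m → u ∈ D.bag j → v ∈ D.bag j → v ∈ D.bag i := by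
  intro j
  induction j using Nat.strong_induction_on with
  | _ j ih =>
    intro hj huj hvj
    rcases lt_trichotomy j i with h | rfl | h
    · exact absurd (D.mem_front.2 ⟨j, h, huj⟩) hu'
    · exact hvj
    · obtain ⟨k, hk, hvk⟩ := D.mem_front.1 hv
      have hp := D.par_lt j (by omega) hj
      refine ih _ hp (by omega) ?_ ?_
      · exact D.inter j (by omega) hj i h (Finset.mem_inter.2 ⟨huj, hu⟩)
      · exact D.inter j (by omega) hj k (by omega) (Finset.mem_inter.2 ⟨hvj, hvk⟩)

/-- The nodes are removed from the last to the second. The intermediate expression sums over the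
vertices of the first i bags and replaces every subtree hanging off them by the message of its top
node. Removing node i sums out exactly the vertices that first occur in its bag. -/
theorem OrderedDecomposition.sum_eq_sum_front (D : OrderedDecomposition m I)
    (ψ : V × V → ℕ → ℕ → R) (a : ℕ → (V → ℕ) → R)
    (ha : ∀ i < m, ∀ h ∈ assignments (D.sep i),
      a i h = ∑ f ∈ assignments (D.bag i) with restrict (D.sep i) f = h, D.val ψ a i f) :
    ∀ k i, 0 < i → i + k = m → ∑ f ∈ assignments Finset.univ, localWeight I ψ Finset.univ ∅ f =
      ∑ f ∈ assignments (D.front i), localWeight I ψ (D.front i) ∅ f *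
        ∏ c ∈ Finset.Ico i m, if D.par c < i then a c (restrict (D.sep c) f) else 1 := by
  intro k
  induction k with
  | zero =>
    intro i hi him
    have hf : D.front i = Finset.univ := by
      ext v
      obtain ⟨j, hj, hv⟩ := D.cover v
      simp only [Finset.mem_univ, iff_true]
      exact D.mem_front.2 ⟨j, by omega, hv⟩
    rw [hf, Finset.Ico_eq_empty (by omega)]
    simp
  | succ k ih =>
    intro i hi him
    have him' : i < m := by omega
    rw [ih (i + 1) (by omega) (by omega)]
    have hsep := D.sep_eq i hi him'
    have hpar := D.par_lt i hi him'
    set A := D.bag i \ D.sep i with hA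
    -- By the running intersection property, a vertex of bag i in any earlier bag is in the parent's
    -- bag, hence in the separator.
    have hmemA : ∀ v, v ∈ A ↔ v ∈ D.bag i ∧ v ∉ D.front i := by
      intro v
      rw [hA, Finset.mem_sdiff, hsep, Finset.mem_inter, D.mem_front]
      constructor
      · rintro ⟨h1, h2⟩
        refine ⟨h1, fun ⟨j, hj, hv⟩ => h2 ⟨h1, ?_⟩⟩
        exact D.inter i hi him' j hj (Finset.mem_inter.2 ⟨h1, hv⟩)
      · rintro ⟨h1, h2⟩
        exact ⟨h1, fun h => h2 ⟨_, hpar, h.2⟩⟩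
    have hdisj : Disjoint (D.front i) A :=
      Finset.disjoint_left.2 fun v h1 h2 => ((hmemA v).1 h2).2 h1
    have hfront' : ∀ v, v ∈ D.front (i + 1) ↔ v ∈ D.front i ∨ v ∈ D.bag i := by
      intro v
      simp only [D.mem_front]
      constructor
      · rintro ⟨j, hj, hv⟩
        rcases Nat.lt_succ_iff_lt_or_eq.1 hj with h | rfl
        exacts [.inl ⟨j, h, hv⟩, .inr hv]
      · rintro (⟨j, hj, hv⟩ | hv)
        exacts [⟨j, by omega, hv⟩, ⟨i, by omega, hv⟩]
    have hfront : D.front (i + 1) = D.front i ∪ A := by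
      ext v
      rw [hfront', Finset.mem_union, hmemA]
      tauto
    have hbag : D.bag i = D.sep i ∪ A := by
      rw [hA, Finset.union_sdiff_of_subset]
      rw [hsep]; exact Finset.inter_subset_left
    have hsf : D.sep i ⊆ D.front i := by
      intro v hv
      rw [hsep, Finset.mem_inter] at hv
      exact D.mem_front.2 ⟨_, hpar, hv.2⟩
    have hdisj' : Disjoint (D.sep i) A := Finset.disjoint_sdiff
    have hsepfront : ∀ c, i < c → c < m → ∀ j, D.par c = j → ∀ v ∈ D.sep c, v ∈ D.bag j := by
      rintro c hc hcm j rfl v hv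
      rw [D.sep_eq c (by omega) hcm, Finset.mem_inter] at hv
      exact hv.2
    rw [hfront, sum_assignments_union hdisj]
    refine Finset.sum_congr rfl fun g hg => ?_
    have hg' := mem_assignments.1 hg
    have hasum : a i (restrict (D.sep i) g) =
        ∑ h ∈ assignments A, D.val ψ a i (restrict (D.sep i) g + h) := by
      rw [ha i him' _ (restrict_mem hg), Finset.sum_filter, hbag, sum_assignments_union hdisj',
        Finset.sum_eq_single (restrict (D.sep i) g)]
      · refine Finset.sum_congr rfl fun h hh => ?_
        rw [if_pos]
        ext v
        by_cases hv : v ∈ D.sep i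
        · have : h v = 0 :=
            (mem_assignments.1 hh).2 v (Finset.disjoint_left.1 hdisj' hv)
          simp [restrict, hv, this]
        · simp [restrict, hv]
      · intro g' hg₁ hne
        refine Finset.sum_eq_zero fun h hh => ?_
        rw [if_neg]
        rintro heq
        apply hne
        rw [← heq]
        ext v
        by_cases hv : v ∈ D.sep i
        · have : h v = 0 :=
            (mem_assignments.1 hh).2 v (Finset.disjoint_left.1 hdisj' hv)
          simp [restrict, hv, this]
        · simp [restrict, hv, (mem_assignments.1 hg₁).2 v hv]
      · intro h
        exact absurd (restrict_mem hg) h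
    rw [Finset.prod_eq_prod_Ico_succ_bot him', if_pos hpar, hasum, mul_left_comm, Finset.sum_mul]
    refine Finset.sum_congr rfl fun h hh => ?_
    have hh' := mem_assignments.1 hh
    have hgh : ∀ v ∈ D.front i, (g + h) v = g v := fun v hv => by
      simp [hh'.2 v (Finset.disjoint_left.1 hdisj hv)]
    have hrh : ∀ v ∈ D.bag i, (g + h) v = (restrict (D.sep i) g + h) v := by
      intro v hv
      by_cases hs : v ∈ D.sep i
      · simp [restrict, hs]
      · have : v ∉ D.front i := ((hmemA v).1 (Finset.mem_sdiff.2 ⟨hv, hs⟩)).2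
        simp [restrict, hs, hg'.2 v this]
    -- Each pair shares a bag, so by `pair_mem_bag` a pair that becomes complete at node i lies in
    -- bag i. Excluding the pairs inside the separator prevents double counting.
    have hw : localWeight I ψ (D.front i ∪ A) ∅ (g + h) = localWeight I ψ (D.front i) ∅ g *
        localWeight I ψ (D.bag i) (D.sep i) (restrict (D.sep i) g + h) := by
      have e1 : localWeight I ψ (D.front i) ∅ g =
          ∏ e ∈ I, if e.1 ∈ D.front i ∧ e.2 ∈ D.front i then ψ e ((g + h) e.1) ((g + h) e.2) else 1 := by
        rw [localWeight, Finset.prod_filter]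
        refine Finset.prod_congr rfl fun e _ => ?_
        simp only [Finset.notMem_empty, and_self, not_false_eq_true, and_true]
        split_ifs with hc
        · rw [hgh _ hc.1, hgh _ hc.2]
        · rfl
      have e2 : localWeight I ψ (D.bag i) (D.sep i) (restrict (D.sep i) g + h) =
          ∏ e ∈ I, if (e.1 ∈ D.bag i ∧ e.2 ∈ D.bag i) ∧ ¬ (e.1 ∈ D.sep i ∧ e.2 ∈ D.sep i) then
            ψ e ((g + h) e.1) ((g + h) e.2) else 1 := by
        rw [localWeight, Finset.prod_filter]
        refine Finset.prod_congr rfl fun e _ => ?_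
        split_ifs with hc
        · rw [hrh _ hc.1.1, hrh _ hc.1.2]
        · rfl
      rw [e1, e2, localWeight, Finset.prod_filter, ← Finset.prod_mul_distrib]
      refine Finset.prod_congr rfl fun e he => ?_
      simp only [Finset.notMem_empty, and_self, not_false_eq_true, and_true]
      obtain ⟨j, hj, hj1, hj2⟩ := D.cover_pair e he
      have hsepiff : ∀ v, v ∈ D.sep i ↔ v ∈ D.bag i ∧ v ∈ D.front i := by
        intro v
        refine ⟨fun hv => ⟨hbag ▸ Finset.mem_union_left _ hv, hsf hv⟩, fun ⟨h1, h2⟩ => ?_⟩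
        by_contra h3
        exact ((hmemA v).1 (Finset.mem_sdiff.2 ⟨h1, h3⟩)).2 h2
      have k1 : e.1 ∈ D.bag i → e.1 ∉ D.front i → e.2 ∈ D.front (i + 1) → e.2 ∈ D.bag i :=
        fun h1 h2 h3 => D.pair_mem_bag him' h1 h2 h3 j hj hj1 hj2
      have k2 : e.2 ∈ D.bag i → e.2 ∉ D.front i → e.1 ∈ D.front (i + 1) → e.1 ∈ D.bag i :=
        fun h1 h2 h3 => D.pair_mem_bag him' h1 h2 h3 j hj hj2 hj1
      rw [hfront'] at k1 k2
      simp only [← hfront, hfront', hsepiff]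
      clear * - k1 k2
      by_cases f1 : e.1 ∈ D.front i <;> by_cases f2 : e.2 ∈ D.front i <;>
        by_cases b1 : e.1 ∈ D.bag i <;> by_cases b2 : e.2 ∈ D.bag i <;>
        simp only [f1, f2, b1, b2, not_true_eq_false, not_false_eq_true, or_true, or_self,
          true_implies, false_implies, and_self, and_true, and_false, if_true,
          if_false, mul_one, one_mul, or_false] at k1 k2 ⊢
    -- The later nodes with parent at most i are the children of i and those hanging off the earlier
    -- nodes. The former may be collected over all c < m, since no child precedes its parent and
    -- `par 0 ≥ m` makes the root nobody's child.
    have hc : (∏ c ∈ Finset.Ico (i + 1) m,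
          if D.par c < i + 1 then a c (restrict (D.sep c) (g + h)) else 1) =
        (∏ c ∈ Finset.range m, if D.par c = i then
            a c (restrict (D.sep c) (restrict (D.sep i) g + h)) else 1) *
          ∏ c ∈ Finset.Ico (i + 1) m, if D.par c < i then a c (restrict (D.sep c) g) else 1 := by
      have hz : ∏ c ∈ Finset.range (i + 1), (if D.par c = i then
            a c (restrict (D.sep c) (restrict (D.sep i) g + h)) else 1) = 1 := by
        refine Finset.prod_eq_one fun c hc => ?_
        rw [Finset.mem_range] at hc
        rw [if_neg]
        rcases Nat.eq_zero_or_pos c with rfl | h0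
        · have := D.par_zero; omega
        · have := D.par_lt c h0 (by omega); omega
      rw [← Finset.prod_range_mul_prod_Ico _ (show i + 1 ≤ m by omega), hz, one_mul,
        ← Finset.prod_mul_distrib]
      refine Finset.prod_congr rfl fun c hc => ?_
      rw [Finset.mem_Ico] at hc
      rcases lt_trichotomy (D.par c) i with h1 | h1 | h1
      · rw [if_pos (by omega), if_neg (by omega), if_pos h1, one_mul]
        congr 1
        ext v
        simp only [restrict]
        split_ifs with hv
        · exact hgh v (D.mem_front.2 ⟨_, h1, hsepfront c (by omega) hc.2 _ rfl v hv⟩)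
        · rfl
      · rw [if_pos (by omega), if_pos h1, if_neg (by omega), mul_one]
        congr 1
        ext v
        simp only [restrict]
        split_ifs with hv
        · exact hrh v (hsepfront c (by omega) hc.2 _ h1 v hv)
        · rfl
      · rw [if_neg (by omega), if_neg (by omega), if_neg (by omega), mul_one]
    rw [hw, hc, OrderedDecomposition.val]
    ring

/-- The message of the root is the total weight. -/
theorem OrderedDecomposition.sum_eq_message (D : OrderedDecomposition m I)
    (ψ : V × V → ℕ → ℕ → R) (a : ℕ → (V → ℕ) → R)
    (ha : ∀ i < m, ∀ h ∈ assignments (D.sep i),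
      a i h = ∑ f ∈ assignments (D.bag i) with restrict (D.sep i) f = h, D.val ψ a i f) :
    a 0 0 = ∑ f ∈ assignments Finset.univ, localWeight I ψ Finset.univ ∅ f := by
  have hm := D.pos
  have hf : D.front 1 = D.bag 0 := by simp [front]
  have h0 : (0 : V → ℕ) ∈ assignments (D.sep 0) := mem_assignments.2 ⟨by simp, by simp⟩
  -- With one node left the front is the bag of the root. Its separator is empty, so its message has
  -- a single entry, at the zero assignment.
  rw [D.sum_eq_sum_front ψ a ha (m - 1) 1 one_pos (by omega), hf, ha 0 hm 0 h0,
    Finset.filter_true_of_mem fun f _ => by ext v; simp [D.sep_zero, restrict]]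
  refine Finset.sum_congr rfl fun f _ => ?_
  rw [val, D.sep_zero, mul_comm, Finset.range_eq_Ico, Finset.prod_eq_prod_Ico_succ_bot hm,
    if_neg (by have := D.par_zero; omega), one_mul]
  congr 1
  refine Finset.prod_congr rfl fun c _ => ?_
  congr 1
  exact propext ⟨fun h => by omega, fun h => by omega⟩

end TreeDP

/-! ### Reading coefficients as digits -/

theorem sum_mul_pow_lt {X : ℕ} {B : ℕ → ℕ} (k : ℕ) (hB : ∀ i < k, B i < X) :
    ∑ i ∈ Finset.range k, B i * X ^ i < X ^ k := by
  induction k with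
  | zero => simp
  | succ k ih =>
    rw [Finset.sum_range_succ, pow_succ]
    have h1 := ih fun i hi => hB i (by omega)
    have h2 : (B k + 1) * X ^ k ≤ X * X ^ k := Nat.mul_le_mul_right _ (hB k (by omega))
    rw [add_mul, one_mul, mul_comm X] at h2
    omega

/-- The lower terms sum to less than X ^ t and vanish in the division; the higher ones are multiples
of X ^ (t + 1) and vanish in the remainder. -/
theorem sum_mul_pow_div_mod {X : ℕ} {B : ℕ → ℕ} {k t : ℕ} (ht : t < k) (hB : ∀ i < k, B i < X) :
    (∑ i ∈ Finset.range k, B i * X ^ i) / X ^ t % X = B t := by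
  have hX : 0 < X := (Nat.zero_le _).trans_lt (hB t ht)
  obtain ⟨d, hd⟩ : ∃ d, ∑ i ∈ Finset.Ico (t + 1) k, B i * X ^ i = X ^ t * (X * d) := by
    have : X ^ t * X ∣ ∑ i ∈ Finset.Ico (t + 1) k, B i * X ^ i := by
      refine Finset.dvd_sum fun i hi => Dvd.dvd.mul_left ?_ _
      rw [← pow_succ]
      exact pow_dvd_pow _ (Finset.mem_Ico.1 hi).1
    obtain ⟨d, hd⟩ := this
    exact ⟨d, by rw [hd, mul_assoc]⟩
  rw [← Finset.sum_range_add_sum_Ico _ (show t + 1 ≤ k by omega), Finset.sum_range_succ, hd]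
  have h1 := sum_mul_pow_lt t fun i hi => hB i (by omega)
  rw [show ∑ i ∈ Finset.range t, B i * X ^ i + B t * X ^ t + X ^ t * (X * d) =
    ∑ i ∈ Finset.range t, B i * X ^ i + X ^ t * (B t + X * d) by ring,
    Nat.add_mul_div_left _ _ (by positivity), Nat.div_eq_of_lt h1, zero_add, Nat.add_mul_mod_self_left,
    Nat.mod_eq_of_lt (hB t ht)]

/-! ### The generating function and the parity of its coefficients -/

section PartitionFunction

variable {V : Type*} [Fintype V] [LinearOrder V]

/-- The factor of a pair: the vertex weight on the diagonal, the edge weight elsewhere. -/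
def pairFactor (X : ℕ) (e : V × V) (a b : ℕ) : ℕ :=
  if e.1 = e.2 then if a = 0 then X else 1 else edgeWeight a b

open Classical in
/-- The pairs that carry a factor: vertices and edges. -/
noncomputable def factorPairs (G : SimpleGraph V) : Finset (V × V) :=
  Finset.univ.filter fun e => e.2 ≤ e.1 ∧ (e.1 = e.2 ∨ G.Adj e.1 e.2)

open Classical in
/-- The edges, each of them as an ordered pair, that avoid `S`. -/
noncomputable def edgePairs (G : SimpleGraph V) (S : Finset V) : Finset (V × V) :=
  Finset.univ.filter fun e => e.2 < e.1 ∧ G.Adj e.1 e.2 ∧ e.1 ∉ S ∧ e.2 ∉ S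

/-- The generating function of the assignments without an edge between the states `1` and `2`. -/
noncomputable def partitionFunction (G : SimpleGraph V) (X : ℕ) : ℕ :=
  ∑ f ∈ assignments Finset.univ, localWeight (factorPairs G) (pairFactor X) Finset.univ ∅ f

/-- The total edge weight of the assignments with zero set `S`. -/
noncomputable def coloringWeight (G : SimpleGraph V) (S : Finset V) : ℕ :=
  ∑ f ∈ colorings S, ∏ e ∈ edgePairs G S, edgeWeight (f e.1) (f e.2)

/-- The diagonal pairs yield the power of X; edges with an end in S carry the factor 1 and may be
dropped. -/
theorem localWeight_factorPairs (G : SimpleGraph V) (X : ℕ) {S : Finset V} {f : V → ℕ}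
    (hf : f ∈ colorings S) : localWeight (factorPairs G) (pairFactor X) Finset.univ ∅ f =
      X ^ S.card * ∏ e ∈ edgePairs G S, edgeWeight (f e.1) (f e.2) := by
  classical
  rw [mem_colorings] at hf
  have h1 : localWeight (factorPairs G) (pairFactor X) Finset.univ ∅ f =
      ∏ e ∈ factorPairs G, pairFactor X e (f e.1) (f e.2) := by
    rw [localWeight, Finset.filter_true_of_mem (by simp)]
  rw [h1, ← Finset.prod_filter_mul_prod_filter_not _ (fun e : V × V => e.1 = e.2)]
  congr 1
  · have : (factorPairs G).filter (fun e => e.1 = e.2) = Finset.univ.image fun v => (v, v) := by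
      ext ⟨u, v⟩
      simp only [factorPairs, Finset.mem_filter, Finset.mem_univ, true_and, Finset.mem_image,
        Prod.mk.injEq]
      constructor
      · rintro ⟨-, rfl⟩; exact ⟨u, rfl, rfl⟩
      · rintro ⟨w, rfl, rfl⟩; simp
    rw [this, Finset.prod_image (by intro a _ b _ h; exact (Prod.mk.inj h).1)]
    simp only [pairFactor, if_true]
    rw [Finset.prod_ite, Finset.prod_const, Finset.prod_const_one, mul_one]
    congr 2
    ext v
    simp only [Finset.mem_filter, Finset.mem_univ, true_and]
    by_cases hv : v ∈ S
    · simp [hv, hf.1 v hv]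
    · have := hf.2 v hv
      simp only [hv, iff_false]; omega
  · refine (Finset.prod_subset (s₁ := edgePairs G S) ?_ ?_).symm.trans
      (Finset.prod_congr rfl fun e he => ?_)
    · intro e he
      simp only [edgePairs, factorPairs, Finset.mem_filter, Finset.mem_univ, true_and] at he ⊢
      exact ⟨⟨he.1.le, .inr he.2.1⟩, he.1.ne'⟩
    · intro e he hn
      simp only [edgePairs, factorPairs, Finset.mem_filter, Finset.mem_univ, true_and] at he hn
      rw [pairFactor, if_neg he.2, edgeWeight, if_pos]
      have hadj : G.Adj e.1 e.2 := he.1.2.resolve_left he.2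
      by_contra hc
      rw [not_or] at hc
      exact hn ⟨lt_of_le_of_ne he.1.1 (Ne.symm he.2), hadj, fun h => hc.1 (hf.1 _ h),
        fun h => hc.2 (hf.1 _ h)⟩
    · simp only [edgePairs, Finset.mem_filter, Finset.mem_univ, true_and] at he
      rw [pairFactor, if_neg he.1.ne']

theorem partitionFunction_eq (G : SimpleGraph V) (X : ℕ) :
    partitionFunction G X = ∑ S : Finset V, X ^ S.card * coloringWeight G S := by
  classical
  rw [partitionFunction, ← Finset.sum_fiberwise (s := assignments Finset.univ)
    (g := fun f : V → ℕ => Finset.univ.filter fun v => f v = 0)]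
  refine Finset.sum_congr rfl fun S _ => ?_
  have : (assignments Finset.univ).filter
      (fun f : V → ℕ => (Finset.univ.filter fun v => f v = 0) = S) = colorings S := by
    ext f
    rw [Finset.mem_filter, mem_assignments, mem_colorings]
    constructor
    · rintro ⟨⟨h1, -⟩, rfl⟩
      refine ⟨fun v hv => by simpa using hv, fun v hv => ?_⟩
      have := h1 v
      have : f v ≠ 0 := by simpa using hv
      omega
    · rintro ⟨h1, h2⟩
      refine ⟨⟨fun v => ?_, by simp⟩, ?_⟩
      · by_cases hv : v ∈ S
        · rw [h1 v hv]; omega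
        · have := h2 v hv; omega
      · ext v
        simp only [Finset.mem_filter, Finset.mem_univ, true_and]
        by_cases hv : v ∈ S
        · simp [hv, h1 v hv]
        · have := h2 v hv
          simp only [hv, iff_false]; omega
  rw [this, coloringWeight, Finset.mul_sum]
  exact Finset.sum_congr rfl fun f hf => localWeight_factorPairs G X hf

theorem coloringWeight_le (G : SimpleGraph V) (S : Finset V) :
    coloringWeight G S ≤ 2 ^ Fintype.card V * 2 ^ (Fintype.card V * Fintype.card V) := by
  rw [coloringWeight]
  calc _ ≤ (colorings S).card • 2 ^ (Fintype.card V * Fintype.card V) := by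
        refine Finset.sum_le_card_nsmul _ _ _ fun f _ => ?_
        refine (Finset.prod_le_pow_card _ _ 2 fun e _ => ?_).trans ?_
        · rw [edgeWeight]; split_ifs <;> omega
        · refine Nat.pow_le_pow_right (by omega) ((Finset.card_le_univ _).trans ?_)
          rw [Fintype.card_prod]
    _ ≤ _ := by
        rw [smul_eq_mul, card_colorings]
        exact Nat.mul_le_mul_right _ (Nat.pow_le_pow_right (by omega) (Nat.sub_le _ _))

/-- The coefficients of the generating function. -/
noncomputable def sizeWeight (G : SimpleGraph V) (t : ℕ) : ℕ :=
  ∑ S : Finset V with S.card = t, coloringWeight G S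

/-- There are at most 2 ^ n sets of weight at most 2 ^ (n + n * n) each, and 2 * n + n * n < (n + 2)
* (n + 2). This dictates the point of evaluation. -/
theorem sizeWeight_lt (G : SimpleGraph V) (t : ℕ) :
    sizeWeight G t < 2 ^ ((Fintype.card V + 2) * (Fintype.card V + 2)) := by
  rw [sizeWeight]
  have h1 := Finset.sum_le_card_nsmul (Finset.univ.filter fun S : Finset V => S.card = t) _ _
    fun S _ => coloringWeight_le G S
  refine h1.trans_lt ?_
  have h2 : (Finset.univ.filter fun S : Finset V => S.card = t).card ≤ 2 ^ Fintype.card V :=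
    (Finset.card_le_univ _).trans (by rw [Fintype.card_finset])
  rw [smul_eq_mul]
  refine (Nat.mul_le_mul_right _ h2).trans_lt ?_
  rw [← pow_add, ← pow_add]
  exact Nat.pow_lt_pow_right (by omega) (by nlinarith)

theorem partitionFunction_eq_sum_range (G : SimpleGraph V) (X : ℕ) :
    partitionFunction G X =
      ∑ t ∈ Finset.range (Fintype.card V + 1), sizeWeight G t * X ^ t := by
  rw [partitionFunction_eq, ← Finset.sum_fiberwise_of_maps_to
    (t := Finset.range (Fintype.card V + 1)) (g := Finset.card)
    (fun S _ => Finset.mem_range.2 (Nat.lt_succ_of_le (Finset.card_le_univ S)))]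
  refine Finset.sum_congr rfl fun t _ => ?_
  rw [sizeWeight, Finset.sum_mul]
  refine Finset.sum_congr rfl fun S hS => ?_
  rw [(Finset.mem_filter.1 hS).2, mul_comm]

/-- In `pairGraph` the vertices of S remain as isolated vertices, which does not affect acyclicity.
-/
theorem exists_coloringWeight_eq (G : SimpleGraph V) (S : Finset V) :
    ∃ q, coloringWeight G S = 2 ^ (Fintype.card V - S.card) * q ∧
      (Odd q ↔ IsFeedbackVertexSet G S) := by
  have hE : ∀ e ∈ edgePairs G S, e.2 < e.1 ∧ e.1 ∉ S ∧ e.2 ∉ S := by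
    intro e he
    simp only [edgePairs, Finset.mem_filter, Finset.mem_univ, true_and] at he
    tauto
  obtain ⟨q, h1, h2⟩ := sum_colorings_parity S (edgePairs G S) hE
  refine ⟨q, h1, h2.trans ?_⟩
  refine isAcyclic_iff_induce fun u v => ?_
  rw [pairGraph_adj fun e he => (hE e he).1]
  simp only [edgePairs, Finset.mem_filter, Finset.mem_univ, true_and, Set.mem_ofPred_eq]
  constructor
  · rintro (⟨-, h, h', h''⟩ | ⟨-, h, h', h''⟩)
    exacts [⟨h, h', h''⟩, ⟨h.symm, h'', h'⟩]
  · rintro ⟨h, h', h''⟩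
    rcases lt_trichotomy u v with hlt | rfl | hlt
    · exact .inr ⟨hlt, h.symm, h'', h'⟩
    · exact absurd h G.irrefl
    · exact .inl ⟨hlt, h, h', h''⟩

/-- All sets of size t share the power 2 ^ (n - t). Division by it leaves the sum of the quotients,
whose parity is that of the number of odd ones. -/
theorem sizeWeight_parity (G : SimpleGraph V) (t : ℕ) :
    sizeWeight G t / 2 ^ (Fintype.card V - t) % 2 = feedbackVertexSetCount G t % 2 := by
  classical
  choose q hq hodd using exists_coloringWeight_eq G
  have h1 : sizeWeight G t =
      2 ^ (Fintype.card V - t) * ∑ S : Finset V with S.card = t, q S := by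
    rw [sizeWeight, Finset.mul_sum]
    refine Finset.sum_congr rfl fun S hS => ?_
    rw [hq, (Finset.mem_filter.1 hS).2]
  have h2 : feedbackVertexSetCount G t =
      ((Finset.univ.filter fun S : Finset V => S.card = t).filter fun S => Odd (q S)).card := by
    rw [feedbackVertexSetCount, ← Set.ncard_coe_finset]
    congr 1
    ext S
    simp only [hodd, Finset.coe_filter, Finset.mem_filter, Finset.mem_univ, true_and,
      Set.mem_ofPred_eq]
    exact and_comm
  rw [h1, Nat.mul_div_cancel_left _ (by positivity), h2]
  have h3 := Finset.odd_sum_iff_odd_card_odd (s := Finset.univ.filter fun S : Finset V => S.card = t) q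
  rw [Nat.odd_iff, Nat.odd_iff] at h3
  omega

theorem partitionFunction_lt (G : SimpleGraph V) :
    partitionFunction G (2 ^ ((Fintype.card V + 2) * (Fintype.card V + 2))) <
      (2 ^ ((Fintype.card V + 2) * (Fintype.card V + 2))) ^ (Fintype.card V + 1) := by
  rw [partitionFunction_eq_sum_range]
  exact sum_mul_pow_lt _ fun i _ => sizeWeight_lt G i

/-- The parity of the number of feedback vertex sets can be read off the generating function. -/
theorem partitionFunction_parity (G : SimpleGraph V) {t X : ℕ} (ht : t ≤ Fintype.card V)
    (hX : X = 2 ^ ((Fintype.card V + 2) * (Fintype.card V + 2))) :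
    partitionFunction G X / X ^ t % X / 2 ^ (Fintype.card V - t) % 2 =
      feedbackVertexSetCount G t % 2 := by
  rw [partitionFunction_eq_sum_range, sum_mul_pow_div_mod (by omega)
    fun i _ => hX ▸ sizeWeight_lt G i, sizeWeight_parity]

theorem feedbackVertexSetCount_eq_zero {V : Type*} [Fintype V] (G : SimpleGraph V) {t : ℕ} (ht : Fintype.card V < t) :
    feedbackVertexSetCount G t = 0 := by
  rw [feedbackVertexSetCount, Set.ncard_eq_zero]
  ext S
  simp only [Set.mem_ofPred_eq, Set.mem_empty_iff_false, iff_false, not_and]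
  intro _ h
  have := Finset.card_le_univ S
  omega

end PartitionFunction

/-! ### Growth orders of a tree and running intersection -/

section GrowthOrder

variable {W : Type*}

/-- An enumeration of the vertices of a graph in which every vertex but the first is adjacent to an
earlier one. -/
structure IsGrowthOrder (T : SimpleGraph W) (m : ℕ) (o : ℕ → W) (par : ℕ → ℕ) : Prop where
  inj : ∀ i < m, ∀ j < m, o i = o j → i = j
  par_lt : ∀ i, 0 < i → i < m → par i < i
  adj : ∀ i, 0 < i → i < m → T.Adj (o i) (o (par i))

variable {T : SimpleGraph W} {m : ℕ} {o : ℕ → W} {par : ℕ → ℕ}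

theorem IsGrowthOrder.exists_walk_zero (h : IsGrowthOrder T m o par) : ∀ k, k < m →
    ∃ w : T.Walk (o k) (o 0), ∀ x ∈ w.support, ∃ l ≤ k, x = o l := by
  intro k
  induction k using Nat.strong_induction_on with
  | _ k ih =>
    intro hk
    rcases Nat.eq_zero_or_pos k with rfl | h0
    · exact ⟨.nil, fun x hx => ⟨0, le_rfl, by simpa using hx⟩⟩
    · have hp := h.par_lt k h0 hk
      obtain ⟨w, hw⟩ := ih _ hp (by omega)
      refine ⟨.cons (h.adj k h0 hk) w, fun x hx => ?_⟩
      rw [SimpleGraph.Walk.support_cons, List.mem_cons] at hx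
      rcases hx with rfl | hx
      · exact ⟨k, le_rfl, rfl⟩
      · obtain ⟨l, hl, hx⟩ := hw x hx
        exact ⟨l, by omega, hx⟩

/-- There is a path from `o i` to `o j` that first steps to the parent and then uses smaller indices
only. Another one stays inside the connected set S. In a forest they coincide, so the parent lies in
S. For S the set of nodes whose bags contain a given vertex, this is the running intersection
property. -/
theorem IsGrowthOrder.par_mem (h : IsGrowthOrder T m o par) (hT : T.IsAcyclic) {S : Set W}
    (hS : (T.induce S).Connected) {i j : ℕ} (hj : j < i) (hi : i < m) (hiS : o i ∈ S)
    (hjS : o j ∈ S) : o (par i) ∈ S := by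
  classical
  have hp := h.par_lt i (by omega) hi
  obtain ⟨w₁, hw₁⟩ := h.exists_walk_zero (par i) (by omega)
  obtain ⟨w₂, hw₂⟩ := h.exists_walk_zero j (by omega)
  let w := (w₁.append w₂.reverse).bypass
  have hw : ∀ x ∈ w.support, ∃ l < i, x = o l := by
    intro x hx
    have hx := SimpleGraph.Walk.support_bypass_subset_support _ hx
    rw [SimpleGraph.Walk.mem_support_append_iff, SimpleGraph.Walk.support_reverse,
      List.mem_reverse] at hx
    rcases hx with hx | hx
    · obtain ⟨l, hl, hx⟩ := hw₁ x hx
      exact ⟨l, by omega, hx⟩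
    · obtain ⟨l, hl, hx⟩ := hw₂ x hx
      exact ⟨l, by omega, hx⟩
  -- The walk `w` has only indices below i, so it avoids `o i` and can be prolonged to a path.
  have hpath : (SimpleGraph.Walk.cons (h.adj i (by omega) hi) w).IsPath := by
    rw [SimpleGraph.Walk.cons_isPath_iff]
    refine ⟨SimpleGraph.Walk.bypass_isPath _, fun hmem => ?_⟩
    obtain ⟨l, hl, hx⟩ := hw _ hmem
    have := h.inj i hi l (by omega) hx
    omega
  obtain ⟨w₃⟩ := hS.preconnected ⟨o i, hiS⟩ ⟨o j, hjS⟩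
  let w₄ : T.Walk (o i) (o j) := w₃.map (SimpleGraph.Embedding.induce S).toHom
  have hw₄ : ∀ x ∈ w₄.support, x ∈ S := by
    intro x hx
    replace hx : x ∈ (w₃.map (SimpleGraph.Embedding.induce S).toHom).support := hx
    rw [SimpleGraph.Walk.support_map, List.mem_map] at hx
    obtain ⟨y, -, rfl⟩ := hx
    exact y.2
  have heq := (hT.subsingleton_path _ _).elim ⟨_, hpath⟩
    ⟨w₄.bypass, SimpleGraph.Walk.bypass_isPath _⟩
  have heq' := congrArg Subtype.val heq
  simp only at heq'
  refine hw₄ _ (SimpleGraph.Walk.support_bypass_subset_support _ ?_)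
  rw [← heq', SimpleGraph.Walk.support_cons]
  exact List.mem_cons_of_mem _ (SimpleGraph.Walk.start_mem_support _)

/-- A proper nonempty set of vertices of a connected graph is left by an edge. -/
theorem exists_adj_mem_notMem (hT : T.Preconnected) {S : Set W} {x y : W} (hx : x ∈ S)
    (hy : y ∉ S) : ∃ a b, T.Adj a b ∧ a ∈ S ∧ b ∉ S := by
  obtain ⟨w⟩ := hT x y
  induction w with
  | nil => exact absurd hx hy
  | @cons a b c hab _ ih =>
    by_cases hb : b ∈ S
    · exact ih hb hy
    · exact ⟨_, _, hab, hx, hb⟩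

variable {V : Type*} [DecidableEq V] {G : SimpleGraph V}

/-- The decomposition obtained from a tree decomposition by a growth order of its tree. -/
def IsGrowthOrder.decomposition {D : TreeDecomposition G W} (h : IsGrowthOrder D.tree m o par)
    (hm : 0 < m) (ho : ∀ x, ∃ i < m, o i = x) (h0 : m ≤ par 0) (I : Finset (V × V))
    (hI : ∀ e ∈ I, e.1 = e.2 ∨ G.Adj e.1 e.2) : OrderedDecomposition m I where
  bag i := D.bag (o i)
  par := par
  sep i := if i = 0 then ∅ else D.bag (o i) ∩ D.bag (o (par i))
  pos := hm
  par_lt := h.par_lt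
  par_zero := h0
  sep_zero := if_pos rfl
  sep_eq i hi _ := if_neg hi.ne'
  inter i _ him j hj v hv := by
    rw [Finset.mem_inter] at hv
    exact h.par_mem D.isTree.isAcyclic (D.connected v) hj him hv.1 hv.2
  cover v := by
    obtain ⟨x, hx⟩ := D.exists_mem_bag v
    obtain ⟨i, hi, rfl⟩ := ho x
    exact ⟨i, hi, hx⟩
  cover_pair e he := by
    rcases hI e he with h' | h'
    · obtain ⟨x, hx⟩ := D.exists_mem_bag e.1
      obtain ⟨i, hi, rfl⟩ := ho x
      exact ⟨i, hi, hx, h' ▸ hx⟩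
    · obtain ⟨x, hx⟩ := D.exists_edge_bag _ _ h'
      obtain ⟨i, hi, rfl⟩ := ho x
      exact ⟨i, hi, hx⟩

end GrowthOrder

/-! ### Numbering assignments -/

section Codes

variable {n : ℕ}

open Classical in
/-- Whether `v` belongs to `A`, as a number. -/
noncomputable def memBit (A : Finset (Fin n)) (v : ℕ) : ℕ := if ∃ h : v < n, ⟨v, h⟩ ∈ A then 1 else 0

theorem memBit_of_mem {A : Finset (Fin n)} {v : ℕ} {h : v < n} (hA : ⟨v, h⟩ ∈ A) :
    memBit A v = 1 := if_pos ⟨h, hA⟩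

theorem memBit_of_notMem {A : Finset (Fin n)} {v : ℕ} {h : v < n} (hA : ⟨v, h⟩ ∉ A) :
    memBit A v = 0 := if_neg fun ⟨_, h'⟩ => hA h'

theorem memBit_val (A : Finset (Fin n)) (v : Fin n) : memBit A v = if v ∈ A then 1 else 0 := by
  split_ifs with h
  exacts [memBit_of_mem h, memBit_of_notMem h]

theorem memBit_inter (A B : Finset (Fin n)) (v : ℕ) :
    memBit (A ∩ B) v = memBit A v * memBit B v := by
  by_cases hv : v < n
  · have h1 := memBit_val A ⟨v, hv⟩
    have h2 := memBit_val B ⟨v, hv⟩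
    have h3 := memBit_val (A ∩ B) ⟨v, hv⟩
    simp only at h1 h2 h3
    rw [h1, h2, h3]
    by_cases hA : (⟨v, hv⟩ : Fin n) ∈ A <;> by_cases hB : (⟨v, hv⟩ : Fin n) ∈ B <;> simp [hA, hB]
  · simp [memBit, hv]

/-- The number of states of the vertex `v`, as needed to enumerate the assignments on `A`. -/
noncomputable def radix (A : Finset (Fin n)) (v : ℕ) : ℕ := 1 + 2 * memBit A v

/-- The assignment on `A` with number `q`. -/
noncomputable def digits (A : Finset (Fin n)) (q v : ℕ) : ℕ :=
  q / (∏ u ∈ Finset.range v, radix A u) % radix A v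

theorem radix_val (A : Finset (Fin n)) (v : Fin n) : radix A v = if v ∈ A then 3 else 1 := by
  rw [radix, memBit_val]
  split_ifs <;> rfl

theorem digits_mem (A : Finset (Fin n)) (q : ℕ) :
    (fun v : Fin n => digits A q v) ∈ assignments A := by
  simp only [assignments, Fintype.mem_piFinset, Finset.mem_range]
  intro v
  rw [digits, radix_val]
  exact Nat.mod_lt _ (by split_ifs <;> omega)

theorem prod_radix (A : Finset (Fin n)) : ∏ v ∈ Finset.range n, radix A v = 3 ^ A.card := by
  rw [Finset.prod_range]
  simp only [radix_val]
  rw [Finset.prod_ite, Finset.prod_const, Finset.prod_const_one, mul_one, Finset.filter_mem_eq_inter,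
    Finset.univ_inter]

/-- Radix 3 on A and radix 1 elsewhere number the assignments on A without gaps, so a loop over them
has exactly 3 ^ |A| rounds rather than 3 ^ n. -/
theorem sum_range_digits {M : Type*} [AddCommMonoid M] (A : Finset (Fin n))
    (F : (Fin n → ℕ) → M) :
    ∑ q ∈ Finset.range (∏ v ∈ Finset.range n, radix A v), F (fun v => digits A q v) =
      ∑ f ∈ assignments A, F f := by
  rw [Finset.prod_range, Finset.sum_range,
    ← Equiv.sum_comp (finPiFinEquiv (n := fun v : Fin n => radix A v))]
  have hd : ∀ (g : ∀ v : Fin n, Fin (radix A v)) (v : Fin n),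
      digits A (finPiFinEquiv (n := fun v : Fin n => radix A v) g) v = g v := by
    intro g v
    have h1 := congrFun (Equiv.symm_apply_apply (finPiFinEquiv (n := fun v : Fin n => radix A v)) g) v
    conv_rhs => rw [← h1]
    rw [digits, Finset.prod_range]
    rfl
  refine Finset.sum_bij (fun g _ v => (g v : ℕ)) ?_ ?_ ?_ ?_
  · intro g _
    simp only [assignments, Fintype.mem_piFinset, Finset.mem_range]
    intro v
    rw [← radix_val]
    exact (g v).2
  · intro g _ g' _ h
    ext v
    exact congrFun h v
  · intro f hf
    simp only [assignments, Fintype.mem_piFinset, Finset.mem_range, ← radix_val] at hf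
    exact ⟨fun v => ⟨f v, hf v⟩, Finset.mem_univ _, rfl⟩
  · intro g _
    congr 1
    ext v
    exact hd g v

/-- The number of an assignment in base `3`. -/
def code (f : Fin n → ℕ) : ℕ := ∑ v, f v * 3 ^ (v : ℕ)

theorem code_zero : code (0 : Fin n → ℕ) = 0 := by simp [code]

/-- Memory addresses, unlike loop counts, may be sparse: plain base 3 over all vertices suffices,
since only the length of an address is charged. -/
theorem code_inj {f g : Fin n → ℕ} (hf : ∀ v, f v < 3) (hg : ∀ v, g v < 3) (h : code f = code g) :
    f = g := by
  have : (fun v => ⟨f v, hf v⟩ : Fin n → Fin 3) = fun v => ⟨g v, hg v⟩ := by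
    apply finFunctionFinEquiv.injective
    rw [Fin.ext_iff, finFunctionFinEquiv_apply, finFunctionFinEquiv_apply]
    exact h
  ext v
  exact congrArg Fin.val (congrFun this v)

/-- The array index of the message of the node `c` for the assignment `h`. -/
def key (m c : ℕ) (h : Fin n → ℕ) : ℕ := code h * m + c

theorem key_mod {m c : ℕ} (hc : c < m) (h : Fin n → ℕ) : key m c h % m = c := by
  rw [key, Nat.mul_add_mod_self_right, Nat.mod_eq_of_lt hc]

theorem key_inj {m c : ℕ} (hc : c < m) {f g : Fin n → ℕ} (hf : ∀ v, f v < 3)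
    (hg : ∀ v, g v < 3) (h : key m c f = key m c g) : f = g := by
  refine code_inj hf hg (Nat.eq_of_mul_eq_mul_right (show 0 < m by omega) ?_)
  unfold key at h
  omega

end Codes

/-! ### Invariants of the message array -/

section Messages

variable {n m : ℕ} {I : Finset (Fin n × Fin n)}

/-- Children have larger indices than their parent, so writing messages of node i does not disturb
the contributions still to be computed for i or for later nodes. -/
theorem OrderedDecomposition.val_congr {R : Type*} [CommSemiring R] (D : OrderedDecomposition m I)
    (ψ : Fin n × Fin n → ℕ → ℕ → R) {a b : ℕ → (Fin n → ℕ) → R} {i : ℕ}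
    (hi : i < m) (h : ∀ c, i < c → c < m → a c = b c) (f : Fin n → ℕ) : D.val ψ a i f = D.val ψ b i f := by
  rw [val, val]
  congr 1
  refine Finset.prod_congr rfl fun c hc => ?_
  have hc := Finset.mem_range.1 hc
  split_ifs with hp
  · rw [h c ?_ hc]
    rcases Nat.eq_zero_or_pos c with rfl | h0
    · have := D.par_zero
      omega
    · have := D.par_lt c h0 hc
      omega
  · rfl

theorem OrderedDecomposition.cast_val (D : OrderedDecomposition m I) (M : ℕ)
    (ψ : Fin n × Fin n → ℕ → ℕ → ℕ) (a : ℕ → (Fin n → ℕ) → ℕ) (i : ℕ) (f : Fin n → ℕ) :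
    ((D.val ψ a i f : ℕ) : ZMod M) =
      D.val (fun e x y => (ψ e x y : ZMod M)) (fun c h => (a c h : ZMod M)) i f := by
  simp only [val, localWeight, Nat.cast_mul, Nat.cast_prod, Nat.cast_ite, Nat.cast_one]

/-- The array `msg` holds the messages of the nodes from `i` on, modulo `M`, and nothing else. -/
structure OrderedDecomposition.Computed (D : OrderedDecomposition m I)
    (ψ : Fin n × Fin n → ℕ → ℕ → ℕ) (M i : ℕ) (msg : ℕ → ℕ) : Prop where
  lt : ∀ k, msg k < M
  zero : ∀ k, k % m < i → msg k = 0
  eq : ∀ c, i ≤ c → c < m → ∀ h ∈ assignments (D.sep c), (msg (key m c h) : ZMod M) =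
    ∑ f ∈ assignments (D.bag c) with restrict (D.sep c) f = h,
      ((D.val ψ (fun c h => msg (key m c h)) c f : ℕ) : ZMod M)

/-- The array `msg` results from the array `msg₀` by the first `q` steps of the computation of the
messages of the node `i`. -/
structure OrderedDecomposition.Partial (D : OrderedDecomposition m I)
    (ψ : Fin n × Fin n → ℕ → ℕ → ℕ) (M i : ℕ) (msg₀ : ℕ → ℕ) (q : ℕ) (msg : ℕ → ℕ) : Prop where
  lt : ∀ k, msg k < M
  same : ∀ k, k % m ≠ i → msg k = msg₀ k
  eq : ∀ h ∈ assignments (D.sep i), (msg (key m i h) : ZMod M) =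
    ∑ q' ∈ Finset.range q, if restrict (D.sep i) (fun v => digits (D.bag i) q' v) = h then
      ((D.val ψ (fun c h => msg₀ (key m c h)) i (fun v => digits (D.bag i) q' v) : ℕ) : ZMod M) else 0

theorem OrderedDecomposition.Computed.partial_zero {D : OrderedDecomposition m I}
    {ψ : Fin n × Fin n → ℕ → ℕ → ℕ} {M i : ℕ} (hi : i < m) {msg : ℕ → ℕ}
    (h : D.Computed ψ M (i + 1) msg) : D.Partial ψ M i msg 0 msg :=
  ⟨h.lt, fun _ _ => rfl, fun f _ => by
    rw [h.zero _ (by rw [key_mod hi]; omega)]; simp⟩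

/-- One assignment on the bag affects one accumulator, that of its restriction to the separator;
`key_inj` keeps the other ones apart. -/
theorem OrderedDecomposition.Partial.step {D : OrderedDecomposition m I}
    {ψ : Fin n × Fin n → ℕ → ℕ → ℕ} {M i : ℕ} (hi : i < m) {msg₀ msg : ℕ → ℕ} {q : ℕ}
    (h : D.Partial ψ M i msg₀ q msg) (k v : ℕ)
    (hk : k = key m i (restrict (D.sep i) fun v => digits (D.bag i) q v))
    (hv : v = (msg k + D.val ψ (fun c h => msg (key m c h)) i fun v => digits (D.bag i) q v) % M) :
    D.Partial ψ M i msg₀ (q + 1) (Function.update msg k v) := by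
  have hM : 0 < M := (Nat.zero_le _).trans_lt (h.lt 0)
  have hkm : k % m = i := hk ▸ key_mod hi _
  have hmem := restrict_mem (A := D.sep i) (digits_mem (D.bag i) q)
  have hval : D.val ψ (fun c h => msg (key m c h)) i (fun v => digits (D.bag i) q v) =
      D.val ψ (fun c h => msg₀ (key m c h)) i (fun v => digits (D.bag i) q v) :=
    D.val_congr ψ hi (fun c hc hcm => funext fun f => h.same _ (by rw [key_mod hcm]; omega)) _
  refine ⟨fun j => ?_, fun j hj => ?_, fun f hf => ?_⟩
  · rw [Function.update_apply]; split_ifs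
    · exact hv ▸ Nat.mod_lt _ hM
    · exact h.lt j
  · rw [Function.update_of_ne (by rintro rfl; exact hj hkm), h.same j hj]
  · rw [Finset.sum_range_succ, ← h.eq f hf]
    by_cases hfk : restrict (D.sep i) (fun v => digits (D.bag i) q v) = f
    · rw [if_pos hfk, ← hfk, ← hk, Function.update_self, hv, hval]
      simp
    · rw [if_neg hfk, add_zero, Function.update_of_ne]
      rintro heq
      rw [hk] at heq
      exact hfk (key_inj hi (mem_assignments.1 hf).1 (mem_assignments.1 hmem).1 heq).symm

theorem OrderedDecomposition.Computed.step {D : OrderedDecomposition m I}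
    {ψ : Fin n × Fin n → ℕ → ℕ → ℕ} {M i : ℕ} {msg₀ msg : ℕ → ℕ}
    (h : D.Computed ψ M (i + 1) msg₀)
    (h' : D.Partial ψ M i msg₀ (∏ v ∈ Finset.range n, radix (D.bag i) v) msg) :
    D.Computed ψ M i msg := by
  have hval : ∀ c, i ≤ c → c < m → ∀ f, D.val ψ (fun c h => msg (key m c h)) c f =
      D.val ψ (fun c h => msg₀ (key m c h)) c f := fun c hc hcm f =>
    D.val_congr ψ hcm (fun c' hc' hcm' => funext fun f => h'.same _ (by rw [key_mod hcm']; omega)) _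
  refine ⟨h'.lt, fun k hk => ?_, fun c hc hcm f hf => ?_⟩
  · rw [h'.same k (by omega), h.zero k (by omega)]
  · simp only [hval c hc hcm]
    rcases Nat.eq_or_lt_of_le hc with rfl | hlt
    · rw [h'.eq f hf, Finset.sum_filter]
      exact sum_range_digits (D.bag i) fun g => if restrict (D.sep i) g = f then
        ((D.val ψ (fun c h => msg₀ (key m c h)) i g : ℕ) : ZMod M) else 0
    · rw [h'.same _ (by rw [key_mod hcm]; omega), h.eq c (by omega) hcm f hf]

/-- The recursion holds in `ZMod M`, which determines the root message modulo M; both numbers are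
below M, so they are equal. -/
theorem OrderedDecomposition.Computed.message {D : OrderedDecomposition m I}
    {ψ : Fin n × Fin n → ℕ → ℕ → ℕ} {M : ℕ} {msg : ℕ → ℕ} (h : D.Computed ψ M 0 msg)
    (hlt : ∑ f ∈ assignments Finset.univ, localWeight I ψ Finset.univ ∅ f < M) :
    msg 0 = ∑ f ∈ assignments Finset.univ, localWeight I ψ Finset.univ ∅ f := by
  have h1 := D.sum_eq_message (fun e x y => (ψ e x y : ZMod M))
    (fun c h => (msg (key m c h) : ZMod M)) fun i hi f hf => by
      rw [h.eq i (Nat.zero_le _) hi f hf]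
      exact Finset.sum_congr rfl fun g _ => D.cast_val M ψ _ i g
  have h2 : key m 0 (0 : Fin n → ℕ) = 0 := by simp [key, code_zero]
  rw [h2] at h1
  have h3 : ((msg 0 : ℕ) : ZMod M) =
      ((∑ f ∈ assignments Finset.univ, localWeight I ψ Finset.univ ∅ f : ℕ) : ZMod M) := by
    rw [h1]
    simp only [localWeight, Nat.cast_sum, Nat.cast_prod]
  rw [ZMod.natCast_eq_natCast_iff', Nat.mod_eq_of_lt (h.lt 0), Nat.mod_eq_of_lt hlt] at h3
  exact h3

end Messages

/-! ### The program and the values of its expressions -/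

namespace RAM

instance : Add Expr := ⟨.op .add⟩
instance : Sub Expr := ⟨.op .sub⟩
instance : Mul Expr := ⟨.op .mul⟩
instance : Div Expr := ⟨.op .div⟩
instance : Mod Expr := ⟨.op .mod⟩
instance (c : ℕ) : OfNat Expr c := ⟨.lit c⟩

/-- The sum over the values of the variable `r` below `e`. -/
def Expr.sum (r : ℕ) (e b : Expr) : Expr := .big false r e b

/-- The product over the values of the variable `r` below `e`. -/
def Expr.prod (r : ℕ) (e b : Expr) : Expr := .big true r e b

/-! The variables of the program: the numbers of vertices and of nodes, the size of the feedback
vertex sets, the argument of the generating function, the modulus, a loop counter, the number of an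
assignment, and a node. The variables from `10` on are bound in expressions. -/

def vertices : Expr := .var 1
def nodes : Expr := .var 2
def target : Expr := .var 3
def point : Expr := .var 4
def modulus : Expr := .var 5
def counter : Expr := .var 6
def assignmentNo : Expr := .var 8
def node : Expr := .var 9

/-! The arrays of the program: the order of the nodes, the parents, the positions in the order
(increased by `1`), and the messages. -/

def order (e : Expr) : Expr := .arr 0 e
def parent (e : Expr) : Expr := .arr 1 e
def position (e : Expr) : Expr := .arr 2 e
def message (e : Expr) : Expr := .arr 3 e

/-- The entry of the adjacency matrix of the graph. -/
def adjacent (u v : Expr) : Expr := .inp (3 + u * vertices + v)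

/-- Whether the vertex `v` belongs to the bag of the node `i`. -/
def inBag (i v : Expr) : Expr :=
  .inp (3 + vertices * vertices + nodes * nodes + order i * vertices + v)

/-- Whether the vertex `v` belongs to the bags of the node `c` and of its parent. -/
def inSep (c v : Expr) : Expr := .ite 0 c (inBag c v * inBag (parent c) v) 0

/-- The number of states of the vertex `v`. -/
def stateCount (v : Expr) : Expr := 1 + 2 * inBag node v

/-- The state of the vertex `v` in the current assignment. -/
def stateOf (v : Expr) : Expr :=
  assignmentNo / .prod 10 v (stateCount (.var 10)) % stateCount v

/-- The code of the restriction of the current assignment to the separator of the node `c`. -/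
def codeOf (c : Expr) : Expr :=
  .sum 11 vertices (inSep c (.var 11) * (stateOf (.var 11) * .prod 17 (.var 11) 3))

/-- The index of the message of the node `c` for the current assignment. -/
def keyOf (c : Expr) : Expr := codeOf c * nodes + c

/-- The product of the messages of the children for the current assignment. -/
def childProduct : Expr :=
  .prod 12 nodes (.ite (parent (.var 12)) node 1 (.ite node (parent (.var 12)) 1
    (message (keyOf (.var 12)))))

/-- The weight of two adjacent vertices with states `a` and `b`. -/
def weightOf (a b : Expr) : Expr :=
  .ite 0 a (.ite 0 b (.ite a b 0 (.ite b a 0 2)) 1) 1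

/-- The factor of the pair of `u` and `v`. -/
def factorOf (u v : Expr) : Expr :=
  .ite v u (.ite 0 (adjacent u v) (weightOf (stateOf u) (stateOf v)) 1)
    (.ite 0 (stateOf u) 1 point)

/-- The product of the factors of the pairs that do not belong to the parent. -/
def pairProduct : Expr :=
  .prod 13 vertices (.prod 14 (.var 13 + 1)
    (.ite 0 (inBag node (.var 13) * inBag node (.var 14))
      (.ite 0 (inSep node (.var 13) * inSep node (.var 14)) 1 (factorOf (.var 13) (.var 14))) 1))

/-- The least `q < nodes * nodes` such that the node `q / nodes` has no position, the node
`q % nodes` has one, and they are adjacent. -/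
def nextEdge : Expr :=
  .sum 15 (nodes * nodes) (.prod 16 (.var 15 + 1)
    (.ite 0 (position (.var 16 / nodes)) 1 (.ite 0 (position (.var 16 % nodes))
      (1 - .inp (3 + vertices * vertices + .var 16)) 1)))

/-- Read the parameters. -/
def readParameters : Stmt :=
  .seq (.assign 1 (.inp 0)) <| .seq (.assign 2 (.inp 1)) <| .seq (.assign 3 (.inp 2)) <|
  .seq (.assign 4 (.prod 10 ((vertices + 2) * (vertices + 2)) 2)) <|
  .seq (.assign 5 (.prod 10 (vertices + 1) point)) <|
  .seq (.store 2 0 1) (.store 1 0 nodes)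

/-- Order the nodes. -/
def orderNodes : Stmt :=
  .loop 6 (nodes - 1) <| .seq (.assign 7 nextEdge) <|
  .seq (.store 0 (counter + 1) (.var 7 / nodes)) <|
  .seq (.store 1 (counter + 1) (position (.var 7 % nodes) - 1))
    (.store 2 (.var 7 / nodes) (counter + 2))

/-- Compute the messages of the current node. -/
def processNode : Stmt :=
  .loop 8 (.prod 10 vertices (stateCount (.var 10))) <|
    .store 3 (keyOf node) ((message (keyOf node) + childProduct * pairProduct) % modulus)

/-- Compute all messages. -/
def computeMessages : Stmt :=
  .loop 6 nodes <| .seq (.assign 9 (nodes - 1 - counter)) processNode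

/-- Extract the result. -/
def extractResult : Stmt :=
  .assign 0 (.ite vertices target 0
    (message 0 / .prod 10 target point % point / .prod 10 (vertices - target) 2 % 2))

/-- The program, after the computation of the first free address. -/
def mainStmt : Stmt := .seq readParameters <| .seq orderNodes <| .seq computeMessages extractResult

/-- The input in `Γ` represents the tree decomposition `D` and the number `t`. -/
structure InputSpec (Γ : Ctx) {n m : ℕ} {G : SimpleGraph (Fin n)}
    (D : TreeDecomposition G (Fin m)) (t : ℕ) : Prop where
  base_eq : Γ.base = 3 + n * n + m * m + m * n
  inp_zero : Γ.inp 0 = n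
  inp_one : Γ.inp 1 = m
  inp_two : Γ.inp 2 = t
  adj : ∀ (u v : Fin n), Γ.inp (3 + u * n + v) ≤ 1 ∧
    (0 < Γ.inp (3 + u * n + v) ↔ G.Adj u v)
  tree : ∀ (x y : Fin m), Γ.inp (3 + n * n + (x * m + y)) ≤ 1 ∧
    (0 < Γ.inp (3 + n * n + (x * m + y)) ↔ D.tree.Adj x y)
  bag : ∀ (x : Fin m) (v : Fin n), Γ.inp (3 + n * n + m * m + x * n + v) = memBit (D.bag x) v
  sq_le : (n + 2) * (n + 2) ≤ Γ.bits
  nodes_le : m * m ≤ Γ.bits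
  modulus_le : (n + 2) * (n + 2) * (n + 1) + 1 ≤ Γ.bits
  target_le : Nat.size t ≤ Γ.bits

/-- The environment during the computation of the messages: `order` and `parent` describe `O`. -/
structure DPEnv {n m : ℕ} {G : SimpleGraph (Fin n)} (D : TreeDecomposition G (Fin m))
    (O : OrderedDecomposition m (factorPairs G)) (X : ℕ) (τ : Env) : Prop where
  vertices : τ.var 1 = n
  nodes : τ.var 2 = m
  point : τ.var 4 = X
  order : ∀ i < m, ∃ h : τ.arr 0 i < m, D.bag ⟨τ.arr 0 i, h⟩ = O.bag i
  parent : ∀ i < m, τ.arr 1 i = O.par i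

variable {Γ : Ctx} {n m t : ℕ} {G : SimpleGraph (Fin n)} {D : TreeDecomposition G (Fin m)}
  {O : OrderedDecomposition m (factorPairs G)} {X : ℕ} {τ : Env}

theorem DPEnv.setVar (h : DPEnv D O X τ) {r : ℕ} (hr : 6 ≤ r) (x : ℕ) : DPEnv D O X (τ.setVar r x) where
  vertices := by rw [Env.var_setVar, if_neg (by omega), h.vertices]
  nodes := by rw [Env.var_setVar, if_neg (by omega), h.nodes]
  point := by rw [Env.var_setVar, if_neg (by omega), h.point]
  order := h.order
  parent := h.parent

theorem InputSpec.le_bits (hI : InputSpec Γ D t) : n + 4 ≤ Γ.bits ∧ m ≤ Γ.bits := by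
  have h1 := hI.sq_le
  have h2 := hI.nodes_le
  exact ⟨by nlinarith, by nlinarith⟩

theorem mul_add_lt {x y a b : ℕ} (hx : x < a) (hy : y < b) : x * b + y < a * b := by
  nlinarith [Nat.mul_le_mul_right b (show x + 1 ≤ a from hx)]

theorem ev_inBag (hI : InputSpec Γ D t) (h : DPEnv D O X τ) {a b : Expr} {i v : ℕ}
    (ha : Ev Γ τ a i) (hb : Ev Γ τ b v) (hi : i < m) (hv : v < n) :
    Ev Γ τ (inBag a b) (memBit (O.bag i) v) := by
  obtain ⟨ho, hbag⟩ := h.order i hi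
  have e := ((((Ev.lit 3).add ((Ev.var h.vertices).mul (Ev.var h.vertices))).add
    ((Ev.var h.nodes).mul (Ev.var h.nodes))).add
    ((Ev.arr (j := 0) ha).mul (Ev.var h.vertices))).add hb
  have h1 := mul_add_lt ho hv
  refine (Ev.inp e (by rw [hI.base_eq]; omega)).congr ?_
  rw [← hbag]
  exact hI.bag ⟨_, ho⟩ ⟨v, hv⟩

theorem memBit_sep (O : OrderedDecomposition m (factorPairs G)) {c : ℕ} (hc : c < m) (v : ℕ) :
    memBit (O.sep c) v = if 0 < c then memBit (O.bag c) v * memBit (O.bag (O.par c)) v else 0 := by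
  split_ifs with h
  · rw [O.sep_eq c h hc, memBit_inter]
  · rw [show c = 0 by omega, O.sep_zero]
    simp [memBit]

theorem ev_inSep (hI : InputSpec Γ D t) (h : DPEnv D O X τ) {a b : Expr} {c v : ℕ}
    (ha : Ev Γ τ a c) (hb : Ev Γ τ b v) (hc : c < m) (hv : v < n) :
    Ev Γ τ (inSep a b) (memBit (O.sep c) v) := by
  rw [memBit_sep O hc]
  refine Ev.ite (Ev.lit 0) ha (fun h0 => ?_) fun _ => Ev.lit 0
  have hp := O.par_lt c h0 hc
  exact (ev_inBag hI h ha hb hc hv).mul (ev_inBag hI h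
    ((Ev.arr (j := 1) ha).congr (h.parent c hc)) hb (by omega) hv)

theorem ev_stateCount (hI : InputSpec Γ D t) (h : DPEnv D O X τ) {b : Expr} {i v : ℕ}
    (hi : τ.var 9 = i) (hb : Ev Γ τ b v) (him : i < m) (hv : v < n) :
    Ev Γ τ (stateCount b) (radix (O.bag i) v) :=
  (Ev.lit 1).add ((Ev.lit 2).mul (ev_inBag hI h (Ev.var hi) hb him hv))

theorem ev_stateOf (hI : InputSpec Γ D t) (h : DPEnv D O X τ) {b : Expr} {i q v : ℕ}
    (hi : τ.var 9 = i) (hq : τ.var 8 = q) (hb : Ev Γ τ b v) (him : i < m) (hv : v < n) :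
    Ev Γ τ (stateOf b) (digits (O.bag i) q v) := by
  refine ((Ev.var hq).div (Ev.prod hb ?_ fun u hu => ?_)).mod (ev_stateCount hI h hi hb him hv)
  · have := hI.le_bits; omega
  · exact ev_stateCount hI (h.setVar (by omega) u) (by rw [Env.var_setVar, if_neg (by omega), hi])
      (Ev.var (by rw [Env.var_setVar, if_pos rfl])) him (by omega)

/-- The current assignment. -/
noncomputable def current (O : OrderedDecomposition m (factorPairs G)) (i q : ℕ) : Fin n → ℕ :=
  fun v => digits (O.bag i) q v

/-- The sum in `codeOf` binds the variable 11, so the variable that holds the node must be another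
one. -/
theorem ev_keyOf (hI : InputSpec Γ D t) (h : DPEnv D O X τ) {r i q c : ℕ}
    (hi : τ.var 9 = i) (hq : τ.var 8 = q) (hr : r ≠ 11) (hc : τ.var r = c) (him : i < m)
    (hcm : c < m) :
    Ev Γ τ (keyOf (.var r)) (key m c (restrict (O.sep c) (current O i q))) := by
  have hb := hI.le_bits
  refine Ev.add (Ev.mul (Ev.congr (Ev.sum (f := fun v => memBit (O.sep c) v *
    (digits (O.bag i) q v * ∏ _ ∈ Finset.range v, 3)) (Ev.var h.vertices) (by omega)
    fun v hv => ?_) ?_) (Ev.var h.nodes)) (Ev.var hc)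
  · have h' := h.setVar (r := 11) (by omega) v
    have ev : Ev Γ (τ.setVar 11 v) (.var 11) v := Ev.var (by rw [Env.var_setVar, if_pos rfl])
    refine (ev_inSep hI h' (Ev.var ?_) ev hcm hv).mul ((ev_stateOf hI h' ?_ ?_ ev him hv).mul
      (Ev.prod ev (by omega) fun _ _ => Ev.lit 3))
    · rw [Env.var_setVar, if_neg hr, hc]
    · rw [Env.var_setVar, if_neg (by omega), hi]
    · rw [Env.var_setVar, if_neg (by omega), hq]
  · rw [Finset.sum_range, code]
    refine Finset.sum_congr rfl fun v _ => ?_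
    rw [memBit_val, Finset.prod_const, Finset.card_range, restrict, current]
    split_ifs <;> simp

theorem ev_childProduct (hI : InputSpec Γ D t) (h : DPEnv D O X τ) {i q : ℕ}
    (hi : τ.var 9 = i) (hq : τ.var 8 = q) (him : i < m) :
    Ev Γ τ childProduct (∏ c ∈ Finset.range m,
      if O.par c = i then τ.arr 3 (key m c (restrict (O.sep c) (current O i q))) else 1) := by
  have hb := hI.le_bits
  refine Ev.prod (Ev.var h.nodes) (by omega) fun c hc => ?_
  have h' := h.setVar (r := 12) (by omega) c
  have ev : Ev Γ (τ.setVar 12 c) (.var 12) c := Ev.var (by rw [Env.var_setVar, if_pos rfl])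
  have ep : Ev Γ (τ.setVar 12 c) (parent (.var 12)) (O.par c) :=
    (Ev.arr (j := 1) ev).congr (h.parent c hc)
  have hi' : (τ.setVar 12 c).var 9 = i := by rw [Env.var_setVar, if_neg (by omega), hi]
  have hq' : (τ.setVar 12 c).var 8 = q := by rw [Env.var_setVar, if_neg (by omega), hq]
  refine (Ev.ite ep (Ev.var hi') (fun _ => Ev.lit 1) fun _ => Ev.ite (Ev.var hi') ep
    (fun _ => Ev.lit 1) fun _ => Ev.arr (ev_keyOf hI h' hi' hq' (by omega)
      (by rw [Env.var_setVar, if_pos rfl]) him hc)).congr ?_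
  split_ifs <;> first | rfl | omega

/-- The only test available is `<`, so equality is expressed as the failure of two strict
comparisons. -/
theorem ev_weightOf {a b : Expr} {x y : ℕ} (ha : Ev Γ τ a x) (hb : Ev Γ τ b y) :
    Ev Γ τ (weightOf a b) (edgeWeight x y) := by
  refine (Ev.ite (Ev.lit 0) ha (fun _ => Ev.ite (Ev.lit 0) hb (fun _ => Ev.ite ha hb
    (fun _ => Ev.lit 0) fun _ => Ev.ite hb ha (fun _ => Ev.lit 0) fun _ => Ev.lit 2)
    fun _ => Ev.lit 1) fun _ => Ev.lit 1).congr ?_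
  rw [edgeWeight]
  split_ifs <;> first | rfl | omega

open Classical in
theorem ev_factorOf (hI : InputSpec Γ D t) (h : DPEnv D O X τ) {a b : Expr} {i q : ℕ} {u v : Fin n}
    (hi : τ.var 9 = i) (hq : τ.var 8 = q) (ha : Ev Γ τ a u) (hb : Ev Γ τ b v) (him : i < m)
    (hvu : v ≤ u) :
    Ev Γ τ (factorOf a b) (if (u, v) ∈ factorPairs G then
      pairFactor X (u, v) (current O i q u) (current O i q v) else 1) := by
  have e1 := ev_stateOf hI h hi hq ha him u.2
  have e2 := ev_stateOf hI h hi hq hb him v.2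
  have hlt := mul_add_lt u.2 v.2
  refine (Ev.ite hb ha (fun _ => Ev.ite (Ev.lit 0) (Ev.inp (((Ev.lit 3).add
    (ha.mul (Ev.var h.vertices))).add hb) (by rw [hI.base_eq]; omega)) (fun _ => ev_weightOf e1 e2)
    fun _ => Ev.lit 1) fun _ => Ev.ite (Ev.lit 0) e1 (fun _ => Ev.lit 1)
    fun _ => Ev.var h.point).congr ?_
  simp only [(hI.adj u v).2, factorPairs, Finset.mem_filter, Finset.mem_univ, true_and, hvu,
    pairFactor, Fin.val_fin_lt]
  rcases eq_or_lt_of_le hvu with rfl | hlt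
  · simp only [lt_irrefl, if_false, true_or, if_true, current]
    rcases Nat.eq_zero_or_pos (digits (O.bag i) q v) with h0 | h0
    · simp [h0]
    · simp [h0, h0.ne']
  · simp only [hlt, hlt.ne', if_true, if_false, false_or]
    rfl

/-- Every pair of I has its larger vertex first, so a triangular double product meets each of them
once. -/
theorem localWeight_eq_prod_range (I : Finset (Fin n × Fin n)) (hI : ∀ e ∈ I, e.2 ≤ e.1)
    (ψ : Fin n × Fin n → ℕ → ℕ → ℕ) (A P : Finset (Fin n)) (f : Fin n → ℕ) (F : ℕ → ℕ → ℕ)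
    (hF : ∀ u v : Fin n, v ≤ u → F u v =
      if ((u, v) ∈ I ∧ (u ∈ A ∧ v ∈ A) ∧ ¬ (u ∈ P ∧ v ∈ P)) then ψ (u, v) (f u) (f v) else 1) :
    ∏ u ∈ Finset.range n, ∏ v ∈ Finset.range (u + 1), F u v = localWeight I ψ A P f := by
  have h1 : localWeight I ψ A P f = ∏ e : Fin n × Fin n,
      if e ∈ I ∧ (e.1 ∈ A ∧ e.2 ∈ A) ∧ ¬ (e.1 ∈ P ∧ e.2 ∈ P) then ψ e (f e.1) (f e.2) else 1 := by
    rw [localWeight, ← Finset.prod_filter]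
    refine Finset.prod_congr ?_ fun _ _ => rfl
    ext e
    simp
  rw [h1, ← Finset.univ_product_univ, Finset.prod_product, Finset.prod_range]
  refine Finset.prod_congr rfl fun u _ => ?_
  have h2 : ∏ v ∈ Finset.range (u + 1), F u v =
      ∏ v ∈ Finset.range n, if v ≤ u then F u v else 1 := by
    rw [← Finset.prod_filter]
    refine Finset.prod_congr ?_ fun _ _ => rfl
    ext v
    simp only [Finset.mem_range, Finset.mem_filter]
    have := u.2
    omega
  rw [h2, Finset.prod_range]
  refine Finset.prod_congr rfl fun v _ => ?_
  by_cases hvu : v ≤ u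
  · rw [if_pos (Fin.le_def.1 hvu), hF u v hvu]
  · rw [if_neg (fun h => hvu (Fin.le_def.2 h)), if_neg (fun h => hvu (hI _ h.1))]

open Classical in
theorem ev_pairProduct (hI : InputSpec Γ D t) (h : DPEnv D O X τ) {i q : ℕ}
    (hi : τ.var 9 = i) (hq : τ.var 8 = q) (him : i < m) :
    Ev Γ τ pairProduct
      (localWeight (factorPairs G) (pairFactor X) (O.bag i) (O.sep i) (current O i q)) := by
  have hb := hI.le_bits
  -- A total function on numbers is needed here; the reductions modulo n do nothing to actual
  -- vertices and merely supply the bounds required by `Fin n`.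
  let F : ℕ → ℕ → ℕ := fun u v => if 0 < memBit (O.bag i) u * memBit (O.bag i) v then
    if 0 < memBit (O.sep i) u * memBit (O.sep i) v then 1 else
      if ∃ (hu : u < n) (hv : v < n), ((⟨u, hu⟩ : Fin n), (⟨v, hv⟩ : Fin n)) ∈ factorPairs G then
        if hn : 0 < n then
          pairFactor X ((⟨u % n, Nat.mod_lt _ hn⟩ : Fin n), (⟨v % n, Nat.mod_lt _ hn⟩ : Fin n))
            (digits (O.bag i) q u) (digits (O.bag i) q v) else 1
      else 1 else 1
  refine (Ev.prod (f := fun u => ∏ v ∈ Finset.range (u + 1), F u v) (Ev.var h.vertices)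
    (by omega) fun u hu => ?_).congr ?_
  · refine Ev.prod ((Ev.var (by rw [Env.var_setVar, if_pos rfl])).add (Ev.lit 1)) (by omega)
      fun v hv => ?_
    have h' := (h.setVar (r := 13) (by omega) u).setVar (r := 14) (by omega) v
    have eu : Ev Γ ((τ.setVar 13 u).setVar 14 v) (.var 13) u :=
      Ev.var (by rw [Env.var_setVar, if_neg (by omega), Env.var_setVar, if_pos rfl])
    have ev : Ev Γ ((τ.setVar 13 u).setVar 14 v) (.var 14) v :=
      Ev.var (by rw [Env.var_setVar, if_pos rfl])
    have hi' : ((τ.setVar 13 u).setVar 14 v).var 9 = i := by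
      rw [Env.var_setVar, if_neg (by omega), Env.var_setVar, if_neg (by omega), hi]
    have hq' : ((τ.setVar 13 u).setVar 14 v).var 8 = q := by
      rw [Env.var_setVar, if_neg (by omega), Env.var_setVar, if_neg (by omega), hq]
    have hv' : v < n := by omega
    refine Ev.ite (Ev.lit 0) ((ev_inBag hI h' (Ev.var hi') eu him hu).mul
      (ev_inBag hI h' (Ev.var hi') ev him hv')) (fun _ => Ev.ite (Ev.lit 0)
      ((ev_inSep hI h' (Ev.var hi') eu him hu).mul (ev_inSep hI h' (Ev.var hi') ev him hv'))
      (fun _ => Ev.lit 1) fun _ => ?_) fun _ => Ev.lit 1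
    refine (ev_factorOf hI h' (u := ⟨u, hu⟩) (v := ⟨v, hv'⟩) hi' hq' eu ev him
      (Fin.le_def.2 (by simp only; omega))).congr ?_
    simp only [hu, hv', exists_true_left, show 0 < n by omega, dif_pos, Nat.mod_eq_of_lt, current]
  · refine localWeight_eq_prod_range _ (fun e he => ?_) _ _ _ _ _ fun u v _ => ?_
    · rw [factorPairs, Finset.mem_filter] at he
      exact he.2.1
    · simp only [F, memBit_val, u.2, v.2, exists_true_left, show 0 < n from u.pos, dif_pos,
        Nat.mod_eq_of_lt, current, Fin.eta]
      by_cases h1 : u ∈ O.bag i <;> by_cases h2 : v ∈ O.bag i <;> by_cases h3 : u ∈ O.sep i <;>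
        by_cases h4 : v ∈ O.sep i <;> simp [h1, h2, h3, h4]

theorem ev_val (hI : InputSpec Γ D t) (h : DPEnv D O X τ) {i q : ℕ}
    (hi : τ.var 9 = i) (hq : τ.var 8 = q) (him : i < m) :
    Ev Γ τ (childProduct * pairProduct)
      (O.val (pairFactor X) (fun c h => τ.arr 3 (key m c h)) i (current O i q)) :=
  (ev_childProduct hI h hi hq him).mul (ev_pairProduct hI h hi hq him)

end RAM

/-! ### Correctness of the loops -/

namespace RAM

variable {Γ : Ctx} {n m t : ℕ} {G : SimpleGraph (Fin n)} {D : TreeDecomposition G (Fin m)}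
  {O : OrderedDecomposition m (factorPairs G)} {X : ℕ} {τ : Env}

theorem Env.arr_setArr_self (σ : Env) (j : Fin 4) (i v : ℕ) :
    (σ.setArr j i v).arr j = Function.update (σ.arr j) i v := by
  simp [Env.setArr]

theorem Env.arr_setArr_of_ne (σ : Env) {j j' : Fin 4} (h : j' ≠ j) (i v : ℕ) :
    (σ.setArr j i v).arr j' = σ.arr j' := by
  simp [Env.setArr, h]

theorem DPEnv.congr {τ' : Env} (h : DPEnv D O X τ) (h1 : ∀ r < 6, τ'.var r = τ.var r)
    (h2 : ∀ j, j ≠ 3 → τ'.arr j = τ.arr j) : DPEnv D O X τ' where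
  vertices := by rw [h1 _ (by omega), h.vertices]
  nodes := by rw [h1 _ (by omega), h.nodes]
  point := by rw [h1 _ (by omega), h.point]
  order := by rw [h2 0 (by decide)]; exact h.order
  parent := by rw [h2 1 (by decide)]; exact h.parent

theorem size_le_bits {x : ℕ} (hx : x ≤ Γ.bits) : Nat.size x ≤ Γ.bits := (size_le_self x).trans hx

theorem triple_processNode (hI : InputSpec Γ D t) (h : DPEnv D O X τ) {M i : ℕ}
    (hM : τ.var 5 = M) (hMs : Nat.size M ≤ Γ.bits) (hi : τ.var 9 = i) (him : i < m)
    (hc : O.Computed (pairFactor X) M (i + 1) (τ.arr 3)) :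
    Triple Γ processNode τ (3 ^ (O.bag i).card * 2 + 1) fun τ' =>
      (∀ r, r ≠ 8 → τ'.var r = τ.var r) ∧ (∀ j, j ≠ 3 → τ'.arr j = τ.arr j) ∧
        O.Computed (pairFactor X) M i (τ'.arr 3) := by
  have hb := hI.le_bits
  have hloop : Ev Γ τ (.prod 10 vertices (stateCount (.var 10)))
      (∏ v ∈ Finset.range n, radix (O.bag i) v) :=
    Ev.prod (Ev.var h.vertices) (by omega) fun v hv =>
      ev_stateCount hI (h.setVar (by omega) v) (by rw [Env.var_setVar, if_neg (by omega), hi])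
        (Ev.var (by rw [Env.var_setVar, if_pos rfl])) him hv
  -- The number of rounds may be exponential, but its length is at most about 2 * n.
  have hsize : Nat.size (∏ v ∈ Finset.range n, radix (O.bag i) v) ≤ Γ.bits := by
    rw [prod_radix, Nat.size_le]
    calc 3 ^ (O.bag i).card ≤ 3 ^ n :=
          Nat.pow_le_pow_right (by omega) ((Finset.card_le_univ _).trans (by simp))
      _ ≤ (2 ^ 2) ^ n := Nat.pow_le_pow_left (by omega) n
      _ = 2 ^ (2 * n) := (pow_mul _ _ _).symm
      _ < 2 ^ Γ.bits := Nat.pow_lt_pow_right (by omega) (by have := hI.sq_le; nlinarith)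
  refine (Triple.loop (c := 1) (fun q τ' => (∀ r, r ≠ 8 → τ'.var r = τ.var r) ∧
    (∀ j, j ≠ 3 → τ'.arr j = τ.arr j) ∧ O.Partial (pairFactor X) M i (τ.arr 3) q (τ'.arr 3))
    hloop hsize ⟨fun _ _ => rfl, fun _ _ => rfl, hc.partial_zero him⟩ ?_).mono ?_ ?_
  · rintro q - τ' ⟨h1, h2, h3⟩
    have hd : DPEnv D O X (τ'.setVar 8 q) :=
      (h.congr (fun r hr => h1 r (by omega)) h2).setVar (by omega) q
    have hi' : (τ'.setVar 8 q).var 9 = i := by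
      rw [Env.var_setVar, if_neg (by omega), h1 _ (by omega), hi]
    have hq' : (τ'.setVar 8 q).var 8 = q := by rw [Env.var_setVar, if_pos rfl]
    have ek := ev_keyOf hI hd hi' hq' (r := 9) (by omega) hi' him him
    have hM' : (τ'.setVar 8 q).var 5 = M := by
      rw [Env.var_setVar, if_neg (by omega), h1 _ (by omega), hM]
    have hMpos : 0 < M := (Nat.zero_le _).trans_lt (h3.lt 0)
    refine Triple.store ek (((Ev.arr (j := 3) ek).add (ev_val hI hd hi' hq' him)).mod
      (Ev.var hM')) ?_ ⟨fun r hr => ?_, fun j hj => ?_, ?_⟩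
    · exact (Nat.size_le_size (Nat.mod_lt _ hMpos).le).trans hMs
    · rw [Env.var_setArr, Env.var_setVar, if_neg hr, h1 r hr]
    · rw [Env.arr_setArr_of_ne _ hj, Env.arr_setVar, h2 j hj]
    · rw [Env.arr_setArr_self, Env.arr_setVar]
      exact h3.step him _ _ rfl rfl
  · rw [prod_radix]
  · rintro τ' ⟨h1, h2, h3⟩
    exact ⟨h1, h2, hc.step h3⟩

/-- The nodes are visited from the last to the first, so all children of a node are finished before
it. -/
theorem triple_computeMessages (hI : InputSpec Γ D t) (h : DPEnv D O X τ) {M w : ℕ}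
    (hM : τ.var 5 = M) (hMs : Nat.size M ≤ Γ.bits) (hM0 : 0 < M)
    (hw : ∀ i < m, (O.bag i).card ≤ w) (h0 : ∀ k, τ.arr 3 k = 0) :
    Triple Γ computeMessages τ (m * (1 + (3 ^ w * 2 + 1) + 1) + 1) fun τ' =>
      (∀ r < 6, τ'.var r = τ.var r) ∧ O.Computed (pairFactor X) M 0 (τ'.arr 3) := by
  have hb := hI.le_bits
  refine (Triple.loop (c := 1 + (3 ^ w * 2 + 1)) (fun i τ' => (∀ r < 6, τ'.var r = τ.var r) ∧
    (∀ j, j ≠ 3 → τ'.arr j = τ.arr j) ∧ O.Computed (pairFactor X) M (m - i) (τ'.arr 3))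
    (Ev.var h.nodes) (size_le_bits hb.2) ⟨fun _ _ => rfl, fun _ _ => rfl, ?_⟩ ?_).mono le_rfl ?_
  · exact ⟨fun k => by rw [h0]; exact hM0, fun k _ => h0 k, fun c hc hcm => by omega⟩
  · rintro i hi τ' ⟨h1, h2, h3⟩
    have hd : DPEnv D O X (τ'.setVar 6 i) :=
      (h.congr h1 h2).setVar (by omega) i
    refine Triple.seq (Q := fun τ'' => τ'' = (τ'.setVar 6 i).setVar 9 (m - 1 - i))
      (Triple.assign (((Ev.var hd.nodes).sub (Ev.lit 1)).sub
        (Ev.var (by rw [Env.var_setVar, if_pos rfl]))) (size_le_bits (by omega)) rfl) ?_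
    rintro _ rfl
    have hM' : ((τ'.setVar 6 i).setVar 9 (m - 1 - i)).var 5 = M := by
      rw [Env.var_setVar, if_neg (by omega), Env.var_setVar, if_neg (by omega), h1 _ (by omega), hM]
    refine (triple_processNode hI (hd.setVar (by omega) _) (i := m - 1 - i) hM' hMs
      (by rw [Env.var_setVar, if_pos rfl]) (by omega) ?_).mono ?_ ?_
    · rw [show m - 1 - i + 1 = m - i by omega]
      exact h3
    · have := Nat.pow_le_pow_right (show 0 < 3 by omega) (hw (m - 1 - i) (by omega))
      omega
    · rintro τ'' ⟨k1, k2, k3⟩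
      refine ⟨fun r hr => ?_, fun j hj => ?_, ?_⟩
      · rw [k1 r (by omega), Env.var_setVar, if_neg (by omega), Env.var_setVar, if_neg (by omega),
          h1 r hr]
      · rw [k2 j hj]; exact h2 j hj
      · rw [show m - (i + 1) = m - 1 - i by omega]
        exact k3
  · rintro τ' ⟨k1, -, k3⟩
    exact ⟨k1, by simpa using k3⟩

/-! ### Ordering the nodes -/

/-- The product indicates that P fails up to and including a, so the sum counts the numbers before
the least witness. This lets an expression perform a search. -/
theorem sum_prod_least {N : ℕ} {P : ℕ → Prop} [DecidablePred P] (h : ∃ q < N, P q) :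
    ∃ q < N, P q ∧
      ∑ a ∈ Finset.range N, ∏ b ∈ Finset.range (a + 1), (if P b then 0 else 1) = q := by
  have h' : ∃ q, P q := h.imp fun _ h => h.2
  obtain ⟨q, hq, hP⟩ := h
  have hle : Nat.find h' < N := (Nat.find_min' h' hP).trans_lt hq
  refine ⟨Nat.find h', hle, Nat.find_spec h', ?_⟩
  have : ∀ a, ∏ b ∈ Finset.range (a + 1), (if P b then 0 else 1) =
      if a < Nat.find h' then 1 else 0 := by
    intro a
    split_ifs with ha
    · refine Finset.prod_eq_one fun b hb => if_neg (Nat.find_min h' ?_)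
      rw [Finset.mem_range] at hb
      omega
    · exact Finset.prod_eq_zero (i := Nat.find h') (Finset.mem_range.2 (by omega))
        (if_pos (Nat.find_spec h'))
  simp only [this]
  rw [← Finset.sum_filter, Finset.sum_const, smul_eq_mul, mul_one]
  have : (Finset.range N).filter (· < Nat.find h') = Finset.range (Nat.find h') := by
    ext a
    simp only [Finset.mem_filter, Finset.mem_range]
    omega
  rw [this, Finset.card_range]

/-- The first `i + 1` nodes have been ordered. -/
structure OrderInv (D : TreeDecomposition G (Fin m)) (i : ℕ) (τ : Env) : Prop where
  order : ∀ j ≤ i, τ.arr 0 j < m ∧ τ.arr 2 (τ.arr 0 j) = j + 1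
  position : ∀ x, 0 < τ.arr 2 x → ∃ j ≤ i, τ.arr 0 j = x
  parent : ∀ j, 0 < j → j ≤ i → τ.arr 1 j < j
  adj : ∀ j, 0 < j → j ≤ i → ∃ x y : Fin m, D.tree.Adj x y ∧ τ.arr 0 j = x ∧
    τ.arr 0 (τ.arr 1 j) = y
  parent_zero : τ.arr 1 0 = m

/-- Only i + 1 < m nodes have been placed, so some node is missing; as the tree is connected, an
edge leaves the set of placed nodes. -/
theorem OrderInv.exists_edge {i : ℕ} (h : OrderInv D i τ) (hi : i + 1 < m) :
    ∃ x y : Fin m, D.tree.Adj x y ∧ τ.arr 2 x = 0 ∧ 0 < τ.arr 2 y := by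
  obtain ⟨h0, h0'⟩ := h.order 0 (Nat.zero_le _)
  have hne : ∃ x : Fin m, τ.arr 2 x = 0 := by
    by_contra hc
    push Not at hc
    have : Finset.univ ⊆ (Finset.range (i + 1)).attach.image fun j : {j // j ∈ Finset.range (i + 1)} =>
        (⟨τ.arr 0 j, (h.order j (by have := Finset.mem_range.1 j.2; omega)).1⟩ : Fin m) := by
      intro x _
      obtain ⟨j, hj, hx⟩ := h.position x (Nat.pos_of_ne_zero (hc x))
      exact Finset.mem_image.2 ⟨⟨j, Finset.mem_range.2 (by omega)⟩, Finset.mem_attach _ _, Fin.ext hx⟩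
    have h1 := (Finset.card_le_card this).trans Finset.card_image_le
    rw [Finset.card_univ, Fintype.card_fin, Finset.card_attach, Finset.card_range] at h1
    omega
  obtain ⟨x, hx⟩ := hne
  obtain ⟨a, b, hab, ha, hb⟩ := exists_adj_mem_notMem D.isTree.connected.preconnected
    (S := {y : Fin m | 0 < τ.arr 2 y}) (x := ⟨τ.arr 0 0, h0⟩) (y := x)
    (by change 0 < τ.arr 2 (τ.arr 0 0); omega) (by change ¬ 0 < τ.arr 2 x; omega)
  have hb' : ¬ 0 < τ.arr 2 b := hb
  exact ⟨b, a, hab.symm, by omega, ha⟩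

/-- The number x * m + y encodes a pair of nodes and is at the same time its offset in the adjacency
matrix of the tree. -/
theorem ev_nextEdge (hI : InputSpec Γ D t) (h1 : τ.var 1 = n) (h2 : τ.var 2 = m)
    (h : ∃ x y : Fin m, D.tree.Adj x y ∧ τ.arr 2 x = 0 ∧ 0 < τ.arr 2 y) :
    ∃ x y : Fin m, D.tree.Adj x y ∧ τ.arr 2 x = 0 ∧ 0 < τ.arr 2 y ∧
      Ev Γ τ nextEdge (x * m + y) := by
  classical
  let P : ℕ → Prop := fun b => ∃ x y : Fin m, D.tree.Adj x y ∧ τ.arr 2 x = 0 ∧ 0 < τ.arr 2 y ∧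
    b = x * m + y
  have hP : ∃ q < m * m, P q := by
    obtain ⟨x, y, h3, h4, h5⟩ := h
    exact ⟨x * m + y, mul_add_lt x.2 y.2, x, y, h3, h4, h5, rfl⟩
  obtain ⟨q, hq, ⟨x, y, h3, h4, h5, rfl⟩, hsum⟩ := sum_prod_least hP
  refine ⟨x, y, h3, h4, h5, Ev.congr ?_ hsum⟩
  have hmm := hI.nodes_le
  refine Ev.sum ((Ev.var h2).mul (Ev.var h2)) hmm fun a ha => Ev.prod
    ((Ev.var (by rw [Env.var_setVar, if_pos rfl])).add (Ev.lit 1)) (by omega) fun b hb => ?_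
  set τ' := (τ.setVar 15 a).setVar 16 b with hτ'
  have hm' : τ'.var 2 = m := by
    rw [hτ', Env.var_setVar, if_neg (by omega), Env.var_setVar, if_neg (by omega), h2]
  have hn' : τ'.var 1 = n := by
    rw [hτ', Env.var_setVar, if_neg (by omega), Env.var_setVar, if_neg (by omega), h1]
  have eb : Ev Γ τ' (.var 16) b := Ev.var (by rw [hτ', Env.var_setVar, if_pos rfl])
  have hbm : b < m * m := by omega
  have hm0 : 0 < m := x.pos
  have hdiv : b / m < m := Nat.div_lt_of_lt_mul hbm
  have hmod : b % m < m := Nat.mod_lt _ hm0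
  have hbeq : b / m * m + b % m = b := Nat.div_add_mod' b m
  refine (Ev.ite (Ev.lit 0) (Ev.arr (j := 2) (eb.div (Ev.var hm'))) (fun _ => Ev.lit 1) fun _ =>
    Ev.ite (Ev.lit 0) (Ev.arr (j := 2) (eb.mod (Ev.var hm'))) (fun _ => (Ev.lit 1).sub
      (Ev.inp (((Ev.lit 3).add ((Ev.var hn').mul (Ev.var hn'))).add eb)
        (by rw [hI.base_eq]; omega))) fun _ => Ev.lit 1).congr ?_
  have harr : τ'.arr = τ.arr := rfl
  rw [harr]
  obtain ⟨t1, t2⟩ := hI.tree ⟨b / m, hdiv⟩ ⟨b % m, hmod⟩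
  simp only [hbeq] at t1 t2
  by_cases hPb : P b
  · rw [if_pos hPb]
    obtain ⟨x', y', k1, k2, k3, rfl⟩ := hPb
    have e1 : (x' * m + y' : ℕ) / m = x' := by
      rw [mul_comm, Nat.mul_add_div hm0, Nat.div_eq_of_lt y'.2, add_zero]
    have e2 : (x' * m + y' : ℕ) % m = y' := by
      rw [Nat.mul_add_mod_self_right, Nat.mod_eq_of_lt y'.2]
    simp only [e1, e2, Fin.eta] at t2 ⊢
    rw [if_neg (by omega), if_pos k3]
    have := t2.2 k1
    omega
  · rw [if_neg hPb]
    split_ifs with c1 c2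
    · rfl
    · have : ¬ 0 < Γ.inp (3 + n * n + b) := fun hpos =>
        hPb ⟨_, _, t2.1 hpos, Nat.eq_zero_of_not_pos c1, c2, hbeq.symm⟩
      omega
    · rfl

theorem triple_orderNodes (hI : InputSpec Γ D t) (h1 : τ.var 1 = n) (h2 : τ.var 2 = m)
    (hm : 0 < m) (h : OrderInv D 0 τ) :
    Triple Γ orderNodes τ ((m - 1) * (4 + 1) + 1) fun τ' =>
      (∀ r < 6, τ'.var r = τ.var r) ∧ τ'.arr 3 = τ.arr 3 ∧ OrderInv D (m - 1) τ' := by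
  have hb := hI.le_bits
  refine Triple.loop (fun i τ' => (∀ r < 6, τ'.var r = τ.var r) ∧ τ'.arr 3 = τ.arr 3 ∧
    OrderInv D i τ') ((Ev.var h2).sub (Ev.lit 1)) (size_le_bits (by omega))
    ⟨fun _ _ => rfl, rfl, h⟩ ?_
  rintro i hi τ' ⟨k1, k2, k3⟩
  have hn' : (τ'.setVar 6 i).var 1 = n := by
    rw [Env.var_setVar, if_neg (by omega), k1 _ (by omega), h1]
  have hm' : (τ'.setVar 6 i).var 2 = m := by
    rw [Env.var_setVar, if_neg (by omega), k1 _ (by omega), h2]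
  obtain ⟨x, y, hxy, hx, hy, ev⟩ := ev_nextEdge hI hn' hm' (k3.exists_edge (by omega))
  rw [Env.arr_setVar] at hx hy
  have e1 : (x * m + y : ℕ) / m = x := by
    rw [mul_comm, Nat.mul_add_div hm, Nat.div_eq_of_lt y.2, add_zero]
  have e2 : (x * m + y : ℕ) % m = y := by
    rw [Nat.mul_add_mod_self_right, Nat.mod_eq_of_lt y.2]
  have hq := mul_add_lt x.2 y.2
  have hmm := hI.nodes_le
  obtain ⟨p, hp, hpy⟩ := k3.position y hy
  -- Positions are stored increased by 1, with 0 for unplaced nodes; subtracting 1 gives the index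
  -- of the new node's parent.
  have hpos : τ'.arr 2 y = p + 1 := by rw [← hpy]; exact (k3.order p hp).2
  set τ₁ := (τ'.setVar 6 i).setVar 7 (x * m + y) with hτ₁
  have v6 : τ₁.var 6 = i := by
    rw [hτ₁, Env.var_setVar, if_neg (by omega), Env.var_setVar, if_pos rfl]
  have v7 : τ₁.var 7 = x * m + y := by rw [hτ₁, Env.var_setVar, if_pos rfl]
  have v2 : τ₁.var 2 = m := by rw [hτ₁, Env.var_setVar, if_neg (by omega), hm']
  have a1 : τ₁.arr = τ'.arr := rfl
  refine (Triple.seq (c := 1) (c' := 1 + (1 + 1)) (Q := fun σ => σ = τ₁)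
    (Triple.assign ev (size_le_bits (by omega)) rfl) ?_)
  rintro _ rfl
  have ex : ∀ σ : Env, σ.var = τ₁.var → Ev Γ σ (.var 7 / nodes) x := fun σ hσ =>
    ((Ev.var (by rw [hσ, v7])).div (Ev.var (by rw [hσ, v2]))).congr e1
  have ey : ∀ σ : Env, σ.var = τ₁.var → Ev Γ σ (.var 7 % nodes) y := fun σ hσ =>
    ((Ev.var (by rw [hσ, v7])).mod (Ev.var (by rw [hσ, v2]))).congr e2
  have ei : ∀ (σ : Env) (c : ℕ), σ.var = τ₁.var → Ev Γ σ (counter + .lit c) (i + c) := fun σ c hσ =>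
    (Ev.var (by rw [hσ, v6])).add (Ev.lit c)
  refine (Triple.seq (Q := fun σ => σ = τ₁.setArr 0 (i + 1) x)
    (Triple.store (ei τ₁ 1 rfl) (ex τ₁ rfl) (size_le_bits (by omega)) rfl) ?_)
  rintro _ rfl
  refine (Triple.seq (Q := fun σ => σ = (τ₁.setArr 0 (i + 1) x).setArr 1 (i + 1) p)
    (Triple.store (ei _ 1 rfl) (((Ev.arr (j := 2) (ey _ rfl)).sub (Ev.lit 1)).congr ?_)
      (size_le_bits (by omega)) rfl) ?_)
  · rw [a1, hpos, Nat.add_sub_cancel]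
  rintro _ rfl
  refine Triple.store (ex _ rfl) (ei _ 2 rfl) (size_le_bits (by omega)) ⟨fun r hr => ?_, ?_, ?_⟩
  · simp only [Env.var_setArr]
    rw [hτ₁, Env.var_setVar, if_neg (by omega), Env.var_setVar, if_neg (by omega), k1 r hr]
  · rw [Env.arr_setArr_of_ne _ (by decide), Env.arr_setArr_of_ne _ (by decide),
      Env.arr_setArr_of_ne _ (by decide), a1, k2]
  · set τ₂ := ((τ₁.setArr 0 (i + 1) x).setArr 1 (i + 1) p).setArr 2 x (i + 2) with hτ₂
    have A0 : τ₂.arr 0 = Function.update (τ'.arr 0) (i + 1) x := by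
      rw [hτ₂, Env.arr_setArr_of_ne _ (by decide), Env.arr_setArr_of_ne _ (by decide),
        Env.arr_setArr_self, a1]
    have A1 : τ₂.arr 1 = Function.update (τ'.arr 1) (i + 1) p := by
      rw [hτ₂, Env.arr_setArr_of_ne _ (by decide), Env.arr_setArr_self,
        Env.arr_setArr_of_ne _ (by decide), a1]
    have A2 : τ₂.arr 2 = Function.update (τ'.arr 2) x (i + 2) := by
      rw [hτ₂, Env.arr_setArr_self, Env.arr_setArr_of_ne _ (by decide),
        Env.arr_setArr_of_ne _ (by decide), a1]
    have hne : ∀ j ≤ i, τ'.arr 0 j ≠ x := fun j hj heq => by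
      have := (k3.order j hj).2
      rw [heq, hx] at this
      omega
    refine ⟨fun j hj => ?_, fun z hz => ?_, fun j h0 hj => ?_, fun j h0 hj => ?_, ?_⟩
    · rw [A0, A2]
      rcases Nat.eq_or_lt_of_le hj with rfl | hlt
      · rw [Function.update_self, Function.update_self]
        exact ⟨x.2, rfl⟩
      · rw [Function.update_of_ne (by omega), Function.update_of_ne (hne j (by omega))]
        exact k3.order j (by omega)
    · rw [A0]
      rw [A2] at hz
      by_cases hzx : z = x
      · exact ⟨i + 1, le_rfl, by rw [Function.update_self, hzx]⟩
      · rw [Function.update_of_ne hzx] at hz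
        obtain ⟨j, hj, hjz⟩ := k3.position z hz
        exact ⟨j, by omega, by rw [Function.update_of_ne (by omega), hjz]⟩
    · rw [A1]
      rcases Nat.eq_or_lt_of_le hj with rfl | hlt
      · rw [Function.update_self]; omega
      · rw [Function.update_of_ne (by omega)]
        exact k3.parent j h0 (by omega)
    · rw [A0, A1]
      rcases Nat.eq_or_lt_of_le hj with rfl | hlt
      · refine ⟨x, y, hxy, Function.update_self .., ?_⟩
        rw [Function.update_self, Function.update_of_ne (by omega), hpy]
      · have := k3.parent j h0 (by omega)
        have u1 : Function.update (τ'.arr 1) (i + 1) p j = τ'.arr 1 j :=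
          Function.update_of_ne (by omega) _ _
        rw [u1, Function.update_of_ne (by omega), Function.update_of_ne (by omega)]
        exact k3.adj j h0 (by omega)
    · rw [A1, Function.update_of_ne (by omega), k3.parent_zero]

end RAM

/-! ### Assembling the main statement -/

namespace RAM

variable {Γ : Ctx} {n m t : ℕ} {G : SimpleGraph (Fin n)} {D : TreeDecomposition G (Fin m)}

/-- The number `2 ^ ((n + 2) * (n + 2))` at which the generating function is evaluated. -/
def evalPoint (n : ℕ) : ℕ := 2 ^ ((n + 2) * (n + 2))

/-- The environment in which all variables and array cells are zero. -/
def Env.zero : Env := ⟨fun _ => 0, fun _ _ => 0⟩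

theorem size_two_pow (k : ℕ) : Nat.size (2 ^ k) = k + 1 := Nat.size_pow

theorem triple_readParameters (hI : InputSpec Γ D t) :
    Triple Γ readParameters Env.zero 7 fun τ => τ.var 1 = n ∧ τ.var 2 = m ∧ τ.var 3 = t ∧
      τ.var 4 = evalPoint n ∧ τ.var 5 = evalPoint n ^ (n + 1) ∧ (∀ k, τ.arr 3 k = 0) ∧
        (0 < m → OrderInv D 0 τ) := by
  have hb := hI.le_bits
  have hsq := hI.sq_le
  have hmod := hI.modulus_le
  have hsX : Nat.size (evalPoint n) ≤ Γ.bits := by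
    rw [evalPoint, size_two_pow]
    nlinarith
  have hsM : Nat.size (evalPoint n ^ (n + 1)) ≤ Γ.bits := by
    rw [evalPoint, ← pow_mul, size_two_pow]
    exact hmod
  let τ₁ := Env.zero.setVar 1 n
  let τ₂ := τ₁.setVar 2 m
  let τ₃ := τ₂.setVar 3 t
  let τ₄ := τ₃.setVar 4 (evalPoint n)
  let τ₅ := τ₄.setVar 5 (evalPoint n ^ (n + 1))
  refine Triple.seq (c := 1) (c' := 1 + (1 + (1 + (1 + (1 + 1))))) (Q := fun τ => τ = τ₁)
    (Triple.assign ((Ev.inp (Ev.lit 0) (by rw [hI.base_eq]; omega)).congr hI.inp_zero)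
      (size_le_bits (by omega)) rfl) ?_
  rintro _ rfl
  refine Triple.seq (Q := fun τ => τ = τ₂)
    (Triple.assign ((Ev.inp (Ev.lit 1) (by rw [hI.base_eq]; omega)).congr hI.inp_one)
      (size_le_bits (by omega)) rfl) ?_
  rintro _ rfl
  refine Triple.seq (Q := fun τ => τ = τ₃)
    (Triple.assign ((Ev.inp (Ev.lit 2) (by rw [hI.base_eq]; omega)).congr hI.inp_two)
      hI.target_le rfl) ?_
  rintro _ rfl
  have en : Ev Γ τ₃ vertices n := Ev.var (by simp [τ₃, τ₂, τ₁, Env.var_setVar])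
  refine Triple.seq (Q := fun τ => τ = τ₄)
    (Triple.assign ((Ev.prod (((en.add (Ev.lit 2)).mul (en.add (Ev.lit 2)))) hsq
      fun _ _ => Ev.lit 2).congr (by simp [evalPoint])) hsX rfl) ?_
  rintro _ rfl
  refine Triple.seq (Q := fun τ => τ = τ₅)
    (Triple.assign ((Ev.prod ((Ev.var (x := n) (by simp [τ₄, τ₃, τ₂, τ₁, Env.var_setVar])).add
      (Ev.lit 1)) (by omega) fun i _ => Ev.var (x := evalPoint n)
        (by simp [τ₄, Env.var_setVar])).congr (by simp)) hsM rfl) ?_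
  rintro _ rfl
  -- The order begins with node 0, which needs no write because the array starts as zero. The parent
  -- of the root is set to m, an index of no node.
  refine Triple.seq (Q := fun τ => τ = τ₅.setArr 2 0 1)
    (Triple.store (Ev.lit 0) (Ev.lit 1) (size_le_bits (by omega)) rfl) ?_
  rintro _ rfl
  refine Triple.store (Ev.lit 0) (Ev.var (x := m)
    (by simp [τ₅, τ₄, τ₃, τ₂, τ₁, Env.var_setVar])) (size_le_bits (by omega)) ?_
  have harr : τ₅.arr = fun _ _ => 0 := rfl
  simp only [Env.var_setArr]
  refine ⟨?_, ?_, ?_, ?_, ?_, fun k => ?_, fun hm => ⟨fun j hj => ?_, fun x hx => ?_,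
    fun j h0 hj => by omega, fun j h0 hj => by omega, ?_⟩⟩
  · simp [τ₅, τ₄, τ₃, τ₂, τ₁, Env.var_setVar]
  · simp [τ₅, τ₄, τ₃, τ₂, τ₁, Env.var_setVar]
  · simp [τ₅, τ₄, τ₃, τ₂, τ₁, Env.var_setVar]
  · simp [τ₅, τ₄, τ₃, τ₂, τ₁, Env.var_setVar]
  · simp [τ₅, τ₄, τ₃, τ₂, τ₁, Env.var_setVar]
  · simp [Env.arr_setArr, harr]
  · obtain rfl : j = 0 := by omega
    simp [Env.arr_setArr, harr, hm]
  · simp only [Env.arr_setArr, harr] at hx ⊢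
    have hx0 : x = 0 := by
      by_contra hne
      simp [hne] at hx
    exact ⟨0, le_rfl, by simp [hx0]⟩
  · simp [Env.arr_setArr]

theorem triple_extractResult (hI : InputSpec Γ D t) {τ : Env} (h1 : τ.var 1 = n) (h3 : τ.var 3 = t)
    (h4 : τ.var 4 = evalPoint n) (hmsg : τ.arr 3 0 = partitionFunction G (evalPoint n)) :
    Triple Γ extractResult τ 1 fun τ' => τ'.var 0 = feedbackVertexSetCount G t % 2 := by
  have hb := hI.le_bits
  have hX : evalPoint n = 2 ^ ((Fintype.card (Fin n) + 2) * (Fintype.card (Fin n) + 2)) := by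
    rw [Fintype.card_fin, evalPoint]
  -- The test t ≤ n makes t an admissible loop count and n - t a true difference; for larger t the
  -- count is 0.
  refine Triple.assign (x := feedbackVertexSetCount G t % 2) ((Ev.ite (Ev.var h1) (Ev.var h3)
    (fun _ => Ev.lit 0) fun hlt => ((((Ev.arr (j := 3) (Ev.lit 0)).div (Ev.prod (Ev.var h3)
      (by omega) fun i hi => Ev.var (x := evalPoint n) (by simp [Env.var_setVar, h4]))).mod
        (Ev.var h4)).div (Ev.prod ((Ev.var h1).sub (Ev.var h3)) (by omega)
          fun _ _ => Ev.lit 2)).mod (Ev.lit 2)).congr ?_) ?_ ?_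
  · split_ifs with hlt
    · rw [feedbackVertexSetCount_eq_zero G (by simpa using hlt)]
    · have := partitionFunction_parity G (t := t) (by rw [Fintype.card_fin]; omega) hX
      rw [Fintype.card_fin] at this
      rw [hmsg, Finset.prod_const, Finset.prod_const, Finset.card_range, Finset.card_range, this]
  · exact size_le_bits (by omega)
  · rw [Env.var_setVar, if_pos rfl]

theorem OrderInv.isGrowthOrder {τ : Env} (h : OrderInv D (m - 1) τ) {o : ℕ → Fin m}
    (ho : ∀ i < m, (o i : ℕ) = τ.arr 0 i) : IsGrowthOrder D.tree m o (τ.arr 1) where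
  inj i hi j hj hij := by
    have h1 := (h.order i (by omega)).2
    have h2 := (h.order j (by omega)).2
    have h3 : τ.arr 0 i = τ.arr 0 j := by rw [← ho i hi, ← ho j hj, hij]
    rw [h3] at h1
    omega
  par_lt i h0 hi := h.parent i h0 (by omega)
  adj i h0 hi := by
    obtain ⟨x, y, hxy, hx, hy⟩ := h.adj i h0 (by omega)
    have hp := h.parent i h0 (by omega)
    have e1 : o i = x := Fin.ext ((ho i hi).trans hx)
    have e2 : o (τ.arr 1 i) = y := Fin.ext ((ho _ (by omega)).trans hy)
    rw [e1, e2]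
    exact hxy

theorem card_bag_le (D : TreeDecomposition G (Fin m)) (x : Fin m) :
    (D.bag x).card ≤ D.width + 1 := by
  have : (D.bag x).card ≤ Finset.univ.sup fun x : Fin m => (D.bag x).card :=
    Finset.le_sup (f := fun x : Fin m => (D.bag x).card) (Finset.mem_univ x)
  rw [TreeDecomposition.width]
  omega

/-- The m ≤ `Γ.bits` nodes dominate with about 6 * 3 ^ width steps each: a factor 3 because bags
have up to width + 1 vertices, and two steps per assignment. The constant 20 leaves room for the
rest. -/
theorem triple_mainStmt (hI : InputSpec Γ D t) :
    Triple Γ mainStmt Env.zero (3 ^ D.width * (20 * Γ.bits))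
      fun τ => τ.var 0 = feedbackVertexSetCount G t % 2 := by
  have hb := hI.le_bits
  obtain ⟨x₀⟩ := D.isTree.connected.nonempty
  have hm : 0 < m := x₀.pos
  refine ((triple_readParameters hI).seq fun τ₁ h₁ =>
    (triple_orderNodes hI h₁.1 h₁.2.1 hm (h₁.2.2.2.2.2.2 hm)).seq
    (c' := m * (1 + (3 ^ (D.width + 1) * 2 + 1) + 1) + 1 + 1)
    (Q' := fun τ => τ.var 0 = feedbackVertexSetCount G t % 2) fun τ₂ h₂ => ?_).mono ?_ fun _ h => h
  · obtain ⟨v1, v2, v3, v4, v5, v6, -⟩ := h₁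
    obtain ⟨k1, k2, k3⟩ := h₂
    let o : ℕ → Fin m := fun i => ⟨τ₂.arr 0 i % m, Nat.mod_lt _ hm⟩
    have ho : ∀ i < m, (o i : ℕ) = τ₂.arr 0 i := fun i hi =>
      Nat.mod_eq_of_lt (k3.order i (by omega)).1
    have hgrow := k3.isGrowthOrder ho
    -- An injective enumeration of m out of m nodes reaches all of them.
    have hsurj : ∀ x, ∃ i < m, o i = x := by
      have hinj : Function.Injective fun i : Fin m => o i := fun i j hij =>
        Fin.ext (hgrow.inj i i.2 j j.2 hij)
      intro x
      obtain ⟨i, hi⟩ := Finite.injective_iff_surjective.1 hinj x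
      exact ⟨i, i.2, hi⟩
    let O := hgrow.decomposition hm hsurj k3.parent_zero.ge (factorPairs G) fun e he => by
      simp only [factorPairs, Finset.mem_filter] at he
      exact he.2.2
    have hd : DPEnv D O (evalPoint n) τ₂ := by
      refine ⟨by rw [k1 _ (by omega), v1], by rw [k1 _ (by omega), v2],
        by rw [k1 _ (by omega), v4], fun i hi => ⟨(k3.order i (by omega)).1, ?_⟩, fun i _ => rfl⟩
      exact congrArg D.bag (Fin.ext (ho i hi).symm)
    have hM : Nat.size (evalPoint n ^ (n + 1)) ≤ Γ.bits := by
      rw [evalPoint, ← pow_mul, size_two_pow]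
      exact hI.modulus_le
    refine (triple_computeMessages hI hd (M := evalPoint n ^ (n + 1)) (w := D.width + 1)
      (by rw [k1 _ (by omega), v5]) hM (by rw [evalPoint]; positivity)
      (fun i _ => card_bag_le D _) (by rw [k2]; exact v6)).seq fun τ₃ h₃ => ?_
    refine triple_extractResult hI ?_ ?_ ?_ ?_
    · rw [h₃.1 _ (by omega), k1 _ (by omega), v1]
    · rw [h₃.1 _ (by omega), k1 _ (by omega), v3]
    · rw [h₃.1 _ (by omega), k1 _ (by omega), v4]
    · have hlt := partitionFunction_lt G
      simp only [Fintype.card_fin] at hlt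
      exact h₃.2.message hlt
  · have hw : 1 ≤ 3 ^ D.width := Nat.one_le_pow _ _ (by omega)
    set w := 3 ^ D.width with hwdef
    have e1 : 3 ^ (D.width + 1) = 3 * w := by rw [pow_succ, hwdef]; ring
    rw [e1]
    have e2 : m ≤ w * m := Nat.le_mul_of_pos_left _ hw
    have e3 : m * (1 + (3 * w * 2 + 1) + 1) = 6 * (w * m) + 3 * m := by ring
    have e4 : w * m ≤ w * Γ.bits := Nat.mul_le_mul_left _ hb.2
    have e5 : w * (20 * Γ.bits) = 20 * (w * Γ.bits) := by ring
    have e6 : Γ.bits ≤ w * Γ.bits := Nat.le_mul_of_pos_left _ hw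
    omega

end RAM

/-! ### Positions in the encoded input -/

theorem List.getD_flatMap_map {α β : Type*} (l : List α) (l' : List β) (f : α → β → ℕ) {i j : ℕ}
    (hi : i < l.length) (hj : j < l'.length) :
    (l.flatMap fun a => l'.map (f a)).getD (i * l'.length + j) 0 = f l[i] l'[j] := by
  induction l generalizing i with
  | nil => simp at hi
  | cons a l ih =>
    rw [List.flatMap_cons]
    cases i with
    | zero => rw [List.getD_append _ _ _ _ (by simpa using hj)]; simp [List.getD, hj]
    | succ i =>
      rw [List.getD_append_right _ _ _ _ (by rw [List.length_map, Nat.succ_mul]; omega)]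
      rw [List.length_map, Nat.succ_mul,
        show i * l'.length + l'.length + j - l'.length = i * l'.length + j by omega,
        ih (by simpa using hi), List.getElem_cons_succ]

theorem length_matrixWord {n m : ℕ} (r : Fin n → Fin m → Prop) :
    (matrixWord r).length = n * m := by
  simp [matrixWord]

open Classical in
theorem matrixWord_getD {n m : ℕ} (r : Fin n → Fin m → Prop) (i : Fin n) (j : Fin m) :
    (matrixWord r).getD (i * m + j) 0 = if r i j then 1 else 0 := by
  have h := List.getD_flatMap_map (List.finRange n) (List.finRange m)
    (fun i j => if r i j then 1 else 0) (i := i) (j := j) (by simp) (by simp)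
  simpa [matrixWord] using h

section Input

variable {n m : ℕ} (G : SimpleGraph (Fin n)) (D : TreeDecomposition G (Fin m)) (t : ℕ)

theorem length_encodeInput : (encodeInput G D t).length = 3 + n * n + m * m + m * n := by
  simp only [encodeInput, List.length_append, length_matrixWord, List.length_cons, List.length_nil]

theorem encodeInput_getD_header {k : ℕ} (hk : k < 3) :
    (encodeInput G D t).getD k 0 = [n, m, t].getD k 0 := by
  rw [encodeInput, List.append_assoc, List.append_assoc, List.getD_append _ _ _ _ (by simpa using hk)]

open Classical in
theorem encodeInput_getD_adj (u v : Fin n) :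
    (encodeInput G D t).getD (3 + u * n + v) 0 = if G.Adj u v then 1 else 0 := by
  rw [← matrixWord_getD G.Adj, encodeInput, List.append_assoc, List.append_assoc,
    List.getD_append_right _ _ _ _ (by simp; omega), List.getD_append]
  · congr 1
    simp
    omega
  · have := RAM.mul_add_lt u.2 v.2
    rw [length_matrixWord]
    simp
    omega

open Classical in
theorem encodeInput_getD_tree (x y : Fin m) :
    (encodeInput G D t).getD (3 + n * n + (x * m + y)) 0 = if D.tree.Adj x y then 1 else 0 := by
  have := RAM.mul_add_lt x.2 y.2
  rw [← matrixWord_getD D.tree.Adj, encodeInput, List.append_assoc,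
    List.getD_append_right _ _ _ _ (by simp [length_matrixWord]; omega), List.getD_append]
  · congr 1
    simp [length_matrixWord]
    omega
  · simp [length_matrixWord]
    omega

theorem encodeInput_getD_bag (x : Fin m) (v : Fin n) :
    (encodeInput G D t).getD (3 + n * n + m * m + x * n + v) 0 =
      if v ∈ D.bag x then 1 else 0 := by
  refine Eq.trans ?_ ((matrixWord_getD (fun x v => v ∈ D.bag x) x v).trans (by congr))
  rw [encodeInput,
    List.getD_append_right _ _ _ _ (by simp [length_matrixWord]; omega)]
  congr 1
  simp [length_matrixWord]
  omega

end Input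

/-! ### The machine program and its running time -/

namespace RAM

theorem length_le_inputSize (l : List ℕ) : l.length ≤ inputSize l := by
  induction l with
  | nil => simp
  | cons a l ih => simp only [inputSize, List.map_cons, List.sum_cons, List.length_cons] at ih ⊢; omega

theorem size_getD_le_inputSize (l : List ℕ) (i : ℕ) : Nat.size (l.getD i 0) ≤ inputSize l := by
  induction l generalizing i with
  | nil => simp
  | cons a l ih =>
    simp only [inputSize, List.map_cons, List.sum_cons] at ih ⊢
    cases i with
    | zero => simp; omega
    | succ i => have := ih i; simp only [List.getD_cons_succ]; omega

/-- The context in which the program runs on a given input. -/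
def inputCtx (l : List ℕ) : Ctx := ⟨fun i => l.getD i 0, l.length, (inputSize l + 3) ^ 3⟩

theorem inputSize_add_le_bits (l : List ℕ) : inputSize l + 4 ≤ (inputSize l + 3) ^ 3 := by
  nlinarith [Nat.zero_le (inputSize l), sq_nonneg (inputSize l), Nat.zero_le (inputSize l ^ 3)]

theorem good_inputCtx (l : List ℕ) : (inputCtx l).Good where
  four_le := (Nat.le_add_left _ _).trans (inputSize_add_le_bits l)
  base_le := (size_le_self _).trans ((length_le_inputSize l).trans
    (le_of_add_le_left (inputSize_add_le_bits l)))
  inp_le i _ := (size_getD_le_inputSize l i).trans (le_of_add_le_left (inputSize_add_le_bits l))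

/-- The cube in `inputCtx` is needed for the modulus, which has (n + 2) * (n + 2) * (n + 1) + 1
bits; the other bounds are at most quadratic. -/
theorem inputSpec_inputCtx {n m : ℕ} (G : SimpleGraph (Fin n)) (D : TreeDecomposition G (Fin m))
    (t : ℕ) : InputSpec (inputCtx (encodeInput G D t)) D t := by
  classical
  have hN := length_le_inputSize (encodeInput G D t)
  have hsize := size_getD_le_inputSize (encodeInput G D t) 2
  have hbits := inputSize_add_le_bits (encodeInput G D t)
  have h2 : (encodeInput G D t).getD 2 0 = t := encodeInput_getD_header G D t (by omega)
  rw [h2] at hsize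
  rw [length_encodeInput] at hN
  have hn : n ≤ inputSize (encodeInput G D t) := by nlinarith
  refine ⟨length_encodeInput G D t, encodeInput_getD_header G D t (k := 0) (by omega),
    encodeInput_getD_header G D t (k := 1) (by omega), h2, fun u v => ?_, fun x y => ?_, fun x v => ?_,
    ?_, ?_, ?_, ?_⟩
  · simp only [inputCtx, encodeInput_getD_adj]
    split_ifs with h <;> simp [h]
  · simp only [inputCtx, encodeInput_getD_tree]
    split_ifs with h <;> simp [h]
  · simp only [inputCtx, encodeInput_getD_bag]
    simp [memBit]
  · simp only [inputCtx]
    calc (n + 2) * (n + 2) ≤ (inputSize (encodeInput G D t) + 3) ^ 2 := by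
          rw [pow_two]; exact Nat.mul_le_mul (by omega) (by omega)
      _ ≤ _ := Nat.pow_le_pow_right (by omega) (by omega)
  · simp only [inputCtx]
    have : 0 ≤ m * n := Nat.zero_le _
    omega
  · simp only [inputCtx]
    generalize inputSize (encodeInput G D t) = N at *
    calc (n + 2) * (n + 2) * (n + 1) + 1 ≤ (n + 3) ^ 3 := by nlinarith
      _ ≤ _ := Nat.pow_le_pow_left (by omega) _
  · simp only [inputCtx]
    omega

/-- The length of the input, computed from the first two memory cells. -/
def lengthExpr : Expr := 3 + .arr 0 0 * .arr 0 0 + .arr 1 0 * .arr 1 0 + .arr 1 0 * .arr 0 0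

/-- The program for counting feedback vertex sets modulo `2`. -/
def mainProg : Prog := .seq (lengthExpr.compile 1) <| .seq (move 1 3) (mainStmt.compile 1)

/-- The first free address is not yet known, so this phase runs in a context with base 0, in
accordance with the zero in register 1. The input itself is then seen as the four interleaved
arrays, and its first two cells are the first entries of the arrays 0 and 1. -/
theorem reaches_readLength {l : List ℕ} (hl : l.length = 3 + l.getD 0 0 * l.getD 0 0 +
    l.getD 1 0 * l.getD 1 0 + l.getD 1 0 * l.getD 0 0) :
    Reaches (lengthExpr.compile 1) (start l) ((inputCtx l).bits ^ lengthExpr.deg) fun s =>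
      s.mem = (start l).mem ∧ (∀ r, s.reg (2 * r) = 0) ∧ s.reg 3 = l.length := by
  let Γ : Ctx := ⟨fun _ => 0, 0, (inputCtx l).bits⟩
  let σ : Env := ⟨fun _ => 0, fun j i => l.getD (i * 4 + j) 0⟩
  have hrel : Rel Γ σ (start l) :=
    { good := ⟨(good_inputCtx l).four_le, by simp [Γ], by simp [Γ]⟩
      bdd := ⟨by simp [σ], fun j i => (size_getD_le_inputSize l _).trans
        (le_of_add_le_left (inputSize_add_le_bits l))⟩
      var := fun _ => rfl
      base := rfl
      inp := fun i hi => absurd hi (Nat.not_lt_zero i)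
      arr := fun _ _ => rfl }
  have e0 : Ev Γ σ (.arr 0 0) (l.getD 0 0) := (Ev.arr (j := 0) (Ev.lit 0)).congr rfl
  have e1 : Ev Γ σ (.arr 1 0) (l.getD 1 0) := (Ev.arr (j := 1) (Ev.lit 0)).congr rfl
  obtain ⟨hok, hval⟩ := (((Ev.lit 3).add (e0.mul e0)).add (e1.mul e1)).add (e1.mul e0)
  refine (lengthExpr.reaches_compile σ (start l) 1 le_rfl hrel hok).mono le_rfl ?_
  rintro s ⟨h1, h2⟩
  exact ⟨h1.mem, fun r => h1.even r, h2.trans (hval.trans hl.symm)⟩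

theorem reaches_mainProg {n m : ℕ} (G : SimpleGraph (Fin n)) (D : TreeDecomposition G (Fin m))
    (t : ℕ) {S : ℕ} (hS : S = (inputSize (encodeInput G D t) + 3) ^ 3) :
    Reaches mainProg (start (encodeInput G D t))
      (S ^ lengthExpr.deg + (S + 2 + 3 ^ D.width * (20 * S) * S ^ mainStmt.deg))
      fun s => s.reg 0 = feedbackVertexSetCount G t % 2 := by
  have hI := inputSpec_inputCtx G D t
  have hlen := length_encodeInput G D t
  have h0 : (encodeInput G D t).getD 0 0 = n := hI.inp_zero
  have h1 : (encodeInput G D t).getD 1 0 = m := hI.inp_one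
  have hbits : (inputCtx (encodeInput G D t)).bits = S := hS.symm
  have hgood := good_inputCtx (encodeInput G D t)
  rw [← hbits]
  refine (reaches_readLength (by rw [h0, h1, hlen])).seq ?_
  rintro s ⟨hmem, heven, h3⟩
  -- Compiled at depth 1, the length is left in register 3; as the first free address it belongs in
  -- register 1.
  refine ((reaches_move (d := 1) (a := 3) (by omega) s).mono
    (by rw [h3]; exact Nat.add_le_add_right hgood.base_le 2) fun _ h => h).seq ?_
  rintro s' ⟨hmem', hreg⟩
  have hrel : Rel (inputCtx (encodeInput G D t)) Env.zero s' :=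
    { good := hgood
      bdd := ⟨by simp [Env.zero], by simp [Env.zero]⟩
      var := fun r => by rw [hreg, if_neg (by omega), heven]; rfl
      base := by rw [hreg, if_pos rfl, h3]; rfl
      inp := fun i _ => by rw [hmem', hmem]; rfl
      -- Memory beyond the input is untouched, so all arrays start as zero.
      arr := fun j i => by
        rw [hmem', hmem]
        exact List.getD_eq_default _ _ (Nat.le_add_left _ _) }
  refine (triple_mainStmt hI _ 1 s' le_rfl le_rfl hrel).mono le_rfl ?_
  rintro s'' ⟨σ, hσ, hout, -⟩
  exact (hσ.var 0).trans hout

/-- Every summand is at most a multiple of S ^ (a + b + 1) * w with S = (N + 3) ^ 3, and the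
multiples add up to 24 = 1 + 1 + 2 + 20. From N ≥ 3 comes N + 3 ≤ 2 * N, hence the powers of 8. -/
theorem time_le {w N : ℕ} (hw : 1 ≤ w) (hN : 3 ≤ N) (a b : ℕ) :
    ((N + 3) ^ 3) ^ a + ((N + 3) ^ 3 + 2 + w * (20 * (N + 3) ^ 3) * ((N + 3) ^ 3) ^ b) ≤
      24 * 8 ^ (a + b + 1) * w * N ^ (3 * (a + b + 1)) := by
  have hS : (N + 3) ^ 3 ≤ 8 * N ^ 3 := by
    calc (N + 3) ^ 3 ≤ (2 * N) ^ 3 := Nat.pow_le_pow_left (by omega) _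
      _ = _ := by ring
  have h1 : 1 ≤ (N + 3) ^ 3 := Nat.one_le_pow _ _ (by omega)
  generalize (N + 3) ^ 3 = S at *
  have hle : ∀ {i}, i ≤ a + b + 1 → S ^ i ≤ S ^ (a + b + 1) * w := fun hi =>
    (Nat.pow_le_pow_right h1 hi).trans (Nat.le_mul_of_pos_right _ hw)
  have e0 := hle (Nat.zero_le _)
  have e1 := hle (i := 1) (by omega)
  have ea := hle (i := a) (by omega)
  have eb : w * (20 * S) * S ^ b ≤ 20 * (S ^ (a + b + 1) * w) := by
    calc _ = 20 * (S ^ (b + 1) * w) := by ring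
      _ ≤ _ := by gcongr; omega
  calc _ ≤ 24 * (S ^ (a + b + 1) * w) := by simp only [pow_zero, pow_one] at e0 e1; omega
    _ ≤ 24 * ((8 * N ^ 3) ^ (a + b + 1) * w) := by gcongr
    _ = _ := by rw [mul_pow, ← pow_mul]; ring

end RAM

theorem theorem4 :
    ∃ (P : RAM.Prog) (C c : ℕ),
      ∀ (n m : ℕ) (G : SimpleGraph (Fin n)) (D : TreeDecomposition G (Fin m)) (t : ℕ), 0 < t →
        RAM.OutputsWithin P (encodeInput G D t) (feedbackVertexSetCount G t % 2)
          (C * 3 ^ D.width * RAM.inputSize (encodeInput G D t) ^ c) := by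
  refine ⟨RAM.mainProg, 24 * 8 ^ (RAM.lengthExpr.deg + RAM.mainStmt.deg + 1),
    3 * (RAM.lengthExpr.deg + RAM.mainStmt.deg + 1), fun n m G D t _ => ?_⟩
  refine (RAM.reaches_mainProg G D t rfl).mono (RAM.time_le (Nat.one_le_pow _ _ (by omega)) ?_ _ _)
    fun _ h => h
  -- The three header numbers already give the input a size of at least 3.
  have h1 := RAM.length_le_inputSize (encodeInput G D t)
  rw [length_encodeInput] at h1
  omega
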